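/- Let $\mathbb K=\mathbb R$ or $\mathbb C$, let $\psi:\mathbb K\to\mathbb C^\times$ be a nontrivial continuous unitary additive character and $\chi_0:\mathbb K^\times\to\mathbb C^\times$ an arbitrary continuous character. Let $G=\mathrm{GL}_6(\mathbb K)$, let $S\subset G$ be the subgroup of all matrices (in $2\times2$ blocks) $\begin{pmatrix}1&b&d\\0&1&c\\0&0&1\end{pmatrix}\begin{pmatrix}a&0&0\\0&a&0\\0&0&a\end{pmatrix}$ with $a\in\mathrm{GL}_2(\mathbb K)$ and $b,c,d\in\mathfrak{gl}_2(\mathbb K)$, and let $\chi_S$ be the character of $S$ sending this matrix to $\chi_0(\det a)\,\psi(\mathrm{tr}(b+c))$. Let $H=S\times S$ act on $G$ by $(g_1,g_2)x=g_1xg_2^{\tau}$ ($\tau$ = transpose), and let $\chi=\chi_S\otimes\chi_S$. Give $G$ the invariant pseudo-Riemannian metric $\langle u,v\rangle_x=\mathrm{Re}\,\mathrm{tr}(x^{-1}u\,x^{-1}v)$. Definitions. Submanifolds are smooth, real and locally closed (embedded). (1) A submanifold $Z\subset G$ is *metrically proper* if for every $z\in Z$ the tangent space $T_zZ$ is contained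 in a proper nondegenerate real subspace of $T_zG$. (2) If $Z\subset G$ is an $H$-stable submanifold, a *local $H$-slice* of $Z$ is a submanifold $\mathfrak Z\subset Z$ such that the action map $H\times\mathfrak Z\to Z$ is a submersion. The $H$-stable submanifold $Z$ is *unipotently $\chi$-incompatible* if every $z_0\in Z$ lies in a local $H$-slice $\mathfrak Z$ of $Z$ for which there is a smooth map $\phi:\mathfrak Z\to H$ such that for all $z\in\mathfrak Z$: $\phi(z)z=z$; the action of $\phi(z)$ induces a unipotent map on $T_zG/T_zZ$; and $\chi(\phi(z))\ne1$. (3) An $H$-stable locally closed subset $Z\subset G$ has the *$\mathrm U_\chi\mathrm M$ property* if there is a finite filtration $Z=Z_0\supset Z_1\supset\dots\supset Z_k\supset Z_{k+1}=\emptyset$ by $H$-stable closed subsets of $Z$ such that each $Z_i\setminus Z_{i+1}$ is a submanifold of $G$ that is either unipotently $\chi$-incompatible or metrically proper. Let $Z_6$ be the set of all $x\in G$ whose lower right $4\times4$, $4\times2$, $2\times4$ and $2\times2$ blocks have ranks $3,2,2,1$ respectively, i.e. $Z_6=G_R$ with $R=\begin{bmatrix}3&2\\2&1\end{bmatrix}$.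 Let $\mathfrak Z_6$ be the set of all $x\in Z_6$ of the form $$\begin{pmatrix}*&*&*&*&x_{15}&0\\ *&*&*&*&x_{25}&0\\ *&*&0&0&x_{35}&0\\ *&*&0&0&x_{45}&0\\ x_{51}&x_{52}&x_{53}&x_{54}&0&0\\ 0&0&0&0&0&1\end{pmatrix},$$ and put $\mathfrak Z_{6,1}=\{x\in\mathfrak Z_6: x_{35}=x_{53}\}$ and $\mathfrak Z_{6,2}=\{x\in\mathfrak Z_6: x_{35}=x_{53}=0\}$. Let $\mathfrak Z_{6,2}'$ be the set of all $x\in\mathfrak Z_{6,2}$ of the form $$\begin{pmatrix}x_{11}&x_{12}&x_{13}&0&0&0\\ x_{21}&x_{22}&x_{23}&0&0&0\\ x_{31}&x_{32}&0&0&0&0\\ 0&0&0&0&1&0\\ 0&0&0&1&0&0\\ 0&0&0&0&0&1\end{pmatrix},$$ and put $\mathfrak Z_{6,3}'=\{x\in\mathfrak Z_{6,2}': x_{13}=x_{31}\}$ and $\mathfrak Z_{6,4}'=\{x\in\mathfrak Z_{6,2}': x_{13}=x_{31}=0\}$. Let $\mathfrak Z_{6,4}''$ be the set of all $x\in\mathfrak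 Z_{6,4}'$ with $x_{12}=x_{21}=x_{22}=0$, and put $\mathfrak Z_{6,5}''=\{x\in\mathfrak Z_{6,4}'': x_{23}=x_{32}\}$. Set $Z_{6,1}=H\mathfrak Z_{6,1}$, $Z_{6,2}=H\mathfrak Z_{6,2}$, $Z_{6,3}=H\mathfrak Z_{6,3}'$, $Z_{6,4}=H\mathfrak Z_{6,4}'$, $Z_{6,5}=H\mathfrak Z_{6,5}''$. **Proposition.** $Z_6$ is an $H$-stable submanifold of $G$ and has the $\mathrm U_\chi\mathrm M$ property. More precisely, $Z_6\supset Z_{6,1}\supset Z_{6,2}\supset Z_{6,3}\supset Z_{6,4}\supset Z_{6,5}\supset\emptyset$ is a filtration of $Z_6$ by $H$-stable closed subsets of $Z_6$; the submanifolds $Z_6\setminus Z_{6,1}$, $Z_{6,2}\setminus Z_{6,3}$ and $Z_{6,4}\setminus Z_{6,5}$ are unipotently $\chi$-incompatible, and the submanifolds $Z_{6,1}\setminus Z_{6,2}$, $Z_{6,3}\setminus Z_{6,4}$ and $Z_{6,5}$ are metrically proper in $G$. -/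

import Mathlib

open Matrix Topology
open scoped ContDiff MatrixGroups

/- Matrices carry a norm only so that Mathlib's calculus applies; the space is finite dimensional,
so smoothness and tangent vectors do not depend on which norm is chosen. -/
attribute [local instance] Matrix.linftyOpNormedRing Matrix.linftyOpNormedAlgebra

noncomputable section

namespace GinzburgRallis

section Submanifolds

variable {E F : Type*} [NormedAddCommGroup E] [NormedSpace ℝ E]
  [NormedAddCommGroup F] [NormedSpace ℝ F]

/-- A (locally closed, embedded, smooth) submanifold `Z` of a finite dimensional real vector space
`E`: for some codimension `d`, near each of its points `Z` is the zero set of a smooth submersion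
to `ℝ^d`.  A submanifold of an open subset `M` of `E` is the same thing as a submanifold of `E`
contained in `M`; a submanifold of a submanifold `Z` is the same thing as a submanifold of `E`
contained in `Z`. -/
def IsSubmanifold (Z : Set E) : Prop :=
  ∃ d : ℕ, ∀ z ∈ Z, ∃ (U : Set E) (f : E → EuclideanSpace ℝ (Fin d)),
    IsOpen U ∧ z ∈ U ∧ ContDiffOn ℝ ∞ f U ∧
    (∀ x ∈ U, Function.Surjective (fderiv ℝ f x)) ∧
    Z ∩ U = {x ∈ U | f x = 0}

/-- The tangent space of `Z` at `z`, as a subspace of `E`: velocities at time `0` of smooth curves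
in `Z` through `z`.  (At points of a submanifold these velocities already form a subspace, so that
taking the span adds nothing.) -/
def tangentSpaceOf (Z : Set E) (z : E) : Submodule ℝ E :=
  Submodule.span ℝ {v : E | ∃ γ : ℝ → E, ContDiffAt ℝ ∞ γ 0 ∧ γ 0 = z ∧
    (∀ᶠ t in 𝓝 (0 : ℝ), γ t ∈ Z) ∧ deriv γ 0 = v}

/-- For a map `f` that is smooth on the ambient space and maps the submanifold `A` to the
submanifold `B`, the restriction `A → B` is a submersion: at each `p ∈ A` the differential
`T_p A → T_{f p} B` is onto. -/
def IsSubmersionBetween (f : E → F) (A : Set E) (B : Set F) : Prop :=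
  ∀ p ∈ A, (tangentSpaceOf A p).map (fderiv ℝ f p).toLinearMap = tangentSpaceOf B (f p)

end Submanifolds

section Matrices

variable {𝕜 : Type*} [RCLike 𝕜] {n : Type*} [Fintype n] [DecidableEq n]

/-- `GL_n × GL_n` acts on `n × n` matrices by `(g₁, g₂) x = g₁ x g₂ᵀ`; this is the real linear map
`x ↦ g₁ x g₂ᵀ`.  As it is linear, it is also its own differential at every point. -/
def act (h : GL n 𝕜 × GL n 𝕜) : Matrix n n 𝕜 →ₗ[ℝ] Matrix n n 𝕜 where
  toFun x := (h.1 : Matrix n n 𝕜) * x * (h.2 : Matrix n n 𝕜)ᵀ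
  map_add' x y := by rw [mul_add, add_mul]
  map_smul' c x := by simp

/-- The union `H · Y` of the orbits through `Y`. -/
def saturation (H : Subgroup (GL n 𝕜 × GL n 𝕜)) (Y : Set (Matrix n n 𝕜)) :
    Set (Matrix n n 𝕜) :=
  {x | ∃ h ∈ H, ∃ y ∈ Y, act h y = x}

/-- `Z` is `H` stable. -/
def IsStable (H : Subgroup (GL n 𝕜 × GL n 𝕜)) (Z : Set (Matrix n n 𝕜)) : Prop :=
  ∀ h ∈ H, ∀ z ∈ Z, act h z ∈ Z

/-- A pair of invertible matrices, as an element of the vector space of pairs of matrices. -/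
def pairVal (h : GL n 𝕜 × GL n 𝕜) : Matrix n n 𝕜 × Matrix n n 𝕜 := (h.1, h.2)

/-- `H × Y`, as a subset of the vector space of triples of matrices.  (A closed subgroup `H` of
`GL_n × GL_n` is a submanifold of the space of pairs of matrices, and its Lie group structure is
the one that it has as such.) -/
def groupTimes (H : Subgroup (GL n 𝕜 × GL n 𝕜)) (Y : Set (Matrix n n 𝕜)) :
    Set ((Matrix n n 𝕜 × Matrix n n 𝕜) × Matrix n n 𝕜) :=
  (pairVal '' (H : Set (GL n 𝕜 × GL n 𝕜))) ×ˢ Y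

/-- `((g₁, g₂), x) ↦ g₁ x g₂ᵀ`, as a polynomial map on all triples of matrices. -/
def actionMap (p : (Matrix n n 𝕜 × Matrix n n 𝕜) × Matrix n n 𝕜) : Matrix n n 𝕜 :=
  p.1.1 * p.2 * p.1.2ᵀ

/-- `Y` is a local `H` slice of the `H` stable submanifold `Z`: a submanifold of `Z` for which the
action map `H × Y → Z` is a submersion. -/
def IsLocalSlice (H : Subgroup (GL n 𝕜 × GL n 𝕜)) (Z Y : Set (Matrix n n 𝕜)) : Prop :=
  Y ⊆ Z ∧ IsSubmanifold Y ∧ IsSubmersionBetween actionMap (groupTimes H Y) Z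

/-- The invariant pseudo-Riemannian metric on `GL_n` given by the real trace form
`⟨u, v⟩ = Re tr (u v)` on the Lie algebra: at `x`, it is
`⟨u, v⟩_x = Re tr (x⁻¹ u x⁻¹ v)`. -/
def traceMetric (x : Matrix n n 𝕜) : LinearMap.BilinForm ℝ (Matrix n n 𝕜) :=
  LinearMap.mk₂ ℝ (fun u v => RCLike.re (Matrix.trace (x⁻¹ * u * (x⁻¹ * v))))
    (fun u u' v => by simp [mul_add, add_mul])
    (fun c u v => by simp [RCLike.smul_re])
    (fun u v v' => by simp [mul_add])
    (fun c u v => by simp [RCLike.smul_re])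

/-- A submanifold `Z` of `GL_n` is metrically proper: at each of its points, its tangent space is
contained in a proper nondegenerate subspace of the tangent space of `GL_n`. -/
def IsMetricallyProper (Z : Set (Matrix n n 𝕜)) : Prop :=
  IsSubmanifold Z ∧ ∀ z ∈ Z, ∃ W : Submodule ℝ (Matrix n n 𝕜),
    tangentSpaceOf Z z ≤ W ∧ W ≠ ⊤ ∧ ((traceMetric z).restrict W).Nondegenerate

/-- `A : E → E` maps the subspace `T` to itself, and the induced map `E / T → E / T` is
unipotent. -/
def IsUnipotentOnQuotient {E : Type*} [AddCommGroup E] [Module ℝ E]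
    (A : E →ₗ[ℝ] E) (T : Submodule ℝ E) : Prop :=
  ∃ hA : T ≤ T.comap A, IsNilpotent (T.mapQ T A hA - LinearMap.id : Module.End ℝ (E ⧸ T))

/-- An `H` stable submanifold `Z` of `GL_n` is unipotently `χ`-incompatible.  The map `φ` only
matters on the local slice `Y`. -/
def IsUnipotentlyIncompatible (H : Subgroup (GL n 𝕜 × GL n 𝕜)) (χ : H →* ℂˣ)
    (Z : Set (Matrix n n 𝕜)) : Prop :=
  IsSubmanifold Z ∧ IsStable H Z ∧
  ∀ z₀ ∈ Z, ∃ Y : Set (Matrix n n 𝕜), z₀ ∈ Y ∧ IsLocalSlice H Z Y ∧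
    ∃ φ : Matrix n n 𝕜 → H,
      ContDiffOn ℝ ∞ (fun z => pairVal (φ z : GL n 𝕜 × GL n 𝕜)) Y ∧
      ∀ z ∈ Y,
        act (φ z : GL n 𝕜 × GL n 𝕜) z = z ∧
        IsUnipotentOnQuotient (act (φ z : GL n 𝕜 × GL n 𝕜)) (tangentSpaceOf Z z) ∧
        χ (φ z) ≠ 1

/-- `Z = F 0 ⊇ F 1 ⊇ ⋯ ⊇ F k ⊇ F (k + 1) = ∅`, all `F i` being `H` stable and closed in `Z`. -/
def IsStableClosedFiltration (H : Subgroup (GL n 𝕜 × GL n 𝕜)) (Z : Set (Matrix n n 𝕜)) (k : ℕ)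
    (F : ℕ → Set (Matrix n n 𝕜)) : Prop :=
  F 0 = Z ∧ F (k + 1) = ∅ ∧ (∀ i ≤ k, F (i + 1) ⊆ F i) ∧
  ∀ i ≤ k + 1, IsStable H (F i) ∧ ∃ C : Set (Matrix n n 𝕜), IsClosed C ∧ F i = Z ∩ C

/-- The `H` stable locally closed subset `Z` of `GL_n` has the `U_χ M` property. -/
def HasUChiM (H : Subgroup (GL n 𝕜 × GL n 𝕜)) (χ : H →* ℂˣ) (Z : Set (Matrix n n 𝕜)) : Prop :=
  (∀ z ∈ Z, IsUnit z) ∧ IsStable H Z ∧ IsLocallyClosed Z ∧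
  ∃ (k : ℕ) (F : ℕ → Set (Matrix n n 𝕜)), IsStableClosedFiltration H Z k F ∧
    ∀ i ≤ k, IsSubmanifold (F i \ F (i + 1)) ∧
      (IsUnipotentlyIncompatible H χ (F i \ F (i + 1)) ∨ IsMetricallyProper (F i \ F (i + 1)))

end Matrices

section GL6

variable {𝕜 : Type*} [RCLike 𝕜]

/-- The `(i, j)` block of size `2 × 2` of a `6 × 6` matrix. -/
def blk (x : Matrix (Fin 6) (Fin 6) 𝕜) (i j : Fin 3) : Matrix (Fin 2) (Fin 2) 𝕜 :=
  Matrix.of fun p q => x ⟨2 * i + p, by omega⟩ ⟨2 * j + q, by omega⟩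

theorem blk_mul (x y : Matrix (Fin 6) (Fin 6) 𝕜) (i j : Fin 3) :
    blk (x * y) i j = blk x i 0 * blk y 0 j + blk x i 1 * blk y 1 j + blk x i 2 * blk y 2 j := by
  ext p q
  simp only [blk, Matrix.of_apply, Matrix.mul_apply, Matrix.add_apply, Fin.sum_univ_six,
    Fin.sum_univ_two]
  simp [add_assoc]

theorem blk_one (i j : Fin 3) :
    blk (1 : Matrix (Fin 6) (Fin 6) 𝕜) i j = if i = j then 1 else 0 := by
  ext p q
  fin_cases i <;> fin_cases j <;> fin_cases p <;> fin_cases q <;>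
    simp [blk, Matrix.one_apply]

/-- The shape of the elements of `S`:
```
  a b d
  0 a c
  0 0 a
```
in `2 × 2` blocks. -/
def HasShapeS (x : Matrix (Fin 6) (Fin 6) 𝕜) : Prop :=
  blk x 1 0 = 0 ∧ blk x 2 0 = 0 ∧ blk x 2 1 = 0 ∧ blk x 1 1 = blk x 0 0 ∧ blk x 2 2 = blk x 0 0

variable (𝕜) in
/-- The group `S` of invertible matrices of the shape above. -/
def S : Subgroup (GL (Fin 6) 𝕜) where
  carrier := {x | HasShapeS (x : Matrix (Fin 6) (Fin 6) 𝕜)}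
  one_mem' := by simp [HasShapeS, blk_one]
  mul_mem' := by
    rintro x y ⟨h1, h2, h3, h4, h5⟩ ⟨k1, k2, k3, k4, k5⟩
    simp only [Set.mem_ofPred_eq, HasShapeS, Units.val_mul, blk_mul]
    simp [h1, h2, h3, h4, h5, k1, k2, k3, k4, k5]
  inv_mem' := by
    rintro x ⟨h1, h2, h3, h4, h5⟩
    have e : ∀ i j, blk ((x⁻¹).1 * x.1) i j =
        if i = j then 1 else 0 := fun i j => by rw [Units.inv_mul, blk_one]
    simp only [blk_mul] at e
    have e00 := e 0 0
    have e10 := e 1 0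
    have e20 := e 2 0
    have e11 := e 1 1
    have e21 := e 2 1
    have e22 := e 2 2
    simp only [h1, h2, h3, h4, h5, mul_zero, add_zero, if_true] at e00 e10 e20 e11 e21 e22
    simp only [Fin.reduceEq, if_false] at e10 e20 e21
    have r : blk (x : Matrix (Fin 6) (Fin 6) 𝕜) 0 0 *
        blk ((x⁻¹ : GL (Fin 6) 𝕜) : Matrix (Fin 6) (Fin 6) 𝕜) 0 0 = 1 :=
      mul_eq_one_comm.mp e00
    have c0 : ∀ y : Matrix (Fin 2) (Fin 2) 𝕜,
        y * blk (x : Matrix (Fin 6) (Fin 6) 𝕜) 0 0 = 0 → y = 0 := fun y hy => by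
      rw [← mul_one y, ← r, ← mul_assoc, hy, zero_mul]
    have c1 : ∀ y : Matrix (Fin 2) (Fin 2) 𝕜, y * blk (x : Matrix (Fin 6) (Fin 6) 𝕜) 0 0 = 1 →
        y = blk ((x⁻¹ : GL (Fin 6) 𝕜) : Matrix (Fin 6) (Fin 6) 𝕜) 0 0 := fun y hy => by
      rw [← mul_one y, ← r, ← mul_assoc, hy, one_mul]
    have d10 := c0 _ e10
    have d20 := c0 _ e20
    rw [d10, zero_mul, zero_add] at e11
    rw [d20, zero_mul, zero_add] at e21
    have d21 := c0 _ e21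
    rw [d20, d21, zero_mul, zero_mul, zero_add, zero_add] at e22
    exact ⟨d10, d20, d21, c1 _ e11, c1 _ e22⟩

theorem blk_mul_S (x y : S 𝕜) :
    blk (x * y).1.1 0 0 =
      blk x.1.1 0 0 * blk y.1.1 0 0 ∧
    blk (x * y).1.1 0 1 =
      blk x.1.1 0 0 * blk y.1.1 0 1 +
      blk x.1.1 0 1 * blk y.1.1 0 0 ∧
    blk (x * y).1.1 1 2 =
      blk x.1.1 0 0 * blk y.1.1 1 2 +
      blk x.1.1 1 2 * blk y.1.1 0 0 := by
  obtain ⟨x, h1, h2, h3, h4, h5⟩ := x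
  obtain ⟨y, k1, k2, k3, k4, k5⟩ := y
  simp [blk_mul, h1, h4, k1, k2, k3, k4, k5]

variable (𝕜) in
/-- The diagonal block `a` of an element of `S`. -/
def leviS : S 𝕜 →* GL (Fin 2) 𝕜 :=
  MonoidHom.toHomUnits
    { toFun := fun x => blk x.1.1 0 0
      map_one' := by simp [blk_one]
      map_mul' := fun x y => (blk_mul_S x y).1 }

theorem leviS_val (x : S 𝕜) :
    (leviS 𝕜 x : Matrix (Fin 2) (Fin 2) 𝕜) = blk x.1.1 0 0 := rfl

/-- The trace `tr (b + c)`, where the given element of `S` is written as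
```
  1 b d     a 0 0
  0 1 c  *  0 a 0
  0 0 1     0 0 a
```
so that its blocks in the positions of `b` and `c` are `b a` and `c a`. -/
def traceS (x : S 𝕜) : 𝕜 :=
  Matrix.trace ((blk x.1.1 0 1 + blk x.1.1 1 2) *
    ((leviS 𝕜 x)⁻¹).1)

theorem traceS_mul (x y : S 𝕜) : traceS (x * y) = traceS x + traceS y := by
  obtain ⟨-, h1, h2⟩ := blk_mul_S x y
  simp only [traceS, h1, h2, map_mul, _root_.mul_inv_rev, Units.val_mul, ← leviS_val]
  generalize leviS 𝕜 x = a
  generalize leviS 𝕜 y = a'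
  generalize blk x.1.1 0 1 = b
  generalize blk x.1.1 1 2 = c
  generalize blk y.1.1 0 1 = b'
  generalize blk y.1.1 1 2 = c'
  have e : (a.1 * b' + b * a'.1 + (a.1 * c' + c * a'.1)) * ((a'⁻¹).1 * (a⁻¹).1) =
      (b + c) * (a'.1 * (a'⁻¹).1) * (a⁻¹).1 + a.1 * ((b' + c') * (a'⁻¹).1) * (a⁻¹).1 := by
    noncomm_ring
  rw [e, Units.mul_inv, mul_one, Matrix.trace_add, Matrix.trace_mul_comm (a.1 * _), ← mul_assoc,
    Units.inv_mul, one_mul]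

/-- The character `χ_S` of `S` attached to a character `χ₀` of `𝕜ˣ` and an additive unitary
character `ψ` of `𝕜`: it sends the element with diagonal block `a` to
`χ₀ (det a) ψ (tr (b + c))`, with `b` and `c` as above. -/
def chiS (ψ : AddChar 𝕜 Circle) (χ₀ : 𝕜ˣ →* ℂˣ) : S 𝕜 →* ℂˣ where
  toFun x := χ₀ (Matrix.GeneralLinearGroup.det (leviS 𝕜 x)) * Circle.toUnits (ψ (traceS x))
  map_one' := by
    have h : traceS (1 : S 𝕜) = 0 := by simpa using traceS_mul (1 : S 𝕜) 1
    simp [h]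
  map_mul' x y := by
    simp only [map_mul, traceS_mul, AddChar.map_add_eq_mul]
    exact mul_mul_mul_comm _ _ _ _

variable (𝕜) in
/-- `H = S × S`. -/
def groupH : Subgroup (GL (Fin 6) 𝕜 × GL (Fin 6) 𝕜) := (S 𝕜).prod (S 𝕜)

/-- `χ = χ_S ⊗ χ_S`, i.e. `χ (g₁, g₂) = χ_S (g₁) χ_S (g₂)`. -/
def chiH (ψ : AddChar 𝕜 Circle) (χ₀ : 𝕜ˣ →* ℂˣ) : groupH 𝕜 →* ℂˣ :=
  ((chiS ψ χ₀).coprod (chiS ψ χ₀)).comp (Subgroup.prodEquiv (S 𝕜) (S 𝕜)).toMonoidHom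

/-- The rank matrix of a `6 × 6` matrix: the ranks of its lower right blocks of sizes `4 × 4`,
`4 × 2`, `2 × 4` and `2 × 2`. -/
def rankMatrix (x : Matrix (Fin 6) (Fin 6) 𝕜) : Matrix (Fin 2) (Fin 2) ℕ :=
  let r4 : Fin 4 → Fin 6 := ![2, 3, 4, 5]
  let r2 : Fin 2 → Fin 6 := ![4, 5]
  !![(x.submatrix r4 r4).rank, (x.submatrix r4 r2).rank;
     (x.submatrix r2 r4).rank, (x.submatrix r2 r2).rank]

variable (𝕜) in
/-- The set `G_R` of all invertible matrices with rank matrix `R`. -/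
def GR (R : Matrix (Fin 2) (Fin 2) ℕ) : Set (Matrix (Fin 6) (Fin 6) 𝕜) :=
  {x | IsUnit x ∧ rankMatrix x = R}

variable (𝕜) in
def Z6 : Set (Matrix (Fin 6) (Fin 6) 𝕜) := GR 𝕜 !![3, 2; 2, 1]

variable (𝕜) in
/-- The slice of `Z6`: entries that are not displayed as numbers are arbitrary. -/
def slice6 : Set (Matrix (Fin 6) (Fin 6) 𝕜) :=
  {x ∈ Z6 𝕜 | x =
    !![x 0 0, x 0 1, x 0 2, x 0 3, x 0 4, 0;
       x 1 0, x 1 1, x 1 2, x 1 3, x 1 4, 0;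
       x 2 0, x 2 1, 0,     0,     x 2 4, 0;
       x 3 0, x 3 1, 0,     0,     x 3 4, 0;
       x 4 0, x 4 1, x 4 2, x 4 3, 0,     0;
       0,     0,     0,     0,     0,     1]}

variable (𝕜) in
def slice61 : Set (Matrix (Fin 6) (Fin 6) 𝕜) := {x ∈ slice6 𝕜 | x 2 4 = x 4 2}

variable (𝕜) in
def slice62 : Set (Matrix (Fin 6) (Fin 6) 𝕜) := {x ∈ slice6 𝕜 | x 2 4 = 0 ∧ x 4 2 = 0}

variable (𝕜) in
/-- A smaller slice inside `slice62`. -/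
def slice62' : Set (Matrix (Fin 6) (Fin 6) 𝕜) :=
  {x ∈ slice62 𝕜 | x =
    !![x 0 0, x 0 1, x 0 2, 0, 0, 0;
       x 1 0, x 1 1, x 1 2, 0, 0, 0;
       x 2 0, x 2 1, 0,     0, 0, 0;
       0,     0,     0,     0, 1, 0;
       0,     0,     0,     1, 0, 0;
       0,     0,     0,     0, 0, 1]}

variable (𝕜) in
def slice63' : Set (Matrix (Fin 6) (Fin 6) 𝕜) := {x ∈ slice62' 𝕜 | x 0 2 = x 2 0}

variable (𝕜) in
def slice64' : Set (Matrix (Fin 6) (Fin 6) 𝕜) := {x ∈ slice62' 𝕜 | x 0 2 = 0 ∧ x 2 0 = 0}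

variable (𝕜) in
/-- A smaller slice inside `slice64'`. -/
def slice64'' : Set (Matrix (Fin 6) (Fin 6) 𝕜) :=
  {x ∈ slice64' 𝕜 | x =
    !![x 0 0, 0,     0,     0, 0, 0;
       0,     0,     x 1 2, 0, 0, 0;
       0,     x 2 1, 0,     0, 0, 0;
       0,     0,     0,     0, 1, 0;
       0,     0,     0,     1, 0, 0;
       0,     0,     0,     0, 0, 1]}

variable (𝕜) in
def slice65'' : Set (Matrix (Fin 6) (Fin 6) 𝕜) := {x ∈ slice64'' 𝕜 | x 1 2 = x 2 1}

variable (𝕜) in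
/-- The filtration `Z₆ ⊇ Z₆₁ ⊇ Z₆₂ ⊇ Z₆₃ ⊇ Z₆₄ ⊇ Z₆₅ ⊇ ∅`. -/
def filtration6 : ℕ → Set (Matrix (Fin 6) (Fin 6) 𝕜)
  | 0 => Z6 𝕜
  | 1 => saturation (groupH 𝕜) (slice61 𝕜)
  | 2 => saturation (groupH 𝕜) (slice62 𝕜)
  | 3 => saturation (groupH 𝕜) (slice63' 𝕜)
  | 4 => saturation (groupH 𝕜) (slice64' 𝕜)
  | 5 => saturation (groupH 𝕜) (slice65'' 𝕜)
  | _ => ∅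

end GL6

end GinzburgRallis

end

open GinzburgRallis

/-! The proof replaces orbits and slices by polynomial semi-invariants. Let `adj2` be the adjugate
of the lower right 2 × 2 block, `adj4` the upper left block of the adjugate of the lower right 4 × 4
block, and let `invB`, `invB'`, `invA`, `invA'` be the products of these adjugates with the
neighbouring blocks. Where the two determinants vanish, an adjugate annihilates the block it comes
from, so the products change under `H` only by a nonzero scalar and a conjugation
(`exists_equivariance`). The rank conditions say that two determinants vanish while `adj2` and
`adj4` do not (`Z6_eq_locus0`).

The sets of the filtration are then cut out by the traces of the four products and, at the last
step, by a Kronecker product identity; these are the sets `locus0` to `locus5`. Elimination moves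
each point into the relevant slice, where the invariants are entries of the matrix up to sign. This
identifies the saturations with the loci, and `H`-stability and relative closedness follow from the
equations. Smoothness comes from a Jacobian that is triangular along suitable directions
(`surjective_fderiv_of_triangular`); for `locus5` the last equation has to be chosen locally.

For incompatibility: if `K z K = 0`, the pair `(1 + z K, (1 - K z)ᵀ)` fixes `z`, and it acts
unipotently on the whole matrix space, hence on every quotient in question. On the first and third
strata a polynomial field `K` built from an adjugate works globally, and the argument of `ψ` is a
difference of two traces that defines the stratum (`isUnipotentlyIncompatible_of_field`). On the
fifth stratum one passes to the three parameter slice `normalForm a b c`. Two families of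
stabilizers there give the values `ψ (-(t (a + b)))` and `ψ (t (a + c))`; since `b ≠ c`, the two
sums are not both zero.

For metric properness: a matrix `Q` with `tr (Q v) = 0` on the tangent space and `tr (Q z Q z) ≠ 0`
makes the hyperplane `tr (Q u) = 0` nondegenerate (`isMetricallyProper_of_conormal`). The gradient
of the equation that equates two invariants is such a `Q`; by equivariance it has to be checked only
at normal forms, where Jacobi's formula gives it explicitly. -/

noncomputable section

namespace GinzburgRallis

/-! ### Submanifolds, tangent vectors and triangular Jacobians. -/

section Calculus

variable {E F V : Type*} [NormedAddCommGroup E] [NormedSpace ℝ E]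
  [NormedAddCommGroup F] [NormedSpace ℝ F]
  [NormedAddCommGroup V] [NormedSpace ℝ V] [FiniteDimensional ℝ V]

/-- Compose with a fixed right inverse of `L z`: the result is the identity at `z`, and invertible
endomorphisms form an open set. -/
theorem eventually_surjective {α : Type*} [TopologicalSpace α] {L : α → E →L[ℝ] V} {z : α}
    (hL : ContinuousAt L z) (hz : Function.Surjective (L z)) :
    ∀ᶠ x in 𝓝 z, Function.Surjective (L x) := by
  obtain ⟨g, hg⟩ := (L z : E →ₗ[ℝ] V).exists_rightInverse_of_surjective
    (LinearMap.range_eq_top.2 hz)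
  let G : V →L[ℝ] E := LinearMap.toContinuousLinearMap g
  have hc : ContinuousAt (fun x => (L x).comp G) z :=
    ((ContinuousLinearMap.compL ℝ V E V).flip G).continuous.continuousAt.comp hL
  have h1 : (L z).comp G = (1 : V →L[ℝ] V) := by
    ext v
    exact LinearMap.congr_fun hg v
  have hU : IsOpen {T : V →L[ℝ] V | IsUnit T} :=
    haveI := FiniteDimensional.complete ℝ V
    Units.isOpen
  filter_upwards [hc (hU.mem_nhds (by simp [h1]))] with x hx v
  obtain ⟨u, hu⟩ := hx
  refine ⟨G ((↑u⁻¹ : V →L[ℝ] V) v), ?_⟩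
  have := congrArg (fun T : V →L[ℝ] V => T v) u.mul_inv
  rw [hu] at this
  exact this

/-- Surjectivity is needed only at the point itself, since it persists on a smaller neighbourhood,
and any finite dimensional target will do, since it is isomorphic to a Euclidean space. -/
theorem isSubmanifold_of_local {Z : Set E}
    (h : ∀ z ∈ Z, ∃ (U : Set E) (f : E → V), IsOpen U ∧ z ∈ U ∧ ContDiffOn ℝ ∞ f U ∧
      Function.Surjective (fderiv ℝ f z) ∧ Z ∩ U = {x ∈ U | f x = 0}) :
    IsSubmanifold Z := by
  refine ⟨Module.finrank ℝ V, fun z hz => ?_⟩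
  obtain ⟨U, f, hU, hzU, hf, hs, hZ⟩ := h z hz
  let e : V ≃L[ℝ] EuclideanSpace ℝ (Fin (Module.finrank ℝ V)) :=
    ContinuousLinearEquiv.ofFinrankEq (by simp)
  have hc : ContinuousAt (fderiv ℝ f) z :=
    (hf.continuousOn_fderiv_of_isOpen hU (by simp)).continuousAt (hU.mem_nhds hzU)
  obtain ⟨W, hW, hWo, hzW⟩ := eventually_nhds_iff.1 (eventually_surjective hc hs)
  refine ⟨U ∩ W, e ∘ f, hU.inter hWo, ⟨hzU, hzW⟩,
    e.contDiff.comp_contDiffOn (hf.mono Set.inter_subset_left), ?_, ?_⟩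
  · intro x hx
    rw [e.comp_fderiv]
    exact e.surjective.comp (hW x hx.2)
  · ext x
    have := Set.ext_iff.1 hZ x
    simp only [Set.mem_inter_iff, Set.mem_ofPred_eq, Function.comp_apply,
      EmbeddingLike.map_eq_zero_iff] at this ⊢
    tauto

theorem isSubmanifold_of_contDiff {Z U : Set E} {f : E → V} (hU : IsOpen U)
    (hf : ContDiff ℝ ∞ f) (hs : ∀ z ∈ Z, Function.Surjective (fderiv ℝ f z))
    (hZ : Z = {x ∈ U | f x = 0}) : IsSubmanifold Z := by
  refine isSubmanifold_of_local (V := V) fun z hz =>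
    ⟨U, f, hU, by rw [hZ] at hz; exact hz.1, hf.contDiffOn, hs z hz, ?_⟩
  ext x
  simp [hZ]
  tauto

theorem IsSubmanifold.preimage_equiv {Z : Set E} (hZ : IsSubmanifold Z) (e : F ≃L[ℝ] E) :
    IsSubmanifold (e ⁻¹' Z) := by
  obtain ⟨d, hd⟩ := hZ
  refine ⟨d, fun z hz => ?_⟩
  obtain ⟨U, f, hU, hzU, hf, hs, h⟩ := hd (e z) hz
  refine ⟨e ⁻¹' U, f ∘ e, hU.preimage e.continuous, hzU,
    hf.comp e.contDiff.contDiffOn (Set.mapsTo_preimage _ _), ?_, ?_⟩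
  · intro x hx
    rw [e.comp_right_fderiv]
    exact (hs _ hx).comp e.surjective
  · rw [← Set.preimage_inter, h]
    rfl

/-- A smooth curve in `Z` through `z` with velocity `v`. -/
def IsVelocity (Z : Set E) (z v : E) : Prop :=
  ∃ γ : ℝ → E, ContDiffAt ℝ ∞ γ 0 ∧ γ 0 = z ∧ (∀ᶠ t in 𝓝 (0 : ℝ), γ t ∈ Z) ∧ deriv γ 0 = v

theorem IsVelocity.mem {Z : Set E} {z v : E} (h : IsVelocity Z z v) : v ∈ tangentSpaceOf Z z :=
  Submodule.subset_span h

theorem tangentSpaceOf_le {Z : Set E} {z : E} {W : Submodule ℝ E}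
    (h : ∀ v, IsVelocity Z z v → v ∈ W) : tangentSpaceOf Z z ≤ W :=
  Submodule.span_le.2 h

theorem IsVelocity.map {A : Set E} {B : Set F} {p v : E} (h : IsVelocity A p v) {f : E → F}
    (hf : ContDiffAt ℝ ∞ f p) (hAB : ∀ x ∈ A, f x ∈ B) :
    IsVelocity B (f p) (fderiv ℝ f p v) := by
  obtain ⟨γ, h1, h2, h3, h4⟩ := h
  subst h2
  refine ⟨f ∘ γ, hf.comp 0 h1, rfl, h3.mono fun t ht => hAB _ ht, ?_⟩
  rw [← h4]
  exact ((hf.differentiableAt (by simp)).hasFDerivAt.comp_hasDerivAt (0 : ℝ)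
    (h1.differentiableAt (by simp)).hasDerivAt).deriv

theorem tangentSpaceOf_map_le {A : Set E} {B : Set F} {p : E} {f : E → F}
    (hf : ContDiffAt ℝ ∞ f p) (hAB : ∀ x ∈ A, f x ∈ B) :
    (tangentSpaceOf A p).map (fderiv ℝ f p).toLinearMap ≤ tangentSpaceOf B (f p) := by
  rw [Submodule.map_le_iff_le_comap]
  exact tangentSpaceOf_le fun v hv => (hv.map hf hAB).mem

theorem tangentSpaceOf_map_clm_le {A : Set E} {B : Set F} {p v : E} (L : E →L[ℝ] F)
    (hAB : ∀ x ∈ A, L x ∈ B) (hv : v ∈ tangentSpaceOf A p) : L v ∈ tangentSpaceOf B (L p) := by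
  have := tangentSpaceOf_map_le (p := p) L.contDiff.contDiffAt hAB
  rw [L.fderiv] at this
  exact this ⟨v, hv, rfl⟩

theorem tangentSpaceOf_mono {A B : Set E} (h : A ⊆ B) (p : E) :
    tangentSpaceOf A p ≤ tangentSpaceOf B p :=
  fun _ hv => tangentSpaceOf_map_clm_le (ContinuousLinearMap.id ℝ E) h hv

/-- Only derivatives along curves enter, so linearized equations can be obtained from product rules
without computing a Fréchet derivative. -/
theorem IsVelocity.eq_zero {Z : Set E} {z v : E} (h : IsVelocity Z z v) {f : E → F}
    (hZ : ∀ x ∈ Z, f x = 0) {w : F}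
    (hf : ∀ γ : ℝ → E, γ 0 = z → HasDerivAt γ v 0 → HasDerivAt (f ∘ γ) w 0) : w = 0 := by
  obtain ⟨γ, h1, h2, h3, h4⟩ := h
  have h5 : HasDerivAt γ v 0 := h4 ▸ (h1.differentiableAt (by simp)).hasDerivAt
  have h6 : HasDerivAt (f ∘ γ) 0 0 :=
    (hasDerivAt_const (0 : ℝ) (0 : F)).congr_of_eventuallyEq (h3.mono fun t ht => hZ _ ht)
  exact (hf γ h2 h5).unique h6

/-- A line in `Z` gives a tangent vector. -/
theorem isVelocity_line {Z : Set E} {z v : E} (h : ∀ᶠ t in 𝓝 (0 : ℝ), z + t • v ∈ Z) :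
    IsVelocity Z z v := by
  refine ⟨fun t => z + t • v, ?_, by simp, h, ?_⟩
  · exact contDiffAt_const.add (contDiffAt_id.smul contDiffAt_const)
  · have : HasDerivAt (fun t : ℝ => z + t • v) ((1 : ℝ) • v) 0 :=
      ((hasDerivAt_id (0 : ℝ)).smul_const v).const_add z
    simpa using this.deriv

theorem hasDerivAt_line (z v : E) : HasDerivAt (fun t : ℝ => z + t • v) v 0 := by
  simpa using ((hasDerivAt_id (0 : ℝ)).smul_const v).const_add z

variable {𝕜 : Type*} [RCLike 𝕜]

/-- The differential of a family of functions is onto if it is triangular with respect to some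
directions. -/
theorem surjective_fderiv_of_triangular {k : ℕ} {f : E → Fin k → 𝕜} {z : E}
    (hf : DifferentiableAt ℝ f z) (h : ∀ i, ∃ u : 𝕜 →ₗ[ℝ] E, ∃ a : 𝕜, a ≠ 0 ∧
      (∀ c, f (z + u c) i = f z i + c * a) ∧ ∀ j < i, ∀ c, f (z + u c) j = f z j) :
    Function.Surjective (fderiv ℝ f z) := by
  -- A coordinate that is affine along a line has its slope as directional derivative.
  have key : ∀ (v : E) (j : Fin k) (b : 𝕜), (∀ t : ℝ, f (z + t • v) j = f z j + t • b) →
      fderiv ℝ f z v j = b := by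
    intro v j b hb
    have h0 := hasDerivAt_line z v
    have h1 : HasDerivAt (fun t : ℝ => f (z + t • v)) (fderiv ℝ f z v) 0 := by
      refine HasFDerivAt.comp_hasDerivAt (0 : ℝ) ?_ h0
      simpa using hf.hasFDerivAt
    have h2 := hasDerivAt_pi.1 h1 j
    have h3 : HasDerivAt (fun t : ℝ => f (z + t • v) j) b 0 := by
      simp only [hb]
      simpa using ((hasDerivAt_id (0 : ℝ)).smul_const b).const_add (f z j)
    exact h2.unique h3
  -- Back substitution: vectors supported on the last `m` coordinates are reached by induction on
  -- `m`. The new direction fixes its own coordinate, leaves the earlier ones alone, and its effect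
  -- on the later ones is corrected by the induction hypothesis.
  have main : ∀ m ≤ k, ∀ y : Fin k → 𝕜, (∀ j : Fin k, (j : ℕ) < k - m → y j = 0) →
      ∃ v, fderiv ℝ f z v = y := by
    intro m
    induction m with
    | zero =>
      intro _ y hy
      exact ⟨0, by rw [map_zero]; ext j; exact (hy j (by omega)).symm⟩
    | succ m ih =>
      intro hm y hy
      obtain ⟨u, a, ha, h1, h2⟩ := h ⟨k - (m + 1), by omega⟩
      set i : Fin k := ⟨k - (m + 1), by omega⟩ with hi
      set c : 𝕜 := y i / a with hc
      have e1 : fderiv ℝ f z (u c) i = y i := by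
        refine key _ _ _ fun t => ?_
        rw [← map_smul, h1, smul_mul_assoc, hc, div_mul_cancel₀ _ ha]
      have e2 : ∀ j < i, fderiv ℝ f z (u c) j = 0 := fun j hj =>
        key _ _ _ fun t => by rw [← map_smul, h2 j hj]; simp
      obtain ⟨v, hv⟩ := ih (by omega) (y - fderiv ℝ f z (u c)) (by
        intro j hj
        rcases lt_trichotomy j i with hji | hji | hji
        · rw [Pi.sub_apply, e2 j hji, hy j (Fin.lt_def.1 hji), sub_zero]
        · rw [hji, Pi.sub_apply, e1, sub_self]
        · have : k - (m + 1) < (j : ℕ) := hji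
          omega)
      exact ⟨v + u c, by rw [map_add, hv, sub_add_cancel]⟩
  exact fun y => main k le_rfl y fun j hj => by omega

end Calculus

end GinzburgRallis

end

noncomputable section

namespace GinzburgRallis

/-! ### The action, and metric properness from a conormal vector. -/

section Action

variable {𝕜 : Type*} [RCLike 𝕜] {n : Type*} [Fintype n] [DecidableEq n]

theorem act_apply (h : GL n 𝕜 × GL n 𝕜) (x : Matrix n n 𝕜) :
    act h x = (h.1 : Matrix n n 𝕜) * x * (h.2 : Matrix n n 𝕜)ᵀ := rfl

theorem act_mul (h k : GL n 𝕜 × GL n 𝕜) (x : Matrix n n 𝕜) :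
    act (h * k) x = act h (act k x) := by
  simp [act_apply, Matrix.transpose_mul, mul_assoc]

theorem act_one (x : Matrix n n 𝕜) : act (1 : GL n 𝕜 × GL n 𝕜) x = x := by
  simp [act_apply]

theorem act_inv_act (h : GL n 𝕜 × GL n 𝕜) (x : Matrix n n 𝕜) : act h⁻¹ (act h x) = x := by
  rw [← act_mul, inv_mul_cancel, act_one]

theorem act_act_inv (h : GL n 𝕜 × GL n 𝕜) (x : Matrix n n 𝕜) : act h (act h⁻¹ x) = x := by
  rw [← act_mul, mul_inv_cancel, act_one]

/-- The action of one element as a continuous linear equivalence. -/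
def actEquiv (h : GL n 𝕜 × GL n 𝕜) : Matrix n n 𝕜 ≃L[ℝ] Matrix n n 𝕜 :=
  LinearEquiv.toContinuousLinearEquiv
    { act h with
      invFun := act h⁻¹
      left_inv := act_inv_act h
      right_inv := act_act_inv h }

theorem IsStable.mem_iff {H : Subgroup (GL n 𝕜 × GL n 𝕜)} {Z : Set (Matrix n n 𝕜)}
    (hZ : IsStable H Z) {h : GL n 𝕜 × GL n 𝕜} (hh : h ∈ H) {z : Matrix n n 𝕜} :
    act h z ∈ Z ↔ z ∈ Z :=
  ⟨fun hz => act_inv_act h z ▸ hZ _ (H.inv_mem hh) _ hz, hZ h hh z⟩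

theorem IsStable.diff {H : Subgroup (GL n 𝕜 × GL n 𝕜)} {Z Z' : Set (Matrix n n 𝕜)}
    (hZ : IsStable H Z) (hZ' : IsStable H Z') : IsStable H (Z \ Z') :=
  fun h hh z hz => ⟨hZ h hh z hz.1, fun h' => hz.2 ((hZ'.mem_iff hh).1 h')⟩

theorem saturation_eq {H : Subgroup (GL n 𝕜 × GL n 𝕜)} {Y Z : Set (Matrix n n 𝕜)}
    (hZ : IsStable H Z) (hY : Y ⊆ Z) (h : ∀ z ∈ Z, ∃ h ∈ H, act h z ∈ Y) :
    saturation H Y = Z := by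
  ext z
  constructor
  · rintro ⟨k, hk, y, hy, rfl⟩
    exact hZ k hk y (hY hy)
  · intro hz
    obtain ⟨k, hk, hy⟩ := h z hz
    exact ⟨k⁻¹, H.inv_mem hk, _, hy, act_inv_act k z⟩

/-- A group element acts by a linear automorphism that preserves `Z`. -/
theorem tangentSpaceOf_act {H : Subgroup (GL n 𝕜 × GL n 𝕜)} {Z : Set (Matrix n n 𝕜)}
    (hZ : IsStable H Z) {h : GL n 𝕜 × GL n 𝕜} (hh : h ∈ H) {z v : Matrix n n 𝕜}
    (hv : v ∈ tangentSpaceOf Z z) : act h v ∈ tangentSpaceOf Z (act h z) :=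
  tangentSpaceOf_map_clm_le (actEquiv h : Matrix n n 𝕜 →L[ℝ] Matrix n n 𝕜)
    (fun x hx => hZ h hh x hx) hv

/-- `Q` defines a conormal vector of `Z` at `z` that is not isotropic. -/
def IsAnisotropicConormal (Z : Set (Matrix n n 𝕜)) (z Q : Matrix n n 𝕜) : Prop :=
  (∀ v ∈ tangentSpaceOf Z z, Matrix.trace (Q * v) = 0) ∧ Matrix.trace (Q * z * (Q * z)) ≠ 0

/-- The new matrix is the pullback of the functional `v ↦ tr (Q v)`. Both conditions are traces of
products, so cyclicity carries them over; this is what reduces the check to normal forms. -/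
theorem IsAnisotropicConormal.of_act {H : Subgroup (GL n 𝕜 × GL n 𝕜)} {Z : Set (Matrix n n 𝕜)}
    (hZ : IsStable H Z) {h : GL n 𝕜 × GL n 𝕜} (hh : h ∈ H) {z Q : Matrix n n 𝕜}
    (hQ : IsAnisotropicConormal Z (act h z) Q) :
    IsAnisotropicConormal Z z ((h.2 : Matrix n n 𝕜)ᵀ * Q * (h.1 : Matrix n n 𝕜)) := by
  refine ⟨fun v hv => ?_, ?_⟩
  · rw [← hQ.1 _ (tangentSpaceOf_act hZ hh hv), act_apply, mul_assoc, mul_assoc,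
      Matrix.trace_mul_comm]
    simp only [mul_assoc]
  · have := hQ.2
    rw [act_apply] at this
    rw [mul_assoc, mul_assoc, mul_assoc, Matrix.trace_mul_comm]
    simpa only [mul_assoc] using this

/-- The metric turns `Q` into the normal vector `z Q z`. A vector of the hyperplane orthogonal to
the hyperplane is also orthogonal to all multiples of this normal, and the normal lies outside the
hyperplane, so the vector is orthogonal to everything. -/
theorem isMetricallyProper_of_conormal {Z : Set (Matrix n n 𝕜)} (hZ : IsSubmanifold Z)
    (hu : ∀ z ∈ Z, IsUnit z) (h : ∀ z ∈ Z, ∃ Q, IsAnisotropicConormal Z z Q) :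
    IsMetricallyProper Z := by
  refine ⟨hZ, fun z hz => ?_⟩
  obtain ⟨Q, hQ, hQ'⟩ := h z hz
  have hdet : IsUnit z.det := (Matrix.isUnit_iff_isUnit_det z).1 (hu z hz)
  let W : Submodule ℝ (Matrix n n 𝕜) :=
    { carrier := {u | Matrix.trace (Q * u) = 0}
      zero_mem' := by simp
      add_mem' := fun {a b} ha hb => by
        simp only [Set.mem_ofPred_eq] at ha hb ⊢
        rw [mul_add, Matrix.trace_add, ha, hb, add_zero]
      smul_mem' := fun c a ha => by
        simp only [Set.mem_ofPred_eq] at ha ⊢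
        rw [mul_smul_comm, Matrix.trace_smul, ha, smul_zero] }
  have hW : ∀ u, u ∈ W ↔ Matrix.trace (Q * u) = 0 := fun u => Iff.rfl
  have hnW : z * Q * z ∉ W := by
    rw [hW]
    simpa only [mul_assoc] using hQ'
  have symm : ∀ u v, traceMetric z u v = traceMetric z v u := by
    intro u v
    simp only [traceMetric, LinearMap.mk₂_apply]
    rw [Matrix.trace_mul_comm]
  have key : ∀ w ∈ W, (∀ w' ∈ W, traceMetric z w w' = 0) → w = 0 := by
    intro w hw hw'
    have h0 : ∀ u : Matrix n n 𝕜, traceMetric z w u = 0 := by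
      intro u
      -- This is the coefficient of `u` along the normal; over `ℂ` it is complex, since the
      -- hyperplane is a complex one.
      set μ : 𝕜 := Matrix.trace (Q * u) / Matrix.trace (Q * (z * Q * z)) with hμ
      have h1 : u - μ • (z * Q * z) ∈ W := by
        rw [hW, mul_sub, Matrix.trace_sub, mul_smul_comm, Matrix.trace_smul, smul_eq_mul, hμ,
          div_mul_cancel₀ _ ((hW _).not.1 hnW), sub_self]
      have h2 := hw' _ h1
      rw [map_sub, sub_eq_zero] at h2
      rw [h2]
      simp only [traceMetric, LinearMap.mk₂_apply]
      -- The pairing of `w` with the normal reduces to `μ tr (Q w)`, which vanishes as `w` lies in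
      -- the hyperplane.
      have h3 : z⁻¹ * w * (z⁻¹ * (μ • (z * Q * z))) = μ • (z⁻¹ * (w * Q) * z) := by
        simp only [mul_smul_comm]
        congr 1
        calc z⁻¹ * w * (z⁻¹ * (z * Q * z)) = z⁻¹ * w * ((z⁻¹ * z) * Q * z) := by
              simp only [mul_assoc]
          _ = _ := by rw [Matrix.nonsing_inv_mul z hdet]; simp only [mul_assoc, one_mul]
      rw [h3, Matrix.trace_smul, Matrix.trace_mul_comm, ← mul_assoc,
        Matrix.mul_nonsing_inv z hdet, one_mul, Matrix.trace_mul_comm, (hW w).1 hw]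
      simp
    have h4 : z⁻¹ * w * z⁻¹ = 0 := by
      apply Matrix.ext_iff_trace_mul_right.2
      intro v
      rw [zero_mul, Matrix.trace_zero]
      have h5 : ∀ c : 𝕜, RCLike.re (c * Matrix.trace (z⁻¹ * w * z⁻¹ * v)) = 0 := by
        intro c
        have := h0 (c • v)
        simp only [traceMetric, LinearMap.mk₂_apply] at this
        rw [mul_smul_comm, mul_smul_comm, Matrix.trace_smul, smul_eq_mul, ← mul_assoc] at this
        exact this
      -- Multiplying by the conjugate of the trace turns the vanishing of real parts into the
      -- vanishing of a squared norm.
      have h6 := h5 (star (Matrix.trace (z⁻¹ * w * z⁻¹ * v)))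
      rw [RCLike.star_def, RCLike.conj_mul] at h6
      have h7 : ‖Matrix.trace (z⁻¹ * w * z⁻¹ * v)‖ ^ 2 = 0 := by exact_mod_cast h6
      exact norm_eq_zero.1 (pow_eq_zero_iff two_ne_zero |>.1 h7)
    calc w = (z * z⁻¹) * w * (z⁻¹ * z) := by
          rw [Matrix.nonsing_inv_mul z hdet, Matrix.mul_nonsing_inv z hdet, one_mul, mul_one]
      _ = z * (z⁻¹ * w * z⁻¹) * z := by simp only [mul_assoc]
      _ = 0 := by rw [h4, mul_zero, zero_mul]
  refine ⟨W, fun v hv => hQ v hv, fun h => hnW (h ▸ Submodule.mem_top), ?_, ?_⟩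
  · rintro ⟨w, hw⟩ hw'
    exact Subtype.ext (key w hw fun w' hw'' => hw' ⟨w', hw''⟩)
  · rintro ⟨w, hw⟩ hw'
    exact Subtype.ext (key w hw fun w' hw'' => (symm w w').trans (hw' ⟨w', hw''⟩))

end Action

/-! ### Unipotent stabilizers and translated local slices. -/

section Stabilizer

variable {𝕜 : Type*} [RCLike 𝕜] {n : Type*} [Fintype n] [DecidableEq n]

/-- If `K z K = 0`, then `(1 + z K, (1 - K z)ᵀ)` fixes `z`. -/
def stabPair (z K : Matrix n n 𝕜) (hK : K * z * K = 0) : GL n 𝕜 × GL n 𝕜 :=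
  (⟨1 + z * K, 1 - z * K, by
      have : z * K * (z * K) = 0 := by rw [mul_assoc, ← mul_assoc K, hK, mul_zero]
      noncomm_ring
      simpa [mul_assoc] using this, by
      have : z * K * (z * K) = 0 := by rw [mul_assoc, ← mul_assoc K, hK, mul_zero]
      noncomm_ring
      simpa [mul_assoc] using this⟩,
   ⟨(1 - K * z)ᵀ, (1 + K * z)ᵀ, by
      have : K * z * (K * z) = 0 := by rw [← mul_assoc, hK, zero_mul]
      rw [← Matrix.transpose_mul, ← Matrix.transpose_one]
      congr 1
      noncomm_ring
      simpa [mul_assoc] using this, by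
      have : K * z * (K * z) = 0 := by rw [← mul_assoc, hK, zero_mul]
      rw [← Matrix.transpose_mul, ← Matrix.transpose_one]
      congr 1
      noncomm_ring
      simpa [mul_assoc] using this⟩)

theorem stabPair_fst (z K : Matrix n n 𝕜) (hK : K * z * K = 0) :
    ((stabPair z K hK).1 : Matrix n n 𝕜) = 1 + z * K := rfl

theorem stabPair_snd (z K : Matrix n n 𝕜) (hK : K * z * K = 0) :
    ((stabPair z K hK).2 : Matrix n n 𝕜) = (1 - K * z)ᵀ := rfl

theorem act_stabPair (z K : Matrix n n 𝕜) (hK : K * z * K = 0) :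
    act (stabPair z K hK) z = z := by
  rw [act_apply, stabPair_fst, stabPair_snd, Matrix.transpose_transpose]
  have : z * K * z * K * z = z * (K * z * K) * z := by simp only [mul_assoc]
  rw [hK, mul_zero, zero_mul] at this
  calc (1 + z * K) * z * (1 - K * z) = z - z * K * z * K * z := by noncomm_ring
    _ = z := by rw [this, sub_zero]

/-- Left and right multiplication commute: with `L` and `R` nilpotent and commuting, the action is
`(1 + L)(1 + R)`, so minus the identity it is `L (1 + R) + R`, a sum of commuting nilpotents. -/
theorem isNilpotent_act_sub_id {h : GL n 𝕜 × GL n 𝕜}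
    (h1 : IsNilpotent ((h.1 : Matrix n n 𝕜) - 1)) (h2 : IsNilpotent ((h.2 : Matrix n n 𝕜) - 1)) :
    IsNilpotent (act h - LinearMap.id : Module.End ℝ (Matrix n n 𝕜)) := by
  let L : Module.End ℝ (Matrix n n 𝕜) := LinearMap.mulLeft ℝ ((h.1 : Matrix n n 𝕜) - 1)
  let R : Module.End ℝ (Matrix n n 𝕜) := LinearMap.mulRight ℝ ((h.2 : Matrix n n 𝕜)ᵀ - 1)
  have hL : IsNilpotent L := LinearMap.isNilpotent_mulLeft_iff ℝ _ |>.2 h1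
  have hR : IsNilpotent R := by
    refine LinearMap.isNilpotent_mulRight_iff ℝ _ |>.2 ?_
    obtain ⟨k, hk⟩ := h2
    refine ⟨k, ?_⟩
    rw [← Matrix.transpose_one, ← Matrix.transpose_sub, ← Matrix.transpose_pow, hk,
      Matrix.transpose_zero]
  have hc : Commute L R := LinearMap.commute_mulLeft_right _ _
  have e : (act h - LinearMap.id : Module.End ℝ (Matrix n n 𝕜)) = L * (1 + R) + R := by
    ext1 x
    simp only [LinearMap.sub_apply, LinearMap.id_apply, LinearMap.add_apply, Module.End.mul_apply,
      Module.End.one_apply, act_apply, L, R, LinearMap.mulLeft_apply, LinearMap.mulRight_apply]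
    noncomm_ring
  rw [e]
  have hc' : Commute L (1 + R) := (Commute.one_right L).add_right hc
  exact Commute.isNilpotent_add ((hc.mul_left ((Commute.one_left R).add_left (Commute.refl R))))
    (hc'.isNilpotent_mul_right hL) hR

theorem isUnipotentOnQuotient_of_isNilpotent {E : Type*} [AddCommGroup E] [Module ℝ E]
    {A : E →ₗ[ℝ] E} {T : Submodule ℝ E} (hA : T ≤ T.comap A)
    (h : IsNilpotent (A - LinearMap.id : Module.End ℝ E)) : IsUnipotentOnQuotient A T := by
  refine ⟨hA, ?_⟩
  obtain ⟨k, hk⟩ := h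
  have hB : T ≤ T.comap (A - LinearMap.id) := fun v hv => T.sub_mem (hA hv) hv
  have e : (T.mapQ T A hA - LinearMap.id : Module.End ℝ (E ⧸ T)) =
      T.mapQ T (A - LinearMap.id) hB := by
    ext v
    simp
  refine ⟨k, ?_⟩
  rw [e, ← Submodule.mapQ_pow]
  ext v
  simp only [hk]
  simp

theorem contDiff_transpose : ContDiff ℝ ∞ (fun x : Matrix n n 𝕜 => xᵀ) :=
  (LinearMap.toContinuousLinearMap
    (Matrix.transposeLinearEquiv n n ℝ 𝕜 : Matrix n n 𝕜 →ₗ[ℝ] Matrix n n 𝕜)).contDiff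

theorem contDiff_actionMap : ContDiff ℝ ∞ (actionMap (𝕜 := 𝕜) (n := n)) :=
  ((contDiff_fst.comp contDiff_fst).mul contDiff_snd).mul
    (contDiff_transpose.comp (contDiff_snd.comp contDiff_fst))

theorem fderiv_actionMap (g : Matrix n n 𝕜 × Matrix n n 𝕜) (x : Matrix n n 𝕜)
    (a : Matrix n n 𝕜 × Matrix n n 𝕜) (u : Matrix n n 𝕜) :
    fderiv ℝ actionMap (g, x) (a, u) =
      a.1 * x * g.2ᵀ + g.1 * u * g.2ᵀ + g.1 * x * a.2ᵀ := by
  let T : Matrix n n 𝕜 →L[ℝ] Matrix n n 𝕜 := LinearMap.toContinuousLinearMap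
    (Matrix.transposeLinearEquiv n n ℝ 𝕜 : Matrix n n 𝕜 →ₗ[ℝ] Matrix n n 𝕜)
  have h0 := hasDerivAt_line ((g, x) : (Matrix n n 𝕜 × Matrix n n 𝕜) × Matrix n n 𝕜) (a, u)
  have h1 : HasDerivAt (fun t : ℝ => actionMap (((g, x) : (Matrix n n 𝕜 × Matrix n n 𝕜) ×
      Matrix n n 𝕜) + t • (a, u))) (fderiv ℝ actionMap (g, x) (a, u)) 0 := by
    refine HasFDerivAt.comp_hasDerivAt_of_eq (0 : ℝ)
      (contDiff_actionMap.differentiable (by simp) (g, x)).hasFDerivAt h0 (by simp)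
  have h2 := ((hasDerivAt_line g.1 a.1).mul (hasDerivAt_line x u)).mul
    (T.hasFDerivAt.comp_hasDerivAt (0 : ℝ) (hasDerivAt_line g.2 a.2))
  have h3 := h1.unique h2
  rw [h3]
  simp [T, add_mul]
  abel

/-- `(X, X')` is tangent to `H` at the identity, in the strong sense that the line in its direction
runs in `H`. -/
def IsLieTangent (H : Subgroup (GL n 𝕜 × GL n 𝕜)) (X : Matrix n n 𝕜 × Matrix n n 𝕜) : Prop :=
  ∀ᶠ t in 𝓝 (0 : ℝ), (1 + t • X.1, 1 + t • X.2) ∈ pairVal '' (H : Set (GL n 𝕜 × GL n 𝕜))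

theorem mul_mem_pairVal {H : Subgroup (GL n 𝕜 × GL n 𝕜)} {h k : GL n 𝕜 × GL n 𝕜} (hh : h ∈ H)
    (hk : k ∈ H) {A B : Matrix n n 𝕜}
    (hX : (A, B) ∈ pairVal '' (H : Set (GL n 𝕜 × GL n 𝕜))) :
    ((h.1 : Matrix n n 𝕜) * A * (k.1 : Matrix n n 𝕜),
      (h.2 : Matrix n n 𝕜) * B * (k.2 : Matrix n n 𝕜)) ∈
      pairVal '' (H : Set (GL n 𝕜 × GL n 𝕜)) := by
  obtain ⟨m, hm, hmX⟩ := hX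
  simp only [pairVal, Prod.mk.injEq] at hmX
  exact ⟨h * m * k, H.mul_mem (H.mul_mem hh hm) hk, by simp [pairVal, hmX]⟩

/-- A translate of a submanifold that is transversal to the orbits is a local slice. -/
theorem isLocalSlice_preimage {H : Subgroup (GL n 𝕜 × GL n 𝕜)} {Z Y : Set (Matrix n n 𝕜)}
    (hZ : IsStable H Z) (hYZ : Y ⊆ Z) (hY : IsSubmanifold Y)
    (hT : ∀ y ∈ Y, ∀ v ∈ tangentSpaceOf Z y, ∃ X, IsLieTangent H X ∧
      v - (X.1 * y + y * X.2ᵀ) ∈ tangentSpaceOf Y y)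
    {h : GL n 𝕜 × GL n 𝕜} (hh : h ∈ H) :
    IsLocalSlice H Z {x | act h x ∈ Y} := by
  refine ⟨fun x hx => (hZ.mem_iff hh).1 (hYZ hx), hY.preimage_equiv (actEquiv h), ?_⟩
  rintro ⟨_, x⟩ ⟨⟨k, hk, rfl⟩, hx⟩
  change act h x ∈ Y at hx
  apply le_antisymm
  · refine tangentSpaceOf_map_le contDiff_actionMap.contDiffAt ?_
    rintro ⟨_, x'⟩ ⟨⟨k', hk', rfl⟩, hx'⟩
    exact hZ k' hk' x' ((hZ.mem_iff hh).1 (hYZ hx'))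
  · intro v hv
    change v ∈ tangentSpaceOf Z (act k x) at hv
    -- The tangent vector is moved from `act k x` to `act h x`, a point of `Y`, where transversality
    -- is assumed.
    have hv0 := tangentSpaceOf_act hZ (H.mul_mem hh (H.inv_mem hk)) hv
    rw [act_mul, act_mul, act_inv_act] at hv0
    obtain ⟨X, hX, hw⟩ := hT _ hx _ hv0
    set w := act h (act k⁻¹ v) - (X.1 * act h x + act h x * X.2ᵀ) with hw_def
    have hm : k * h⁻¹ ∈ H := H.mul_mem hk (H.inv_mem hh)
    -- The line `k h⁻¹ (1 + t X) h` in the group passes through `k` at `t = 0` with this velocity.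
    set V : Matrix n n 𝕜 × Matrix n n 𝕜 :=
      (((k * h⁻¹).1 : Matrix n n 𝕜) * X.1 * (h.1 : Matrix n n 𝕜),
        ((k * h⁻¹).2 : Matrix n n 𝕜) * X.2 * (h.2 : Matrix n n 𝕜)) with hV
    have hV' : IsVelocity (groupTimes H {x | act h x ∈ Y}) (pairVal k, x) (V, 0) := by
      refine isVelocity_line ?_
      filter_upwards [hX] with t ht
      refine ⟨?_, by simpa using hx⟩
      have := mul_mem_pairVal hm hh ht
      convert this using 1
      simp [pairVal, hV, mul_add, add_mul]
    -- Along this map the group coordinate stays at `k`, so it transports tangent vectors of `Y` to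
    -- tangent vectors of the product.
    let f : Matrix n n 𝕜 → (Matrix n n 𝕜 × Matrix n n 𝕜) × Matrix n n 𝕜 :=
      fun y => (pairVal k, (actEquiv h).symm y)
    have hf : HasFDerivAt f ((0 : Matrix n n 𝕜 →L[ℝ] Matrix n n 𝕜 × Matrix n n 𝕜).prod
        ((actEquiv h).symm : Matrix n n 𝕜 →L[ℝ] Matrix n n 𝕜)) (act h x) :=
      (hasFDerivAt_const _ _).prodMk (actEquiv h).symm.hasFDerivAt
    have hw' : ((0 : Matrix n n 𝕜 × Matrix n n 𝕜), act h⁻¹ w) ∈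
        tangentSpaceOf (groupTimes H {x | act h x ∈ Y}) (pairVal k, x) := by
      have h1 : ContDiffAt ℝ ∞ f (act h x) :=
        (contDiff_const.prodMk (actEquiv h).symm.contDiff).contDiffAt
      have h2 := tangentSpaceOf_map_le (B := groupTimes H {x | act h x ∈ Y}) h1 (A := Y)
        (fun y hy => ⟨⟨k, hk, rfl⟩, by
          change act h (act h⁻¹ y) ∈ Y
          rwa [act_act_inv]⟩)
      have h3 : fderiv ℝ f (act h x) w ∈ _ := h2 ⟨w, hw, rfl⟩
      have h5 : fderiv ℝ f (act h x) w = (0, act h⁻¹ w) :=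
        congrArg (fun L => L w) hf.fderiv
      rw [h5] at h3
      have h4 : f (act h x) = (pairVal k, x) := by
        change (pairVal k, act h⁻¹ (act h x)) = _
        rw [act_inv_act]
      rw [h4] at h3
      exact h3
    refine ⟨(V, 0) + (0, act h⁻¹ w), Submodule.add_mem _ hV'.mem hw', ?_⟩
    change fderiv ℝ actionMap (pairVal k, x) ((V, 0) + (0, act h⁻¹ w)) = v
    rw [map_add, fderiv_actionMap, fderiv_actionMap]
    have e1 : V.1 * x * (pairVal k).2ᵀ + (pairVal k).1 * x * V.2ᵀ =
        act (k * h⁻¹) (X.1 * act h x + act h x * X.2ᵀ) := by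
      have e3 : (h.2 : Matrix n n 𝕜)ᵀ * ((h.2⁻¹ : GL n 𝕜) : Matrix n n 𝕜)ᵀ = 1 := by
        rw [← Matrix.transpose_mul, Units.inv_mul, Matrix.transpose_one]
      have e4 : ((h.1⁻¹ : GL n 𝕜) : Matrix n n 𝕜) * (h.1 : Matrix n n 𝕜) = 1 := Units.inv_mul _
      have e5 : ∀ a : Matrix n n 𝕜, (h.2 : Matrix n n 𝕜)ᵀ *
          (((h.2⁻¹ : GL n 𝕜) : Matrix n n 𝕜)ᵀ * a) = a := fun a => by
        rw [← mul_assoc, e3, one_mul]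
      have e6 : ∀ a : Matrix n n 𝕜, ((h.1⁻¹ : GL n 𝕜) : Matrix n n 𝕜) *
          ((h.1 : Matrix n n 𝕜) * a) = a := fun a => by
        rw [← mul_assoc, e4, one_mul]
      simp only [hV, pairVal, act_apply, Prod.fst_mul, Prod.snd_mul, Prod.fst_inv, Prod.snd_inv,
        Units.val_mul, Matrix.transpose_mul, mul_add, add_mul, mul_assoc, e5, e6]
    have e2 : (pairVal k).1 * act h⁻¹ w * (pairVal k).2ᵀ = act (k * h⁻¹) w := by
      rw [act_mul]
      rfl
    have e7 : act (k * h⁻¹) (act h (act k⁻¹ v)) = v := by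
      rw [act_mul, act_inv_act, act_act_inv]
    calc _ = (V.1 * x * (pairVal k).2ᵀ + (pairVal k).1 * x * V.2ᵀ) +
          (pairVal k).1 * act h⁻¹ w * (pairVal k).2ᵀ := by simp
      _ = v := by rw [e1, e2, ← map_add, hw_def, add_sub_cancel, e7]

/-- Allows `K` to be specified only near normal forms. The stabilizer at `z` is the conjugate by `h`
of the one at `act h z`, and conjugation preserves smooth dependence, unipotency and the value of
`χ`. -/
theorem isUnipotentlyIncompatible_of_slices {H : Subgroup (GL n 𝕜 × GL n 𝕜)} {χ : H →* ℂˣ}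
    {Z : Set (Matrix n n 𝕜)} (hZm : IsSubmanifold Z) (hZ : IsStable H Z)
    (hs : ∀ z ∈ Z, ∃ h ∈ H, ∃ (Y : Set (Matrix n n 𝕜)) (K : Matrix n n 𝕜 → Matrix n n 𝕜),
      act h z ∈ Y ∧ Y ⊆ Z ∧ IsSubmanifold Y ∧
      (∀ y ∈ Y, ∀ v ∈ tangentSpaceOf Z y, ∃ X, IsLieTangent H X ∧
        v - (X.1 * y + y * X.2ᵀ) ∈ tangentSpaceOf Y y) ∧
      ContDiffOn ℝ ∞ K Y ∧
      ∀ y ∈ Y, ∃ (hK : K y * y * K y = 0) (hm : stabPair y (K y) hK ∈ H), χ ⟨_, hm⟩ ≠ 1) :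
    IsUnipotentlyIncompatible H χ Z := by
  refine ⟨hZm, hZ, fun z hz => ?_⟩
  obtain ⟨h, hh, Y, K, hzY, hYZ, hYm, hT, hKc, hK⟩ := hs z hz
  refine ⟨{x | act h x ∈ Y}, hzY, isLocalSlice_preimage hZ hYZ hYm hT hh, ?_⟩
  -- Off the translated slice the value is the identity, which is irrelevant because everything is
  -- required only on the slice.
  have ex : ∀ x : Matrix n n 𝕜, ∃ g : H, act h x ∈ Y →
      ∃ (hK' : K (act h x) * act h x * K (act h x) = 0) (hm : stabPair _ _ hK' ∈ H),
        g = ⟨h, hh⟩⁻¹ * ⟨_, hm⟩ * ⟨h, hh⟩ ∧ χ ⟨_, hm⟩ ≠ 1 := by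
    intro x
    by_cases hx : act h x ∈ Y
    · obtain ⟨hK', hm, hχ⟩ := hK _ hx
      exact ⟨_, fun _ => ⟨hK', hm, rfl, hχ⟩⟩
    · exact ⟨1, fun h' => absurd h' hx⟩
  choose φ hφ using ex
  refine ⟨φ, ?_, ?_⟩
  · have c1 : ContDiffOn ℝ ∞ (fun x : Matrix n n 𝕜 => act h x) {x | act h x ∈ Y} :=
      (actEquiv h).contDiff.contDiffOn
    have c2 : ContDiffOn ℝ ∞ (fun x : Matrix n n 𝕜 => K (act h x)) {x | act h x ∈ Y} :=
      hKc.comp c1 fun x hx => hx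
    have c3 : ContDiffOn ℝ ∞ (fun x : Matrix n n 𝕜 =>
        ((((h.1⁻¹ : GL n 𝕜) : Matrix n n 𝕜) * (1 + act h x * K (act h x)) * (h.1 : Matrix n n 𝕜),
          ((h.2⁻¹ : GL n 𝕜) : Matrix n n 𝕜) * (1 - K (act h x) * act h x)ᵀ *
            (h.2 : Matrix n n 𝕜)) : Matrix n n 𝕜 × Matrix n n 𝕜)) {x | act h x ∈ Y} :=
      ((contDiffOn_const.mul (contDiffOn_const.add (c1.mul c2))).mul contDiffOn_const).prodMk
        ((contDiffOn_const.mul (contDiff_transpose.comp_contDiffOn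
          (contDiffOn_const.sub (c2.mul c1)))).mul contDiffOn_const)
    refine c3.congr fun x hx => ?_
    obtain ⟨hK', hm, hg, -⟩ := hφ x hx
    rw [hg]
    rfl
  · intro x hx
    obtain ⟨hK', hm, hg, hχ⟩ := hφ x hx
    have hfix : act (φ x : GL n 𝕜 × GL n 𝕜) x = x := by
      rw [hg]
      change act (h⁻¹ * stabPair _ _ hK' * h) x = x
      rw [act_mul, act_mul, act_stabPair, act_inv_act]
    refine ⟨hfix, isUnipotentOnQuotient_of_isNilpotent ?_ (isNilpotent_act_sub_id ?_ ?_), ?_⟩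
    · intro v hv
      have := tangentSpaceOf_act hZ (φ x).2 hv
      rwa [hfix] at this
    · refine ⟨2, ?_⟩
      rw [hg]
      change (((h.1⁻¹ : GL n 𝕜) : Matrix n n 𝕜) * (1 + act h x * K (act h x)) *
        (h.1 : Matrix n n 𝕜) - 1) ^ 2 = 0
      set u := act h x * K (act h x) with hu
      have hu2 : u * u = 0 := by
        rw [hu, mul_assoc, ← mul_assoc (K _), hK', mul_zero]
      have e : ((h.1⁻¹ : GL n 𝕜) : Matrix n n 𝕜) * (1 + u) * (h.1 : Matrix n n 𝕜) - 1 =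
          ((h.1⁻¹ : GL n 𝕜) : Matrix n n 𝕜) * u * (h.1 : Matrix n n 𝕜) := by
        rw [mul_add, add_mul, mul_one, Units.inv_mul, add_sub_cancel_left]
      rw [e, pow_two]
      calc _ = ((h.1⁻¹ : GL n 𝕜) : Matrix n n 𝕜) * (u * ((h.1 : Matrix n n 𝕜) *
            ((h.1⁻¹ : GL n 𝕜) : Matrix n n 𝕜)) * u) * (h.1 : Matrix n n 𝕜) := by
              simp only [mul_assoc]
        _ = 0 := by rw [Units.mul_inv, mul_one, hu2, mul_zero, zero_mul]
    · refine ⟨2, ?_⟩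
      rw [hg]
      change (((h.2⁻¹ : GL n 𝕜) : Matrix n n 𝕜) * (1 - K (act h x) * act h x)ᵀ *
        (h.2 : Matrix n n 𝕜) - 1) ^ 2 = 0
      set u := (K (act h x) * act h x)ᵀ with hu
      have hu2 : u * u = 0 := by
        rw [hu, ← Matrix.transpose_mul, ← mul_assoc, hK', zero_mul, Matrix.transpose_zero]
      have e : ((h.2⁻¹ : GL n 𝕜) : Matrix n n 𝕜) * (1 - K (act h x) * act h x)ᵀ *
          (h.2 : Matrix n n 𝕜) - 1 =
          -(((h.2⁻¹ : GL n 𝕜) : Matrix n n 𝕜) * u * (h.2 : Matrix n n 𝕜)) := by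
        rw [Matrix.transpose_sub, Matrix.transpose_one, mul_sub, sub_mul, mul_one,
          Units.inv_mul]
        abel
      rw [e, pow_two, neg_mul_neg]
      calc _ = ((h.2⁻¹ : GL n 𝕜) : Matrix n n 𝕜) * (u * ((h.2 : Matrix n n 𝕜) *
            ((h.2⁻¹ : GL n 𝕜) : Matrix n n 𝕜)) * u) * (h.2 : Matrix n n 𝕜) := by
              simp only [mul_assoc]
        _ = 0 := by rw [Units.mul_inv, mul_one, hu2, mul_zero, zero_mul]
    -- A character with commutative target does not see conjugation.
    · rw [hg, map_mul, map_mul, map_inv, mul_right_comm, inv_mul_cancel, one_mul]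
      exact hχ

end Stabilizer

end GinzburgRallis

end

noncomputable section

namespace GinzburgRallis

/-! ### Semi-invariants built from adjugates, and their equivariance. -/

section Invariants

variable {𝕜 : Type*} [RCLike 𝕜]

/-- The lower right `4 × 4` block. -/
def m4 (x : Matrix (Fin 6) (Fin 6) 𝕜) : Matrix (Fin 2 ⊕ Fin 2) (Fin 2 ⊕ Fin 2) 𝕜 :=
  fromBlocks (blk x 1 1) (blk x 1 2) (blk x 2 1) (blk x 2 2)

/-- The blocks below the upper left one. -/
def colP (x : Matrix (Fin 6) (Fin 6) 𝕜) : Matrix (Fin 2 ⊕ Fin 2) (Fin 2) 𝕜 :=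
  fromRows (blk x 1 0) (blk x 2 0)

/-- The blocks to the right of the upper left one. -/
def rowP (x : Matrix (Fin 6) (Fin 6) 𝕜) : Matrix (Fin 2) (Fin 2 ⊕ Fin 2) 𝕜 :=
  fromCols (blk x 0 1) (blk x 0 2)

/-- The adjugate of the lower right `2 × 2` block. -/
def adj2 (x : Matrix (Fin 6) (Fin 6) 𝕜) : Matrix (Fin 2) (Fin 2) 𝕜 := adjugate (blk x 2 2)

/-- The upper left block of the adjugate of the lower right `4 × 4` block. -/
def adj4 (x : Matrix (Fin 6) (Fin 6) 𝕜) : Matrix (Fin 2) (Fin 2) 𝕜 :=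
  (adjugate (m4 x)).toBlocks₁₁

/-- When the corner block is singular, its adjugate annihilates it, so adding multiples of the
corner block to the block `(2, 1)` leaves this product unchanged. -/
def invB (x : Matrix (Fin 6) (Fin 6) 𝕜) : Matrix (Fin 2) (Fin 2) 𝕜 := adj2 x * blk x 2 1

def invB' (x : Matrix (Fin 6) (Fin 6) 𝕜) : Matrix (Fin 2) (Fin 2) 𝕜 := blk x 1 2 * adj2 x

/-- The same construction one size larger: by Cramer's rule the entries are 4 × 4 minors, with a
column of `m4 x` replaced by a column of `colP x`. -/
def invA (x : Matrix (Fin 6) (Fin 6) 𝕜) : Matrix (Fin 2) (Fin 2) 𝕜 :=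
  (adjugate (m4 x) * colP x).toRows₁

def invA' (x : Matrix (Fin 6) (Fin 6) 𝕜) : Matrix (Fin 2) (Fin 2) 𝕜 :=
  (rowP x * adjugate (m4 x)).toCols₁

theorem blk_transpose (x : Matrix (Fin 6) (Fin 6) 𝕜) (i j : Fin 3) :
    blk xᵀ i j = (blk x j i)ᵀ := rfl

theorem blk_ext {x y : Matrix (Fin 6) (Fin 6) 𝕜} (h : ∀ i j, blk x i j = blk y i j) : x = y := by
  ext i j
  have := congrFun (congrFun (h ⟨i / 2, by omega⟩ ⟨j / 2, by omega⟩) ⟨i % 2, by omega⟩)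
    ⟨j % 2, by omega⟩
  simp only [blk, Matrix.of_apply] at this
  convert this using 1 <;> congr 1 <;> ext <;> simp <;> omega

theorem HasShapeS.m4_eq {g : Matrix (Fin 6) (Fin 6) 𝕜} (hg : HasShapeS g) :
    m4 g = fromBlocks (blk g 0 0) (blk g 1 2) 0 (blk g 0 0) := by
  obtain ⟨h1, h2, h3, h4, h5⟩ := hg
  rw [m4, h3, h4, h5]

theorem HasShapeS.m4_mul {g k : Matrix (Fin 6) (Fin 6) 𝕜} (hg : HasShapeS g) (hk : HasShapeS k)
    (x : Matrix (Fin 6) (Fin 6) 𝕜) : m4 (g * x * kᵀ) = m4 g * m4 x * (m4 k)ᵀ := by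
  rw [hg.m4_eq, hk.m4_eq]
  obtain ⟨h1, h2, h3, h4, h5⟩ := hg
  obtain ⟨k1, k2, k3, k4, k5⟩ := hk
  simp only [m4, fromBlocks_transpose, fromBlocks_multiply, blk_mul, blk_transpose, h1, h2, h3, h4,
    h5, k1, k2, k3, k4, k5, zero_mul, mul_zero, zero_add, add_zero, Matrix.transpose_zero]

/-- The right factor adds combinations of the columns of `m4 x`, which its adjugate will kill when
`m4 x` is singular. Only the first block row of `k` enters, so nothing is assumed about `k`. -/
theorem HasShapeS.colP_mul {g k : Matrix (Fin 6) (Fin 6) 𝕜} (hg : HasShapeS g)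
    (x : Matrix (Fin 6) (Fin 6) 𝕜) : colP (g * x * kᵀ) =
      m4 g * (colP x * (blk k 0 0)ᵀ + m4 x * fromRows (blk k 0 1)ᵀ (blk k 0 2)ᵀ) := by
  rw [hg.m4_eq]
  obtain ⟨h1, h2, h3, h4, h5⟩ := hg
  simp only [colP, m4, fromRows_mul, fromBlocks_mul_fromRows, blk_mul, blk_transpose, h1, h2, h3,
    h4, h5, zero_mul, zero_add, Matrix.mul_add, Matrix.add_mul, Matrix.mul_assoc, Matrix.zero_mul]
  ext (i | i) j
  · simp only [fromRows_apply_inl, Matrix.add_apply]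
    abel
  · simp only [fromRows_apply_inr, Matrix.add_apply]
    abel

theorem m4_transpose (x : Matrix (Fin 6) (Fin 6) 𝕜) : m4 xᵀ = (m4 x)ᵀ := by
  simp [m4, fromBlocks_transpose, blk_transpose]

theorem adj2_transpose (x : Matrix (Fin 6) (Fin 6) 𝕜) : adj2 xᵀ = (adj2 x)ᵀ := by
  simp [adj2, blk_transpose, adjugate_transpose]

/-- Transposition exchanges the two factors of `H` and the primed and unprimed invariants, so each
computation needs to be done only once. -/
theorem invB'_eq (x : Matrix (Fin 6) (Fin 6) 𝕜) : invB' x = (invB xᵀ)ᵀ := by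
  simp [invB, invB', adj2_transpose, blk_transpose, Matrix.transpose_mul]

theorem invA'_eq (x : Matrix (Fin 6) (Fin 6) 𝕜) : invA' x = (invA xᵀ)ᵀ := by
  have h : colP xᵀ = (rowP x)ᵀ := by
    rw [rowP, transpose_fromCols]
    rfl
  rw [invA, m4_transpose, ← adjugate_transpose, h, ← Matrix.transpose_mul]
  rfl

section Equivariance

variable {g k : Matrix (Fin 6) (Fin 6) 𝕜}

theorem blk22_act (hg : HasShapeS g) (hk : HasShapeS k)
    (x : Matrix (Fin 6) (Fin 6) 𝕜) :
    blk (g * x * kᵀ) 2 2 = blk g 0 0 * blk x 2 2 * (blk k 0 0)ᵀ := by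
  obtain ⟨h1, h2, h3, h4, h5⟩ := hg
  obtain ⟨k1, k2, k3, k4, k5⟩ := hk
  simp [blk_mul, blk_transpose, h2, h3, h5, k2, k3, k5]

theorem blk21_act (hg : HasShapeS g) (hk : HasShapeS k)
    (x : Matrix (Fin 6) (Fin 6) 𝕜) : blk (g * x * kᵀ) 2 1 =
    blk g 0 0 * (blk x 2 1 * (blk k 0 0)ᵀ + blk x 2 2 * (blk k 1 2)ᵀ) := by
  obtain ⟨h1, h2, h3, h4, h5⟩ := hg
  obtain ⟨k1, k2, k3, k4, k5⟩ := hk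
  simp [blk_mul, blk_transpose, h2, h3, h5, k1, k4, mul_add, mul_assoc]

theorem adj2_act (hg : HasShapeS g) (hk : HasShapeS k)
    (x : Matrix (Fin 6) (Fin 6) 𝕜) : adj2 (g * x * kᵀ) =
    (adjugate (blk k 0 0))ᵀ * adj2 x * adjugate (blk g 0 0) := by
  rw [adj2, blk22_act hg hk, adjugate_mul_distrib, adjugate_mul_distrib, adjugate_transpose,
    mul_assoc]
  rfl

/-- The extra term produced by the right factor contains `adj2 x * blk x 2 2`, which is the
determinant times the identity and hence zero. -/
theorem invB_act (hg : HasShapeS g) (hk : HasShapeS k)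
    {x : Matrix (Fin 6) (Fin 6) 𝕜} (hx : (blk x 2 2).det = 0) :
    invB (g * x * kᵀ) = (blk g 0 0).det •
      ((adjugate (blk k 0 0))ᵀ * invB x * (blk k 0 0)ᵀ) := by
  have h : adj2 x * blk x 2 2 = 0 := by rw [adj2, adjugate_mul, hx, zero_smul]
  rw [invB, adj2_act hg hk, blk21_act hg hk, mul_assoc, ← mul_assoc (adjugate (blk g 0 0)),
    adjugate_mul, smul_mul_assoc, one_mul, mul_smul_comm, mul_add, mul_assoc, mul_assoc,
    ← mul_assoc (adj2 x) (blk x 2 2), h, zero_mul, invB]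
  simp [mul_assoc]

/-- Block triangular with equal diagonal blocks: compare the first block column in `adjugate M * M =
det M • 1` and cancel the nonzero determinant. -/
theorem adjugate_m4_shape (hg : HasShapeS g) (h0 : (blk g 0 0).det ≠ 0) :
    (adjugate (m4 g)).toBlocks₁₁ = (blk g 0 0).det • adjugate (blk g 0 0) ∧
    (adjugate (m4 g)).toBlocks₂₁ = 0 := by
  have h1 : adjugate (m4 g) * m4 g = (m4 g).det • 1 := adjugate_mul _
  have h2 : (m4 g).det = (blk g 0 0).det * (blk g 0 0).det := by
    rw [hg.m4_eq, det_fromBlocks_zero₂₁]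
  rw [h2, hg.m4_eq, ← fromBlocks_toBlocks (adjugate (fromBlocks _ _ _ _)), fromBlocks_multiply,
    ← fromBlocks_one, fromBlocks_smul, fromBlocks_inj, ← hg.m4_eq] at h1
  simp only [mul_zero, add_zero, smul_zero] at h1
  obtain ⟨h3, -, h4, -⟩ := h1
  have key : ∀ u : Matrix (Fin 2) (Fin 2) 𝕜, (blk g 0 0).det • u =
      u * blk g 0 0 * adjugate (blk g 0 0) := fun u => by
    rw [mul_assoc, mul_adjugate, mul_smul_comm, mul_one]
  constructor
  · have := key (adjugate (m4 g)).toBlocks₁₁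
    rw [h3, smul_mul_assoc, one_mul, mul_smul] at this
    exact smul_right_injective _ h0 this
  · have := key (adjugate (m4 g)).toBlocks₂₁
    rw [h4, zero_mul, smul_eq_zero] at this
    exact this.resolve_left h0

theorem adjugate_m4_act (hg : HasShapeS g) (hk : HasShapeS k)
    (x : Matrix (Fin 6) (Fin 6) 𝕜) : adjugate (m4 (g * x * kᵀ)) =
    (adjugate (m4 k))ᵀ * adjugate (m4 x) * adjugate (m4 g) := by
  rw [hg.m4_mul hk, adjugate_mul_distrib, adjugate_mul_distrib, adjugate_transpose, mul_assoc]

theorem toRows₁_transpose_adjugate_mul (hk : HasShapeS k) (h0 : (blk k 0 0).det ≠ 0) {l : Type*}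
    (u : Matrix (Fin 2 ⊕ Fin 2) l 𝕜) :
    ((adjugate (m4 k))ᵀ * u).toRows₁ =
      (blk k 0 0).det • ((adjugate (blk k 0 0))ᵀ * u.toRows₁) := by
  obtain ⟨h1, h2⟩ := adjugate_m4_shape hk h0
  rw [← fromBlocks_toBlocks (adjugate (m4 k)), h1, h2, fromBlocks_transpose,
    ← fromRows_toRows u, fromBlocks_mul_fromRows]
  ext i j
  simp [toRows₁]

/-- The adjugates of the outer factors are block triangular in such a way that the upper left block
of the product sees only the upper left blocks. -/
theorem adj4_act (hg : HasShapeS g) (hk : HasShapeS k)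
    (hg0 : (blk g 0 0).det ≠ 0) (hk0 : (blk k 0 0).det ≠ 0)
    (x : Matrix (Fin 6) (Fin 6) 𝕜) : adj4 (g * x * kᵀ) =
    ((blk g 0 0).det * (blk k 0 0).det) •
      ((adjugate (blk k 0 0))ᵀ * adj4 x * adjugate (blk g 0 0)) := by
  obtain ⟨g1, g2⟩ := adjugate_m4_shape hg hg0
  obtain ⟨k1, k2⟩ := adjugate_m4_shape hk hk0
  rw [adj4, adjugate_m4_act hg hk, ← fromBlocks_toBlocks (adjugate (m4 k)),
    ← fromBlocks_toBlocks (adjugate (m4 g)), ← fromBlocks_toBlocks (adjugate (m4 x)), g1, g2, k1,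
    k2, fromBlocks_transpose, fromBlocks_multiply, fromBlocks_multiply, toBlocks_fromBlocks₁₁]
  simp [adj4, smul_smul]

/-- As for `invB`: the term that contains `m4 x` is annihilated by `adjugate (m4 x)`. -/
theorem invA_act (hg : HasShapeS g) (hk : HasShapeS k)
    (hk0 : (blk k 0 0).det ≠ 0) {x : Matrix (Fin 6) (Fin 6) 𝕜}
    (hx : (m4 x).det = 0) : invA (g * x * kᵀ) =
    ((blk g 0 0).det * (blk g 0 0).det * (blk k 0 0).det) •
      ((adjugate (blk k 0 0))ᵀ * invA x * (blk k 0 0)ᵀ) := by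
  have h : adjugate (m4 x) * m4 x = 0 := by rw [adjugate_mul, hx, zero_smul]
  have h2 : (m4 g).det = (blk g 0 0).det * (blk g 0 0).det := by
    rw [hg.m4_eq, det_fromBlocks_zero₂₁]
  have e : adjugate (m4 (g * x * kᵀ)) * colP (g * x * kᵀ) =
      (adjugate (m4 k))ᵀ * ((m4 g).det • (adjugate (m4 x) * colP x * (blk k 0 0)ᵀ)) := by
    rw [adjugate_m4_act hg hk, hg.colP_mul]
    calc _ = (adjugate (m4 k))ᵀ * (adjugate (m4 x) * ((adjugate (m4 g) * m4 g) *
          (colP x * (blk k 0 0)ᵀ + m4 x * fromRows (blk k 0 1)ᵀ (blk k 0 2)ᵀ))) := by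
          simp only [Matrix.mul_assoc]
      _ = (adjugate (m4 k))ᵀ * ((m4 g).det • (adjugate (m4 x) * colP x * (blk k 0 0)ᵀ +
          (adjugate (m4 x) * m4 x) * fromRows (blk k 0 1)ᵀ (blk k 0 2)ᵀ)) := by
          rw [adjugate_mul]
          simp only [Matrix.smul_mul, Matrix.mul_smul, Matrix.mul_add, Matrix.mul_assoc,
            Matrix.one_mul, smul_add]
      _ = _ := by rw [h, Matrix.zero_mul, add_zero]
  have e' : (((m4 g).det • (adjugate (m4 x) * colP x * (blk k 0 0)ᵀ))).toRows₁ =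
      (m4 g).det • (invA x * (blk k 0 0)ᵀ) := rfl
  rw [invA, e, toRows₁_transpose_adjugate_mul hk hk0, e', h2, Matrix.mul_smul, smul_smul,
    Matrix.mul_assoc, mul_comm (_ * _)]

end Equivariance

theorem HasShapeS.det_blk {g : GL (Fin 6) 𝕜} (hg : g ∈ S 𝕜) :
    (blk (g : Matrix (Fin 6) (Fin 6) 𝕜) 0 0).det ≠ 0 :=
  ((Matrix.isUnit_iff_isUnit_det _).1 (leviS 𝕜 ⟨g, hg⟩).isUnit).ne_zero

theorem adjugate_eq_smul_inv {n : Type*} [Fintype n] [DecidableEq n] (a : Matrix n n 𝕜)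
    (ha : a.det ≠ 0) : adjugate a = a.det • a⁻¹ := by
  rw [Matrix.inv_def, smul_smul, Ring.mul_inverse_cancel _ (isUnit_iff_ne_zero.2 ha), one_smul]

/-- How the semi-invariants change under the action of `H`. -/
theorem exists_equivariance {h : GL (Fin 6) 𝕜 × GL (Fin 6) 𝕜} (hh : h ∈ groupH 𝕜) :
    ∃ (a b : Matrix (Fin 2) (Fin 2) 𝕜) (e : 𝕜), a.det ≠ 0 ∧ b.det ≠ 0 ∧ e ≠ 0 ∧
      ∀ x : Matrix (Fin 6) (Fin 6) 𝕜,
      (blk (act h x) 2 2).det = e * (blk x 2 2).det ∧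
      (m4 (act h x)).det = e ^ 2 * (m4 x).det ∧
      adj2 (act h x) = e • ((b⁻¹)ᵀ * adj2 x * a⁻¹) ∧
      adj4 (act h x) = e ^ 2 • ((b⁻¹)ᵀ * adj4 x * a⁻¹) ∧
      ((blk x 2 2).det = 0 → invB (act h x) = e • ((b⁻¹)ᵀ * invB x * bᵀ) ∧
        invB' (act h x) = e • (a * invB' x * a⁻¹)) ∧
      ((m4 x).det = 0 → invA (act h x) = e ^ 2 • ((b⁻¹)ᵀ * invA x * bᵀ) ∧
        invA' (act h x) = e ^ 2 • (a * invA' x * a⁻¹)) := by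
  obtain ⟨hg, hk⟩ := hh
  have hg0 := HasShapeS.det_blk hg
  have hk0 := HasShapeS.det_blk hk
  change HasShapeS _ at hg
  change HasShapeS _ at hk
  refine ⟨blk (h.1 : Matrix (Fin 6) (Fin 6) 𝕜) 0 0, blk (h.2 : Matrix (Fin 6) (Fin 6) 𝕜) 0 0,
    (blk (h.1 : Matrix (Fin 6) (Fin 6) 𝕜) 0 0).det * (blk (h.2 : Matrix (Fin 6) (Fin 6) 𝕜) 0 0).det,
    hg0, hk0, mul_ne_zero hg0 hk0, fun x => ?_⟩
  rw [act_apply]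
  have tr : ((h.1 : Matrix (Fin 6) (Fin 6) 𝕜) * x * (h.2 : Matrix (Fin 6) (Fin 6) 𝕜)ᵀ)ᵀ =
      (h.2 : Matrix (Fin 6) (Fin 6) 𝕜) * xᵀ * (h.1 : Matrix (Fin 6) (Fin 6) 𝕜)ᵀ := by
    simp [Matrix.transpose_mul, mul_assoc]
  refine ⟨?_, ?_, ?_, ?_, fun hx => ⟨?_, ?_⟩, fun hx => ⟨?_, ?_⟩⟩
  · rw [blk22_act hg hk, det_mul, det_mul, det_transpose]
    ring
  · rw [hg.m4_mul hk, det_mul, det_mul, det_transpose, hg.m4_eq, hk.m4_eq, det_fromBlocks_zero₂₁,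
      det_fromBlocks_zero₂₁]
    ring
  · rw [adj2_act hg hk, adjugate_eq_smul_inv _ hg0, adjugate_eq_smul_inv _ hk0]
    simp [smul_smul]
  · rw [adj4_act hg hk hg0 hk0, adjugate_eq_smul_inv _ hg0, adjugate_eq_smul_inv _ hk0]
    simp only [Matrix.transpose_smul, Matrix.smul_mul, Matrix.mul_smul, smul_smul]
    congr 1
    ring
  · rw [invB_act hg hk hx, adjugate_eq_smul_inv _ hk0]
    simp [smul_smul]
  · rw [invB'_eq, tr, invB_act hk hg (by rwa [blk_transpose, det_transpose]),
      adjugate_eq_smul_inv _ hg0, invB'_eq]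
    simp [smul_smul, Matrix.transpose_mul, mul_assoc, mul_comm]
  · rw [invA_act hg hk hk0 hx, adjugate_eq_smul_inv _ hk0]
    simp only [Matrix.transpose_smul, Matrix.smul_mul, smul_smul]
    congr 1
    ring
  · rw [invA'_eq, tr, invA_act hk hg hg0 (by rwa [m4_transpose, det_transpose]),
      adjugate_eq_smul_inv _ hg0, invA'_eq]
    simp only [Matrix.transpose_smul, Matrix.smul_mul, smul_smul, Matrix.transpose_mul,
      Matrix.transpose_transpose, mul_assoc]
    congr 1
    ring

end Invariants

end GinzburgRallis

end

noncomputable section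

namespace GinzburgRallis

/-! ### Smoothness of polynomial matrix functions and rank one updates. -/

section Smoothness

variable {𝕜 : Type*} [RCLike 𝕜] {E : Type*} [NormedAddCommGroup E] [NormedSpace ℝ E]
  {l m n : Type*} [Fintype l] [Fintype m] [Fintype n] [DecidableEq m] [DecidableEq n]

theorem contDiff_entry (i j : n) : ContDiff ℝ ∞ (fun x : Matrix n n 𝕜 => x i j) :=
  (LinearMap.toContinuousLinearMap (Matrix.entryLinearMap ℝ 𝕜 i j)).contDiff

theorem contDiff_det {f : E → Matrix m m 𝕜} (hf : ∀ i j, ContDiff ℝ ∞ fun x => f x i j) :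
    ContDiff ℝ ∞ fun x => (f x).det := by
  simp only [Matrix.det_apply]
  exact ContDiff.sum fun σ _ => (contDiff_prod fun i _ => hf _ _).const_smul _

theorem contDiff_adjugate {f : E → Matrix m m 𝕜} (hf : ∀ i j, ContDiff ℝ ∞ fun x => f x i j)
    (i j : m) : ContDiff ℝ ∞ fun x => adjugate (f x) i j := by
  simp only [Matrix.adjugate_apply]
  refine contDiff_det fun p q => ?_
  by_cases h : p = j
  · subst h
    simp only [Matrix.updateRow_self]
    exact contDiff_const
  · simp only [Matrix.updateRow_ne h]
    exact hf p q

theorem contDiff_matrix_mul {r s : Type*} {f : E → Matrix r l 𝕜} {g : E → Matrix l s 𝕜}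
    (hf : ∀ i j, ContDiff ℝ ∞ fun x => f x i j) (hg : ∀ i j, ContDiff ℝ ∞ fun x => g x i j)
    (i : r) (j : s) : ContDiff ℝ ∞ fun x => (f x * g x) i j := by
  simp only [Matrix.mul_apply]
  exact ContDiff.sum fun k _ => (hf _ _).mul (hg _ _)

theorem contDiff_matrix_trace {f : E → Matrix n n 𝕜}
    (hf : ∀ i j, ContDiff ℝ ∞ fun x => f x i j) : ContDiff ℝ ∞ fun x => (f x).trace := by
  simp only [Matrix.trace, Matrix.diag_apply]
  exact ContDiff.sum fun k _ => hf _ _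

theorem contDiff_matrix {f : E → Matrix n n 𝕜} (hf : ∀ i j, ContDiff ℝ ∞ fun x => f x i j) :
    ContDiff ℝ ∞ f := by
  have e : f = fun x => ∑ i, ∑ j, (LinearMap.toContinuousLinearMap
      (Matrix.singleLinearMap ℝ i j : 𝕜 →ₗ[ℝ] Matrix n n 𝕜)) (f x i j) := by
    ext1 x
    exact Matrix.matrix_eq_sum_single (f x)
  rw [e]
  exact ContDiff.sum fun i _ => ContDiff.sum fun j _ =>
    (ContinuousLinearMap.contDiff _).comp (hf i j)

/-- The determinant is linear in row `j`, with cofactors as coefficients. This formula provides the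
directions that move a determinant and also links ranks to cofactors. -/
theorem det_add_single {R : Type*} [CommRing R] (M : Matrix m m R) (i j : m) (c : R) :
    (M + Matrix.single j i c).det = M.det + c * adjugate M i j := by
  have e : M + Matrix.single j i c = M.updateRow j (M j + c • Pi.single i 1) := by
    ext p q
    by_cases hp : p = j
    · subst hp
      simp [Matrix.single_apply, Pi.single_apply, eq_comm]
    · simp [Matrix.updateRow_ne hp, Matrix.single_apply, Ne.symm hp]
  rw [e, Matrix.det_updateRow_add, Matrix.det_updateRow_smul, Matrix.updateRow_eq_self,
    Matrix.adjugate_apply]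

end Smoothness

/-! ### The strata as loci of semi-invariants. -/

section Loci

variable (𝕜 : Type*) [RCLike 𝕜]

def locus0 : Set (Matrix (Fin 6) (Fin 6) 𝕜) :=
  {x | IsUnit x ∧ (blk x 2 2).det = 0 ∧ (m4 x).det = 0 ∧ adj2 x ≠ 0 ∧ adj4 x ≠ 0}

def locus1 : Set (Matrix (Fin 6) (Fin 6) 𝕜) := {x ∈ locus0 𝕜 | (invB' x).trace = (invB x).trace}

def locus2 : Set (Matrix (Fin 6) (Fin 6) 𝕜) :=
  {x ∈ locus0 𝕜 | (invB' x).trace = 0 ∧ (invB x).trace = 0}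

def locus3 : Set (Matrix (Fin 6) (Fin 6) 𝕜) := {x ∈ locus2 𝕜 | (invA x).trace = (invA' x).trace}

def locus4 : Set (Matrix (Fin 6) (Fin 6) 𝕜) :=
  {x ∈ locus2 𝕜 | (invA x).trace = 0 ∧ (invA' x).trace = 0}

/-- On `locus4` the matrix `invA` is a multiple of `invB` and `invA'` one of `invB'`. The Kronecker
identity says, without division, that the two ratios agree, which makes it closed and stable. -/
def locus5 : Set (Matrix (Fin 6) (Fin 6) 𝕜) :=
  {x ∈ locus4 𝕜 | kroneckerMap (· * ·) (invA x) (invB' x) =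
    kroneckerMap (· * ·) (invB x) (invA' x)}

variable {𝕜}

theorem trace_conj {b : Matrix (Fin 2) (Fin 2) 𝕜} (hb : b.det ≠ 0) (u : Matrix (Fin 2) (Fin 2) 𝕜) :
    (b * u * b⁻¹).trace = u.trace := by
  rw [Matrix.trace_mul_comm, ← mul_assoc, Matrix.nonsing_inv_mul _ (isUnit_iff_ne_zero.2 hb),
    one_mul]

theorem trace_conj' {b : Matrix (Fin 2) (Fin 2) 𝕜} (hb : b.det ≠ 0)
    (u : Matrix (Fin 2) (Fin 2) 𝕜) : ((b⁻¹)ᵀ * u * bᵀ).trace = u.trace := by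
  rw [Matrix.trace_mul_comm, ← mul_assoc, ← Matrix.transpose_mul,
    Matrix.nonsing_inv_mul _ (isUnit_iff_ne_zero.2 hb), Matrix.transpose_one, one_mul]

theorem isStable_locus0 : IsStable (groupH 𝕜) (locus0 𝕜) := by
  rintro h hh x ⟨h1, h2, h3, h4, h5⟩
  obtain ⟨a, b, e, ha, hb, he, H⟩ := exists_equivariance hh
  obtain ⟨e1, e2, e3, e4, -, -⟩ := H x
  have key : ∀ u : Matrix (Fin 2) (Fin 2) 𝕜, (b⁻¹)ᵀ * u * a⁻¹ = 0 → u = 0 := fun u hu => by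
    have : bᵀ * ((b⁻¹)ᵀ * u * a⁻¹) * a = u := by
      calc _ = (b⁻¹ * b)ᵀ * u * (a⁻¹ * a) := by
            rw [Matrix.transpose_mul]; simp only [mul_assoc]
        _ = u := by
          rw [Matrix.nonsing_inv_mul _ (isUnit_iff_ne_zero.2 hb),
            Matrix.nonsing_inv_mul _ (isUnit_iff_ne_zero.2 ha), Matrix.transpose_one, one_mul,
            mul_one]
    rw [← this, hu, mul_zero, zero_mul]
  refine ⟨?_, by rw [e1, h2, mul_zero], by rw [e2, h3, mul_zero], ?_, ?_⟩
  · rw [act_apply]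
    refine (h.1.isUnit.mul h1).mul ?_
    exact (Matrix.isUnit_transpose _).2 h.2.isUnit
  · rw [e3]
    exact smul_ne_zero he fun h' => h4 (key _ h')
  · rw [e4]
    exact smul_ne_zero (pow_ne_zero 2 he) fun h' => h5 (key _ h')

theorem isStable_locus1 : IsStable (groupH 𝕜) (locus1 𝕜) := by
  rintro h hh x ⟨hx, h1⟩
  refine ⟨isStable_locus0 h hh x hx, ?_⟩
  obtain ⟨a, b, e, ha, hb, he, H⟩ := exists_equivariance hh
  obtain ⟨-, -, -, -, e5, -⟩ := H x
  obtain ⟨e6, e7⟩ := e5 hx.2.1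
  rw [e6, e7, Matrix.trace_smul, Matrix.trace_smul, trace_conj ha, trace_conj' hb, h1]

theorem isStable_locus2 : IsStable (groupH 𝕜) (locus2 𝕜) := by
  rintro h hh x ⟨hx, h1, h2⟩
  refine ⟨isStable_locus0 h hh x hx, ?_⟩
  obtain ⟨a, b, e, ha, hb, he, H⟩ := exists_equivariance hh
  obtain ⟨-, -, -, -, e5, -⟩ := H x
  obtain ⟨e6, e7⟩ := e5 hx.2.1
  rw [e6, e7, Matrix.trace_smul, Matrix.trace_smul, trace_conj ha, trace_conj' hb, h1, h2,
    smul_zero]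
  exact ⟨rfl, rfl⟩

theorem isStable_locus3 : IsStable (groupH 𝕜) (locus3 𝕜) := by
  rintro h hh x ⟨hx, h1⟩
  refine ⟨isStable_locus2 h hh x hx, ?_⟩
  obtain ⟨a, b, e, ha, hb, he, H⟩ := exists_equivariance hh
  obtain ⟨-, -, -, -, -, e5⟩ := H x
  obtain ⟨e6, e7⟩ := e5 hx.1.2.2.1
  rw [e6, e7, Matrix.trace_smul, Matrix.trace_smul, trace_conj ha, trace_conj' hb, h1]

theorem isStable_locus4 : IsStable (groupH 𝕜) (locus4 𝕜) := by
  rintro h hh x ⟨hx, h1, h2⟩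
  refine ⟨isStable_locus2 h hh x hx, ?_⟩
  obtain ⟨a, b, e, ha, hb, he, H⟩ := exists_equivariance hh
  obtain ⟨-, -, -, -, -, e5⟩ := H x
  obtain ⟨e6, e7⟩ := e5 hx.1.2.2.1
  rw [e6, e7, Matrix.trace_smul, Matrix.trace_smul, trace_conj ha, trace_conj' hb, h1, h2,
    smul_zero]
  exact ⟨rfl, rfl⟩

/-- Both Kronecker products are multiplied by the same invertible matrices on either side and by the
same total power of the scalar. -/
theorem isStable_locus5 : IsStable (groupH 𝕜) (locus5 𝕜) := by
  rintro h hh x ⟨hx, h1⟩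
  refine ⟨isStable_locus4 h hh x hx, ?_⟩
  obtain ⟨a, b, e, ha, hb, he, H⟩ := exists_equivariance hh
  obtain ⟨-, -, -, -, e4, e5⟩ := H x
  obtain ⟨e6, e7⟩ := e5 hx.1.1.2.2.1
  obtain ⟨e8, e9⟩ := e4 hx.1.1.2.1
  rw [e6, e7, e8, e9, Matrix.smul_kronecker, Matrix.kronecker_smul, Matrix.smul_kronecker,
    Matrix.kronecker_smul, Matrix.mul_kronecker_mul, Matrix.mul_kronecker_mul, h1,
    Matrix.mul_kronecker_mul, Matrix.mul_kronecker_mul, smul_comm]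

end Loci

/-! ### Directions along which the invariants vary one at a time. -/

section Functions

variable {𝕜 : Type*} [RCLike 𝕜]

theorem contDiff_blk (r s : Fin 3) (i j : Fin 2) :
    ContDiff ℝ ∞ fun x : Matrix (Fin 6) (Fin 6) 𝕜 => blk x r s i j := contDiff_entry _ _

theorem contDiff_m4 (i j : Fin 2 ⊕ Fin 2) :
    ContDiff ℝ ∞ fun x : Matrix (Fin 6) (Fin 6) 𝕜 => m4 x i j := by
  rcases i with i | i <;> rcases j with j | j <;> exact contDiff_blk _ _ _ _

theorem contDiff_colP (i : Fin 2 ⊕ Fin 2) (j : Fin 2) :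
    ContDiff ℝ ∞ fun x : Matrix (Fin 6) (Fin 6) 𝕜 => colP x i j := by
  rcases i with i | i <;> exact contDiff_blk _ _ _ _

theorem contDiff_rowP (i : Fin 2) (j : Fin 2 ⊕ Fin 2) :
    ContDiff ℝ ∞ fun x : Matrix (Fin 6) (Fin 6) 𝕜 => rowP x i j := by
  rcases j with j | j <;> exact contDiff_blk _ _ _ _

theorem contDiff_adj2 (i j : Fin 2) :
    ContDiff ℝ ∞ fun x : Matrix (Fin 6) (Fin 6) 𝕜 => adj2 x i j :=
  contDiff_adjugate (contDiff_blk _ _) i j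

theorem contDiff_adj4 (i j : Fin 2) :
    ContDiff ℝ ∞ fun x : Matrix (Fin 6) (Fin 6) 𝕜 => adj4 x i j :=
  contDiff_adjugate contDiff_m4 _ _

theorem contDiff_invB (i j : Fin 2) :
    ContDiff ℝ ∞ fun x : Matrix (Fin 6) (Fin 6) 𝕜 => invB x i j :=
  contDiff_matrix_mul contDiff_adj2 (contDiff_blk _ _) i j

theorem contDiff_invB' (i j : Fin 2) :
    ContDiff ℝ ∞ fun x : Matrix (Fin 6) (Fin 6) 𝕜 => invB' x i j :=
  contDiff_matrix_mul (contDiff_blk _ _) contDiff_adj2 i j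

theorem contDiff_invA (i j : Fin 2) :
    ContDiff ℝ ∞ fun x : Matrix (Fin 6) (Fin 6) 𝕜 => invA x i j :=
  contDiff_matrix_mul (contDiff_adjugate (contDiff_m4 (𝕜 := 𝕜))) contDiff_colP (Sum.inl i) j

theorem contDiff_invA' (i j : Fin 2) :
    ContDiff ℝ ∞ fun x : Matrix (Fin 6) (Fin 6) 𝕜 => invA' x i j :=
  contDiff_matrix_mul (contDiff_rowP (𝕜 := 𝕜)) (contDiff_adjugate contDiff_m4) i (Sum.inl j)

theorem contDiff_det2 : ContDiff ℝ ∞ fun x : Matrix (Fin 6) (Fin 6) 𝕜 => (blk x 2 2).det :=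
  contDiff_det (contDiff_blk _ _)

theorem contDiff_det4 : ContDiff ℝ ∞ fun x : Matrix (Fin 6) (Fin 6) 𝕜 => (m4 x).det :=
  contDiff_det contDiff_m4

theorem isOpen_ne_zero {f : Matrix (Fin 6) (Fin 6) 𝕜 → Matrix (Fin 2) (Fin 2) 𝕜}
    (hf : ∀ i j, ContDiff ℝ ∞ fun x => f x i j) : IsOpen {x | f x ≠ 0} := by
  have : {x | f x ≠ 0} = ⋃ i, ⋃ j, {x | f x i j ≠ 0} := by
    ext x
    simp only [Set.mem_ofPred_eq, Set.mem_iUnion, ne_eq, ← Matrix.ext_iff, Matrix.zero_apply]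
    push Not
    rfl
  rw [this]
  exact isOpen_iUnion fun i => isOpen_iUnion fun j =>
    isOpen_ne_fun (hf i j).continuous continuous_const

variable (𝕜) in
/-- The open conditions in the definition of `locus0`. -/
def openPart : Set (Matrix (Fin 6) (Fin 6) 𝕜) := {x | IsUnit x ∧ adj2 x ≠ 0 ∧ adj4 x ≠ 0}

theorem isOpen_openPart : IsOpen (openPart 𝕜) := by
  have h : IsOpen {x : Matrix (Fin 6) (Fin 6) 𝕜 | x.det ≠ 0} :=
    isOpen_ne_fun (contDiff_det (contDiff_entry (𝕜 := 𝕜) (n := Fin 6))).continuous continuous_const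
  have e : openPart 𝕜 = {x | x.det ≠ 0} ∩ ({x | adj2 x ≠ 0} ∩ {x | adj4 x ≠ 0}) := by
    ext x
    simp [openPart, Matrix.isUnit_iff_isUnit_det]
  rw [e]
  exact h.inter ((isOpen_ne_zero contDiff_adj2).inter (isOpen_ne_zero contDiff_adj4))

/-- The matrix whose block in position `(r, s)` is `u` and that is zero elsewhere. -/
def put (r s : Fin 3) : Matrix (Fin 2) (Fin 2) 𝕜 →ₗ[ℝ] Matrix (Fin 6) (Fin 6) 𝕜 where
  toFun u := Matrix.of fun p q => if (p : ℕ) / 2 = r ∧ (q : ℕ) / 2 = s then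
    u ⟨p % 2, by omega⟩ ⟨q % 2, by omega⟩ else 0
  map_add' u v := by
    ext p q
    simp only [Matrix.of_apply, Matrix.add_apply]
    split_ifs <;> simp
  map_smul' c u := by
    ext p q
    simp only [Matrix.of_apply, Matrix.smul_apply, RingHom.id_apply]
    split_ifs <;> simp

theorem blk_put (r s r' s' : Fin 3) (u : Matrix (Fin 2) (Fin 2) 𝕜) :
    blk (put r s u) r' s' = if r' = r ∧ s' = s then u else 0 := by
  ext p q
  have h1 : (2 * (r' : ℕ) + p) / 2 = r' := by omega
  have h2 : (2 * (s' : ℕ) + q) / 2 = s' := by omega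
  have h3 : (2 * (r' : ℕ) + p) % 2 = p := by omega
  have h4 : (2 * (s' : ℕ) + q) % 2 = q := by omega
  simp only [blk, put, Matrix.of_apply, LinearMap.coe_mk, AddHom.coe_mk, h1, h2, h3, h4,
    Fin.val_inj]
  split_ifs <;> rfl

theorem blk_add (x y : Matrix (Fin 6) (Fin 6) 𝕜) (r s : Fin 3) :
    blk (x + y) r s = blk x r s + blk y r s := rfl

/-- The direction `c ↦ c u` in the block `(r, s)`. -/
def dir (r s : Fin 3) (u : Matrix (Fin 2) (Fin 2) 𝕜) : 𝕜 →ₗ[ℝ] Matrix (Fin 6) (Fin 6) 𝕜 :=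
  (put r s).comp (LinearMap.toSpanSingleton 𝕜 _ u |>.restrictScalars ℝ)

theorem blk_add_dir (x : Matrix (Fin 6) (Fin 6) 𝕜) (r s r' s' : Fin 3)
    (u : Matrix (Fin 2) (Fin 2) 𝕜) (c : 𝕜) :
    blk (x + dir r s u c) r' s' = blk x r' s' + if r' = r ∧ s' = s then c • u else 0 := by
  rw [blk_add]
  simp [dir, blk_put]

variable {z : Matrix (Fin 6) (Fin 6) 𝕜}

theorem trace_mul_single (u : Matrix (Fin 2) (Fin 2) 𝕜) (i j : Fin 2) (c : 𝕜) :
    (u * Matrix.single j i c).trace = c * u i j := by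
  rw [Matrix.trace_mul_comm, Matrix.trace_single_mul, smul_eq_mul]

/-- A nonzero entry `(i, j)` of the adjugate is the rate at which the determinant changes in
direction `(j, i)`. This and the following directions come with the list of invariants that they
leave unchanged, which is what makes the Jacobians triangular. -/
theorem exists_dir22 (h : adj2 z ≠ 0) : ∃ u : 𝕜 →ₗ[ℝ] Matrix (Fin 6) (Fin 6) 𝕜, ∃ a : 𝕜,
    a ≠ 0 ∧ ∀ c, (blk (z + u c) 2 2).det = (blk z 2 2).det + c * a := by
  obtain ⟨i, j, hij⟩ : ∃ i j, adj2 z i j ≠ 0 := by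
    by_contra! h'
    exact h (Matrix.ext h')
  refine ⟨dir 2 2 (Matrix.single j i 1), _, hij, fun c => ?_⟩
  simp [blk_add_dir, det_add_single, adj2]

/-- The trace of a product with `adj2` is linear in the block `(1, 2)`, which enters neither `adj2`
nor `invB`; a nonzero entry of `adj2` gives the slope. -/
theorem exists_dir12 (h : adj2 z ≠ 0) : ∃ u : 𝕜 →ₗ[ℝ] Matrix (Fin 6) (Fin 6) 𝕜, ∃ a : 𝕜,
    a ≠ 0 ∧ ∀ c, (blk (z + u c) 2 2).det = (blk z 2 2).det ∧ invB (z + u c) = invB z ∧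
      (invB' (z + u c)).trace = (invB' z).trace + c * a := by
  obtain ⟨i, j, hij⟩ : ∃ i j, adj2 z i j ≠ 0 := by
    by_contra! h'
    exact h (Matrix.ext h')
  refine ⟨dir 1 2 (Matrix.single j i 1), _, hij, fun c => ?_⟩
  refine ⟨by simp [blk_add_dir], by simp [invB, adj2, blk_add_dir], ?_⟩
  simp only [invB', blk_add_dir, Matrix.add_mul, Matrix.trace_add]
  rw [Matrix.trace_mul_comm (ite _ _ _)]
  simp [adj2, blk_add_dir, trace_mul_single]

theorem exists_dir21 (h : adj2 z ≠ 0) : ∃ u : 𝕜 →ₗ[ℝ] Matrix (Fin 6) (Fin 6) 𝕜, ∃ a : 𝕜,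
    a ≠ 0 ∧ ∀ c, (blk (z + u c) 2 2).det = (blk z 2 2).det ∧ invB' (z + u c) = invB' z ∧
      (invB (z + u c)).trace = (invB z).trace + c * a := by
  obtain ⟨i, j, hij⟩ : ∃ i j, adj2 z i j ≠ 0 := by
    by_contra! h'
    exact h (Matrix.ext h')
  refine ⟨dir 2 1 (Matrix.single j i 1), _, hij, fun c => ?_⟩
  refine ⟨by simp [blk_add_dir], by simp [invB', adj2, blk_add_dir], ?_⟩
  simp [invB, adj2, blk_add_dir, mul_add, trace_mul_single]

theorem m4_add_dir11 (u : Matrix (Fin 2) (Fin 2) 𝕜) (c : 𝕜) :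
    m4 (z + dir 1 1 u c) = m4 z + fromBlocks (c • u) 0 0 0 := by
  simp [m4, blk_add_dir, fromBlocks_add]

/-- The block `(1, 1)` enters none of the invariants attached to the corner block, and the relevant
cofactors of `m4 z` are the entries of `adj4 z`. -/
theorem exists_dir11 (h : adj4 z ≠ 0) : ∃ u : 𝕜 →ₗ[ℝ] Matrix (Fin 6) (Fin 6) 𝕜, ∃ a : 𝕜,
    a ≠ 0 ∧ ∀ c, (blk (z + u c) 2 2).det = (blk z 2 2).det ∧ invB (z + u c) = invB z ∧
      invB' (z + u c) = invB' z ∧ (m4 (z + u c)).det = (m4 z).det + c * a := by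
  obtain ⟨i, j, hij⟩ : ∃ i j, adj4 z i j ≠ 0 := by
    by_contra! h'
    exact h (Matrix.ext h')
  refine ⟨dir 1 1 (Matrix.single j i 1), _, hij, fun c => ?_⟩
  refine ⟨by simp [blk_add_dir], by simp [invB, adj2, blk_add_dir],
    by simp [invB', adj2, blk_add_dir], ?_⟩
  have e : fromBlocks (c • Matrix.single j i (1 : 𝕜)) 0 0 0 =
      Matrix.single (Sum.inl j : Fin 2 ⊕ Fin 2) (Sum.inl i : Fin 2 ⊕ Fin 2) c := by
    ext (p | p) (q | q) <;> simp [Matrix.single_apply]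
  rw [m4_add_dir11, e, det_add_single]
  rfl

theorem m4_add_dir10 (u : Matrix (Fin 2) (Fin 2) 𝕜) (c : 𝕜) : m4 (z + dir 1 0 u c) = m4 z := by
  simp [m4, blk_add_dir]

theorem m4_add_dir01 (u : Matrix (Fin 2) (Fin 2) 𝕜) (c : 𝕜) : m4 (z + dir 0 1 u c) = m4 z := by
  simp [m4, blk_add_dir]

/-- Changing the block `(1, 0)` only affects `invA`. -/
theorem invariants_add_dir10 (u : Matrix (Fin 2) (Fin 2) 𝕜) (c : 𝕜) :
    (blk (z + dir 1 0 u c) 2 2).det = (blk z 2 2).det ∧ invB (z + dir 1 0 u c) = invB z ∧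
      invB' (z + dir 1 0 u c) = invB' z ∧ (m4 (z + dir 1 0 u c)).det = (m4 z).det ∧
      invA' (z + dir 1 0 u c) = invA' z ∧
      invA (z + dir 1 0 u c) = invA z + c • (adj4 z * u) := by
  refine ⟨by simp [blk_add_dir], by simp [invB, adj2, blk_add_dir],
    by simp [invB', adj2, blk_add_dir], by rw [m4_add_dir10],
    by simp [invA', m4_add_dir10, rowP, blk_add_dir], ?_⟩
  have e : colP (z + dir 1 0 u c) = colP z + fromRows (c • u) 0 := by
    ext (i | i) j <;> simp [colP, blk_add_dir]
  have e' : adjugate (m4 z) * fromRows (c • u) (0 : Matrix (Fin 2) (Fin 2) 𝕜) =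
      fromRows (c • (adj4 z * u)) (c • ((adjugate (m4 z)).toBlocks₂₁ * u)) := by
    conv_lhs => rw [← fromBlocks_toBlocks (adjugate (m4 z)), fromBlocks_mul_fromRows]
    simp [adj4]
  rw [invA, m4_add_dir10, e, Matrix.mul_add, e']
  rfl

/-- Changing the block `(0, 1)` only affects `invA'`. -/
theorem invariants_add_dir01 (u : Matrix (Fin 2) (Fin 2) 𝕜) (c : 𝕜) :
    (blk (z + dir 0 1 u c) 2 2).det = (blk z 2 2).det ∧ invB (z + dir 0 1 u c) = invB z ∧
      invB' (z + dir 0 1 u c) = invB' z ∧ (m4 (z + dir 0 1 u c)).det = (m4 z).det ∧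
      invA (z + dir 0 1 u c) = invA z ∧
      invA' (z + dir 0 1 u c) = invA' z + c • (u * adj4 z) := by
  refine ⟨by simp [blk_add_dir], by simp [invB, adj2, blk_add_dir],
    by simp [invB', adj2, blk_add_dir], by rw [m4_add_dir01],
    by simp [invA, m4_add_dir01, colP, blk_add_dir], ?_⟩
  have e : rowP (z + dir 0 1 u c) = rowP z + fromCols (c • u) 0 := by
    ext i (j | j) <;> simp [rowP, blk_add_dir]
  have e' : fromCols (c • u) (0 : Matrix (Fin 2) (Fin 2) 𝕜) * adjugate (m4 z) =
      fromCols (c • (u * adj4 z)) (c • (u * (adjugate (m4 z)).toBlocks₁₂)) := by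
    conv_lhs => rw [← fromBlocks_toBlocks (adjugate (m4 z)), fromCols_mul_fromBlocks]
    simp [adj4]
  rw [invA', m4_add_dir01, e, Matrix.add_mul, e']
  rfl

theorem exists_dir10 (h : adj4 z ≠ 0) : ∃ u : 𝕜 →ₗ[ℝ] Matrix (Fin 6) (Fin 6) 𝕜, ∃ a : 𝕜,
    a ≠ 0 ∧ ∀ c, (blk (z + u c) 2 2).det = (blk z 2 2).det ∧ invB (z + u c) = invB z ∧
      invB' (z + u c) = invB' z ∧ (m4 (z + u c)).det = (m4 z).det ∧ invA' (z + u c) = invA' z ∧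
      (invA (z + u c)).trace = (invA z).trace + c * a := by
  obtain ⟨i, j, hij⟩ : ∃ i j, adj4 z i j ≠ 0 := by
    by_contra! h'
    exact h (Matrix.ext h')
  refine ⟨dir 1 0 (Matrix.single j i 1), _, hij, fun c => ?_⟩
  obtain ⟨h1, h2, h3, h4, h5, h6⟩ := invariants_add_dir10 (z := z) (Matrix.single j i 1) c
  refine ⟨h1, h2, h3, h4, h5, ?_⟩
  rw [h6, Matrix.trace_add, Matrix.trace_smul, trace_mul_single, smul_eq_mul, one_mul]

theorem exists_dir01 (h : adj4 z ≠ 0) : ∃ u : 𝕜 →ₗ[ℝ] Matrix (Fin 6) (Fin 6) 𝕜, ∃ a : 𝕜,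
    a ≠ 0 ∧ ∀ c, (blk (z + u c) 2 2).det = (blk z 2 2).det ∧ invB (z + u c) = invB z ∧
      invB' (z + u c) = invB' z ∧ (m4 (z + u c)).det = (m4 z).det ∧ invA (z + u c) = invA z ∧
      (invA' (z + u c)).trace = (invA' z).trace + c * a := by
  obtain ⟨i, j, hij⟩ : ∃ i j, adj4 z i j ≠ 0 := by
    by_contra! h'
    exact h (Matrix.ext h')
  refine ⟨dir 0 1 (Matrix.single j i 1), _, hij, fun c => ?_⟩
  obtain ⟨h1, h2, h3, h4, h5, h6⟩ := invariants_add_dir01 (z := z) (Matrix.single j i 1) c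
  refine ⟨h1, h2, h3, h4, h5, ?_⟩
  rw [h6, Matrix.trace_add, Matrix.trace_smul, Matrix.trace_mul_comm, trace_mul_single,
    smul_eq_mul, one_mul]

end Functions

end GinzburgRallis

end

noncomputable section

namespace GinzburgRallis

/-! ### Rank conditions in terms of cofactors. -/

section Ranks

variable {K : Type*} [Field K]

theorem rank_add_finrank_ker {m n : Type*} [Fintype m] [Fintype n] (C : Matrix m n K) :
    C.rank + Module.finrank K (LinearMap.ker C.mulVecLin) = Fintype.card n := by
  rw [Matrix.rank, LinearMap.finrank_range_add_finrank_ker, Module.finrank_fintype_fun_eq_card]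

theorem rank_eq_card_iff {m n : Type*} [Fintype m] [Fintype n] (C : Matrix m n K) :
    C.rank = Fintype.card n ↔ ∀ y, C *ᵥ y = 0 → y = 0 := by
  have h := rank_add_finrank_ker C
  have h2 : C.rank = Fintype.card n ↔ Module.finrank K (LinearMap.ker C.mulVecLin) = 0 := by
    omega
  rw [h2, Submodule.finrank_eq_zero, LinearMap.ker_eq_bot']
  rfl

theorem rank_eq_card_iff_det {n : Type*} [Fintype n] [DecidableEq n] (M : Matrix n n K) :
    M.rank = Fintype.card n ↔ M.det ≠ 0 := by
  rw [rank_eq_card_iff, ne_eq, ← Matrix.exists_mulVec_eq_zero_iff]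
  push Not
  exact ⟨fun h v hv h' => hv (h v h'), fun h v h' => by_contra fun hv => h v hv h'⟩

/-- For 2 × 2 matrices the adjugate only permutes entries and changes signs, so it vanishes only for
the zero matrix, which excludes rank 0; the determinant excludes rank 2. -/
theorem det_two_rank_one_iff (A : Matrix (Fin 2) (Fin 2) K) :
    A.rank = 1 ↔ A.det = 0 ∧ adjugate A ≠ 0 := by
  have h1 := rank_add_finrank_ker A
  have h2 := rank_eq_card_iff_det A
  have h3 : A.rank = 0 ↔ adjugate A = 0 := by
    constructor
    · intro h
      have : Module.finrank K (LinearMap.ker A.mulVecLin) = Module.finrank K (Fin 2 → K) := by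
        rw [Module.finrank_fintype_fun_eq_card]
        omega
      have h4 := Submodule.eq_top_of_finrank_eq this
      rw [LinearMap.ker_eq_top] at h4
      have h5 : A = 0 := by
        ext i j
        have := congrFun (LinearMap.congr_fun h4 (Pi.single j 1)) i
        simpa using this
      rw [h5, adjugate_zero]
    · intro h
      have h5 : A = 0 := by
        rw [adjugate_fin_two] at h
        have h00 := congrFun (congrFun h 0) 0
        have h01 := congrFun (congrFun h 0) 1
        have h10 := congrFun (congrFun h 1) 0
        have h11 := congrFun (congrFun h 1) 1
        simp at h00 h01 h10 h11
        ext i j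
        fin_cases i <;> fin_cases j <;> simp [h00, h01, h10, h11]
      rw [h5, Matrix.rank_zero]
  rw [Fintype.card_fin] at h1 h2
  rw [ne_eq, ← h3]
  have h4 : A.det = 0 ↔ A.rank ≠ 2 := by
    rw [ne_eq, h2, not_not]
  rw [h4]
  omega

/-- The rank conditions on a `4 × 4` matrix and its last two rows and columns, in terms of
minors. -/
theorem rank_conditions_iff (M : Matrix (Fin 4) (Fin 4) K) :
    (M.rank = 3 ∧ (M.submatrix id (Fin.natAdd 2 : Fin 2 → Fin 4)).rank = 2 ∧
      (M.submatrix (Fin.natAdd 2 : Fin 2 → Fin 4) id).rank = 2) ↔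
    M.det = 0 ∧ ∃ i j : Fin 2, adjugate M (Fin.castAdd 2 i) (Fin.castAdd 2 j) ≠ 0 := by
  have hdet := rank_eq_card_iff_det M
  have hker := rank_add_finrank_ker M
  rw [Fintype.card_fin] at hdet hker
  have hC : (M.submatrix id (Fin.natAdd 2 : Fin 2 → Fin 4)).rank = 2 ↔
      ∀ y : Fin 2 → K, M *ᵥ (![0, 0, y 0, y 1]) = 0 → y = 0 := by
    have h := rank_eq_card_iff (M.submatrix id (Fin.natAdd 2 : Fin 2 → Fin 4))
    rw [Fintype.card_fin] at h
    rw [h]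
    have e : ∀ y : Fin 2 → K, (M.submatrix id (Fin.natAdd 2 : Fin 2 → Fin 4)) *ᵥ y =
        M *ᵥ (![0, 0, y 0, y 1]) := fun y => by
      ext i
      simp only [Matrix.mulVec, dotProduct, Matrix.submatrix_apply, id]
      simp [Fin.sum_univ_four, Fin.sum_univ_two]
    simp only [e]
  have hR : (M.submatrix (Fin.natAdd 2 : Fin 2 → Fin 4) id).rank = 2 ↔
      ∀ y : Fin 2 → K, Mᵀ *ᵥ (![0, 0, y 0, y 1]) = 0 → y = 0 := by
    rw [← Matrix.rank_transpose, Matrix.transpose_submatrix]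
    have h := rank_eq_card_iff (Mᵀ.submatrix id (Fin.natAdd 2 : Fin 2 → Fin 4))
    rw [Fintype.card_fin] at h
    rw [h]
    have e : ∀ y : Fin 2 → K, (Mᵀ.submatrix id (Fin.natAdd 2 : Fin 2 → Fin 4)) *ᵥ y =
        Mᵀ *ᵥ (![0, 0, y 0, y 1]) := fun y => by
      ext i
      simp only [Matrix.mulVec, dotProduct, Matrix.submatrix_apply, id]
      simp [Fin.sum_univ_four, Fin.sum_univ_two]
    simp only [e]
  rw [hC, hR]
  constructor
  · rintro ⟨h3, hc, hr⟩
    have hd : M.det = 0 := by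
      by_contra h
      have := hdet.2 h
      omega
    refine ⟨hd, ?_⟩
    obtain ⟨R, hR0, hR⟩ := Matrix.exists_mulVec_eq_zero_iff.2 hd
    obtain ⟨L, hL0, hL⟩ := Matrix.exists_mulVec_eq_zero_iff.2
      (show Mᵀ.det = 0 by rwa [Matrix.det_transpose])
    -- A kernel vector with vanishing upper half would be a relation between the last two columns,
    -- which are independent. It is applied to `M` and to its transpose.
    have aux : ∀ (A : Matrix (Fin 4) (Fin 4) K),
        (∀ y : Fin 2 → K, A *ᵥ (![0, 0, y 0, y 1]) = 0 → y = 0) → ∀ v : Fin 4 → K, v ≠ 0 →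
        A *ᵥ v = 0 → ∃ i : Fin 2, v (Fin.castAdd 2 i) ≠ 0 := by
      intro A hA v hv hAv
      by_contra! h
      have h0 : v 0 = 0 := h 0
      have h1 : v 1 = 0 := h 1
      have e : v = ![0, 0, v 2, v 3] := by
        ext i
        fin_cases i <;> simp [h0, h1]
      have := hA ![v 2, v 3] (by rw [e] at hAv; exact hAv)
      have h2 := congrFun this 0
      have h3 := congrFun this 1
      simp only [Matrix.cons_val_zero, Matrix.cons_val_one, Pi.zero_apply] at h2 h3
      exact hv (by rw [e, h2, h3]; ext i; fin_cases i <;> rfl)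
    obtain ⟨i, hi⟩ := aux M hc R hR0 hR
    obtain ⟨j, hj⟩ := aux Mᵀ hr L hL0 hL
    refine ⟨i, j, fun h => ?_⟩
    -- If the cofactor vanished, this rank one perturbation would still be singular. Pairing a
    -- kernel vector `y` with the left kernel vector `L` forces its coordinate `i` to vanish, so `y`
    -- lies in the line spanned by `R`, whose coordinate `i` is nonzero; hence `y = 0`.
    have hdet' : (M + Matrix.single (Fin.castAdd 2 j) (Fin.castAdd 2 i) (1 : K)).det = 0 := by
      rw [det_add_single, h, hd, mul_zero, add_zero]
    obtain ⟨y, hy0, hy⟩ := Matrix.exists_mulVec_eq_zero_iff.2 hdet'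
    rw [Matrix.add_mulVec] at hy
    have hs : Matrix.single (Fin.castAdd 2 j) (Fin.castAdd 2 i) (1 : K) *ᵥ y =
        Pi.single (Fin.castAdd 2 j) (y (Fin.castAdd 2 i)) := by
      ext p
      simp [Matrix.mulVec, dotProduct, Matrix.single_apply, Pi.single_apply, ite_and, eq_comm]
    have h5 : y (Fin.castAdd 2 i) = 0 := by
      have h6 := congrArg (fun w => L ⬝ᵥ w) hy
      simp only [dotProduct_add, dotProduct_zero, Matrix.dotProduct_mulVec,
        ← Matrix.mulVec_transpose, hL, zero_dotProduct, zero_add] at h6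
      rw [Matrix.mulVec_transpose, ← Matrix.dotProduct_mulVec, hs, dotProduct_single] at h6
      exact (mul_eq_zero.1 h6).resolve_left hj
    have h7 : M *ᵥ y = 0 := by
      rw [hs, h5] at hy
      simpa using hy
    have h1 : Module.finrank K (LinearMap.ker M.mulVecLin) = 1 := by omega
    have hR' : (⟨R, hR⟩ : LinearMap.ker M.mulVecLin) ≠ 0 := fun h => hR0 (congrArg Subtype.val h)
    obtain ⟨c, hc'⟩ := (finrank_eq_one_iff_of_nonzero' _ hR').1 h1 ⟨y, h7⟩
    have h8 : c • R = y := congrArg Subtype.val hc'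
    rw [← h8] at h5
    have hc0 : c = 0 := (mul_eq_zero.1 h5).resolve_right hi
    exact hy0 (by rw [← h8, hc0, zero_smul])
  · rintro ⟨hd, i, j, hij⟩
    -- Conversely the perturbed matrix is invertible, and it agrees with `M` on vectors whose
    -- coordinate `i` is zero. Such vectors therefore cannot lie in the kernel of `M` unless they
    -- are zero.
    set M' := M + Matrix.single (Fin.castAdd 2 j) (Fin.castAdd 2 i) (1 : K) with hM'
    have hdet' : M'.det ≠ 0 := by
      rw [hM', det_add_single, hd, zero_add, one_mul]
      exact hij
    have hinj : ∀ v, M' *ᵥ v = 0 → v = 0 := fun v hv => by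
      by_contra h
      exact hdet' (Matrix.exists_mulVec_eq_zero_iff.1 ⟨v, h, hv⟩)
    have hinj' : ∀ v, M'ᵀ *ᵥ v = 0 → v = 0 := fun v hv => by
      by_contra h
      exact hdet' (by
        rw [← Matrix.det_transpose]
        exact Matrix.exists_mulVec_eq_zero_iff.1 ⟨v, h, hv⟩)
    have app : ∀ y : Fin 2 → K, ![0, 0, y 0, y 1] = (0 : Fin 4 → K) → y = 0 := fun y hy => by
      have h2 := congrFun hy 2
      have h3 := congrFun hy 3
      ext k
      fin_cases k
      · exact h2
      · exact h3
    have low : ∀ (y : Fin 2 → K) (k : Fin 2),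
        (![0, 0, y 0, y 1] : Fin 4 → K) (Fin.castAdd 2 k) = 0 := fun y k => by
      fin_cases k <;> rfl
    refine ⟨?_, fun y hy => app y (hinj _ ?_), fun y hy => app y (hinj' _ ?_)⟩
    · have hne : M.rank ≠ 4 := fun h => hdet.1 h hd
      by_contra h3
      have h2 : 2 ≤ Module.finrank K (LinearMap.ker M.mulVecLin) := by omega
      -- In a kernel of dimension at least two, one linear condition still leaves a nonzero vector.
      have h4 : ∃ v : Fin 4 → K, v ≠ 0 ∧ M *ᵥ v = 0 ∧ v (Fin.castAdd 2 i) = 0 := by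
        let φ : LinearMap.ker M.mulVecLin →ₗ[K] K :=
          (LinearMap.proj (Fin.castAdd 2 i : Fin 4)).comp (LinearMap.ker M.mulVecLin).subtype
        have hφ := LinearMap.finrank_range_add_finrank_ker φ
        have hφ' := Submodule.finrank_le (LinearMap.range φ)
        rw [Module.finrank_self] at hφ'
        have : LinearMap.ker φ ≠ ⊥ := fun h => by
          rw [h, finrank_bot] at hφ
          omega
        obtain ⟨v, hv, hv0⟩ := Submodule.exists_mem_ne_zero_of_ne_bot this
        exact ⟨v.1, fun h => hv0 (Subtype.ext h), v.2, hv⟩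
      obtain ⟨v, hv0, hv, hvi⟩ := h4
      refine hv0 (hinj v ?_)
      rw [hM', Matrix.add_mulVec, hv, zero_add]
      ext p
      simp [Matrix.mulVec, dotProduct, Matrix.single_apply, ite_and, hvi]
    · rw [hM', Matrix.add_mulVec, hy, zero_add]
      ext p
      simp only [Matrix.mulVec, dotProduct, Matrix.single_apply, ite_and, ite_mul, one_mul,
        zero_mul, Matrix.transpose_apply, Finset.sum_ite_irrel, Finset.sum_const_zero,
        Finset.sum_ite_eq, Finset.mem_univ, if_true, low, ite_self, Pi.zero_apply]
    · rw [hM', Matrix.transpose_add, Matrix.add_mulVec, hy, zero_add]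
      ext p
      simp only [Matrix.mulVec, dotProduct, Matrix.single_apply, ite_and, ite_mul, one_mul,
        zero_mul, Matrix.transpose_apply, Finset.sum_ite_irrel, Finset.sum_const_zero,
        Finset.sum_ite_eq, Finset.mem_univ, if_true, low, ite_self, Pi.zero_apply]

end Ranks

/-! ### The rank matrix condition rewritten as `locus0`. -/

section ZSix

variable {𝕜 : Type*} [RCLike 𝕜]

def sub4 (x : Matrix (Fin 6) (Fin 6) 𝕜) : Matrix (Fin 4) (Fin 4) 𝕜 :=
  x.submatrix ![2, 3, 4, 5] ![2, 3, 4, 5]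

theorem m4_eq_submatrix (x : Matrix (Fin 6) (Fin 6) 𝕜) :
    m4 x = (sub4 x).submatrix finSumFinEquiv finSumFinEquiv := by
  ext (i | i) (j | j) <;> fin_cases i <;> fin_cases j <;> rfl

theorem det_m4_eq (x : Matrix (Fin 6) (Fin 6) 𝕜) : (m4 x).det = (sub4 x).det := by
  rw [m4_eq_submatrix, Matrix.det_submatrix_equiv_self]

theorem adj4_apply (x : Matrix (Fin 6) (Fin 6) 𝕜) (i j : Fin 2) :
    adj4 x i j = adjugate (sub4 x) (Fin.castAdd 2 i) (Fin.castAdd 2 j) := by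
  rw [adj4, m4_eq_submatrix, Matrix.adjugate_submatrix_equiv_self]
  rfl

theorem adj4_ne_zero_iff (x : Matrix (Fin 6) (Fin 6) 𝕜) : adj4 x ≠ 0 ↔
    ∃ i j : Fin 2, adjugate (sub4 x) (Fin.castAdd 2 i) (Fin.castAdd 2 j) ≠ 0 := by
  rw [ne_eq, ← Matrix.ext_iff]
  simp only [adj4_apply, Matrix.zero_apply]
  push Not
  rfl

theorem rankMatrix_eq (x : Matrix (Fin 6) (Fin 6) 𝕜) : rankMatrix x =
    !![(sub4 x).rank, ((sub4 x).submatrix id (Fin.natAdd 2 : Fin 2 → Fin 4)).rank;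
      ((sub4 x).submatrix (Fin.natAdd 2 : Fin 2 → Fin 4) id).rank, (blk x 2 2).rank] := by
  have e1 : x.submatrix ![2, 3, 4, 5] ![4, 5] =
      (sub4 x).submatrix id (Fin.natAdd 2 : Fin 2 → Fin 4) := by
    ext i j
    fin_cases i <;> fin_cases j <;> rfl
  have e2 : x.submatrix ![4, 5] ![2, 3, 4, 5] =
      (sub4 x).submatrix (Fin.natAdd 2 : Fin 2 → Fin 4) id := by
    ext i j
    fin_cases i <;> fin_cases j <;> rfl
  have e3 : x.submatrix ![4, 5] ![4, 5] = blk x 2 2 := by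
    ext i j
    fin_cases i <;> fin_cases j <;> rfl
  rw [← e1, ← e2, ← e3]
  rfl

theorem eq_two_by_two_iff {α : Type*} (a b c d a' b' c' d' : α) :
    !![a, b; c, d] = !![a', b'; c', d'] ↔ a = a' ∧ b = b' ∧ c = c' ∧ d = d' := by
  rw [← Matrix.ext_iff]
  simp [Fin.forall_fin_two, and_assoc]

theorem Z6_eq_locus0 : Z6 𝕜 = locus0 𝕜 := by
  ext x
  have h1 := rank_conditions_iff (sub4 x)
  have h2 := det_two_rank_one_iff (blk x 2 2)
  rw [← adj4_ne_zero_iff, ← det_m4_eq] at h1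
  have h3 : x ∈ Z6 𝕜 ↔ IsUnit x ∧ rankMatrix x = !![3, 2; 2, 1] := Iff.rfl
  have h4 : x ∈ locus0 𝕜 ↔ IsUnit x ∧ (blk x 2 2).det = 0 ∧ (m4 x).det = 0 ∧
    adjugate (blk x 2 2) ≠ 0 ∧ adj4 x ≠ 0 := Iff.rfl
  rw [h3, h4, rankMatrix_eq, eq_two_by_two_iff, h2]
  constructor
  · rintro ⟨a, b, c, d, e, f⟩
    obtain ⟨g, k⟩ := h1.1 ⟨b, c, d⟩
    exact ⟨a, e, g, f, k⟩
  · rintro ⟨a, e, g, f, k⟩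
    obtain ⟨b, c, d⟩ := h1.2 ⟨g, k⟩
    exact ⟨a, b, c, d, e, f⟩

end ZSix

end GinzburgRallis

end

noncomputable section

namespace GinzburgRallis

/-! ### Elimination into the first slice. -/

section NormalForms

variable {𝕜 : Type*} [RCLike 𝕜]

/-- The `6 × 6` matrix with given `2 × 2` blocks. -/
def ofBlk (f : Matrix (Fin 3) (Fin 3) (Matrix (Fin 2) (Fin 2) 𝕜)) : Matrix (Fin 6) (Fin 6) 𝕜 :=
  Matrix.of fun p q => f ⟨p / 2, by omega⟩ ⟨q / 2, by omega⟩ ⟨p % 2, by omega⟩ ⟨q % 2, by omega⟩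

theorem blk_ofBlk (f : Matrix (Fin 3) (Fin 3) (Matrix (Fin 2) (Fin 2) 𝕜)) (i j : Fin 3) :
    blk (ofBlk f) i j = f i j := by
  ext p q
  have h1 : (2 * (i : ℕ) + p) / 2 = i := by omega
  have h2 : (2 * (j : ℕ) + q) / 2 = j := by omega
  have h3 : (2 * (i : ℕ) + p) % 2 = p := by omega
  have h4 : (2 * (j : ℕ) + q) % 2 = q := by omega
  simp only [blk, ofBlk, Matrix.of_apply, h1, h2, h3, h4]

/-- The matrix with blocks `a b d | 0 a c | 0 0 a`. -/
def sMat (a b c d : Matrix (Fin 2) (Fin 2) 𝕜) : Matrix (Fin 6) (Fin 6) 𝕜 :=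
  ofBlk !![a, b, d; 0, a, c; 0, 0, a]

theorem blk_sMat (a b c d : Matrix (Fin 2) (Fin 2) 𝕜) (i j : Fin 3) :
    blk (sMat a b c d) i j = !![a, b, d; 0, a, c; 0, 0, a] i j := blk_ofBlk _ _ _

theorem hasShapeS_sMat (a b c d : Matrix (Fin 2) (Fin 2) 𝕜) : HasShapeS (sMat a b c d) := by
  simp [HasShapeS, blk_sMat]

theorem sMat_mul_inv (a b c d : Matrix (Fin 2) (Fin 2) 𝕜) (ha : a.det ≠ 0) :
    sMat a b c d * sMat a⁻¹ (-(a⁻¹ * b * a⁻¹)) (-(a⁻¹ * c * a⁻¹))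
      (a⁻¹ * (b * a⁻¹ * c - d) * a⁻¹) = 1 := by
  have h : a * a⁻¹ = 1 := Matrix.mul_nonsing_inv _ (isUnit_iff_ne_zero.2 ha)
  have h' : ∀ u : Matrix (Fin 2) (Fin 2) 𝕜, a * (a⁻¹ * u) = u := fun u => by
    rw [← mul_assoc, h, one_mul]
  apply blk_ext
  intro i j
  rw [blk_mul, blk_one]
  simp only [blk_sMat]
  fin_cases i <;> fin_cases j <;> simp [h, h', mul_assoc, mul_sub, sub_mul]
  abel

/-- The element of `S` with blocks `a b d | 0 a c | 0 0 a`. -/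
def sElt (a b c d : Matrix (Fin 2) (Fin 2) 𝕜) (ha : a.det ≠ 0) : GL (Fin 6) 𝕜 :=
  ⟨sMat a b c d, _, sMat_mul_inv a b c d ha, mul_eq_one_comm.1 (sMat_mul_inv a b c d ha)⟩

theorem sElt_mem (a b c d : Matrix (Fin 2) (Fin 2) 𝕜) (ha : a.det ≠ 0) :
    sElt a b c d ha ∈ S 𝕜 := hasShapeS_sMat a b c d

theorem sElt_val (a b c d : Matrix (Fin 2) (Fin 2) 𝕜) (ha : a.det ≠ 0) :
    (sElt a b c d ha : Matrix (Fin 6) (Fin 6) 𝕜) = sMat a b c d := rfl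

/-- The entries that are prescribed in `slice6`. -/
theorem slice6_iff {x : Matrix (Fin 6) (Fin 6) 𝕜} : x ∈ slice6 𝕜 ↔ x ∈ locus0 𝕜 ∧
    blk x 1 1 = 0 ∧ blk x 2 2 = !![0, 0; 0, 1] ∧ (∀ p, blk x 0 2 p 1 = 0) ∧
    (∀ p, blk x 1 2 p 1 = 0) ∧ (∀ p, blk x 2 0 1 p = 0) ∧ (∀ p, blk x 2 1 1 p = 0) := by
  rw [← Z6_eq_locus0]
  constructor
  · rintro ⟨h, hx⟩
    have e : ∀ i j, x i j = _ := fun i j => congrFun (congrFun hx i) j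
    refine ⟨h, ?_, ?_, ?_, ?_, ?_, ?_⟩
    · ext i j
      fin_cases i <;> fin_cases j
      exacts [e 2 2, e 2 3, e 3 2, e 3 3]
    · ext i j
      fin_cases i <;> fin_cases j
      exacts [e 4 4, e 4 5, e 5 4, e 5 5]
    · intro p
      fin_cases p
      exacts [e 0 5, e 1 5]
    · intro p
      fin_cases p
      exacts [e 2 5, e 3 5]
    · intro p
      fin_cases p
      exacts [e 5 0, e 5 1]
    · intro p
      fin_cases p
      exacts [e 5 2, e 5 3]
  · rintro ⟨h, h1, h2, h3, h4, h5, h6⟩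
    refine ⟨h, ?_⟩
    have e1 : ∀ i j, blk x 1 1 i j = 0 := fun i j => congrFun (congrFun h1 i) j
    have e2 : ∀ i j, blk x 2 2 i j = _ := fun i j => congrFun (congrFun h2 i) j
    ext i j
    fin_cases i <;> fin_cases j <;> first
      | rfl
      | exact e1 0 0
      | exact e1 0 1
      | exact e1 1 0
      | exact e1 1 1
      | exact e2 0 0
      | exact e2 0 1
      | exact e2 1 0
      | exact e2 1 1
      | exact h3 0
      | exact h3 1
      | exact h4 0
      | exact h4 1
      | exact h5 0
      | exact h5 1
      | exact h6 0
      | exact h6 1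

theorem transpose_two {α : Type*} (a b c d : α) : !![a, b; c, d]ᵀ = !![a, c; b, d] := by
  ext i j
  fin_cases i <;> fin_cases j <;> rfl

theorem exists_rank_one_form {A : Matrix (Fin 2) (Fin 2) 𝕜} (hA : A.det = 0) (h0 : A ≠ 0) :
    ∃ a b : Matrix (Fin 2) (Fin 2) 𝕜, a.det ≠ 0 ∧ b.det ≠ 0 ∧ a * A * bᵀ = !![0, 0; 0, 1] := by
  -- Elimination with a pivot in the lower right corner. In the other cases the swap `P` of rows or
  -- columns brings a nonzero entry there.
  have key : ∀ B : Matrix (Fin 2) (Fin 2) 𝕜, B.det = 0 → B 1 1 ≠ 0 →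
      ∃ a b : Matrix (Fin 2) (Fin 2) 𝕜, a.det ≠ 0 ∧ b.det ≠ 0 ∧
        a * B * bᵀ = !![0, 0; 0, 1] := by
    intro B hB h
    obtain ⟨p, q, r, s, rfl⟩ : ∃ p q r s : 𝕜, B = !![p, q; r, s] := ⟨_, _, _, _, B.eta_fin_two⟩
    have hs : s ≠ 0 := h
    rw [Matrix.det_fin_two_of] at hB
    refine ⟨!![1, -(q / s); 0, 1 / s], !![1, -(r / s); 0, 1], ?_, ?_, ?_⟩
    · simp [Matrix.det_fin_two, hs]
    · simp [Matrix.det_fin_two]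
    · rw [transpose_two, Matrix.mul_fin_two, Matrix.mul_fin_two]
      ext i j
      fin_cases i <;> fin_cases j <;> simp [hs]
      · field_simp
        linear_combination hB
      · field_simp
        ring
  let P : Matrix (Fin 2) (Fin 2) 𝕜 := !![0, 1; 1, 0]
  have hP : P.det ≠ 0 := by simp [P, Matrix.det_fin_two]
  have key2 : ∀ B : Matrix (Fin 2) (Fin 2) 𝕜, B.det = 0 → B 1 0 ≠ 0 →
      ∃ a b : Matrix (Fin 2) (Fin 2) 𝕜, a.det ≠ 0 ∧ b.det ≠ 0 ∧
        a * B * bᵀ = !![0, 0; 0, 1] := by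
    intro B hB h
    obtain ⟨a, b, ha, hb, e⟩ := key (B * P) (by rw [Matrix.det_mul, hB, zero_mul]) (by
      simpa [P, Matrix.mul_apply, Fin.sum_univ_two] using h)
    refine ⟨a, b * Pᵀ, ha, ?_, ?_⟩
    · rw [Matrix.det_mul, Matrix.det_transpose]
      exact mul_ne_zero hb hP
    · rw [← e, Matrix.transpose_mul, Matrix.transpose_transpose]
      simp only [mul_assoc]
  by_cases h1 : A 1 1 ≠ 0
  · exact key A hA h1
  by_cases h2 : A 1 0 ≠ 0
  · exact key2 A hA h2
  have h3 : ∃ j, (P * A) 1 j ≠ 0 := by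
    by_contra! h
    refine h0 (Matrix.ext fun i j => ?_)
    have := h j
    simp only [P, Matrix.mul_apply, Fin.sum_univ_two] at this
    push Not at h1 h2
    fin_cases i <;> fin_cases j <;> simp_all
  have h4 : (P * A).det = 0 := by rw [Matrix.det_mul, hA, mul_zero]
  have h5 : ∃ a b : Matrix (Fin 2) (Fin 2) 𝕜, a.det ≠ 0 ∧ b.det ≠ 0 ∧
      a * (P * A) * bᵀ = !![0, 0; 0, 1] := by
    obtain ⟨j, hj⟩ := h3
    fin_cases j
    · exact key2 _ h4 hj
    · exact key _ h4 hj
  obtain ⟨a, b, ha, hb, e⟩ := h5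
  refine ⟨a * P, b, ?_, hb, by rw [← e]; simp only [mul_assoc]⟩
  rw [Matrix.det_mul]
  exact mul_ne_zero ha hP

theorem exists_act_blk22 {x : Matrix (Fin 6) (Fin 6) 𝕜} (hx : x ∈ locus0 𝕜) :
    ∃ h ∈ groupH 𝕜, blk (act h x) 2 2 = !![0, 0; 0, 1] := by
  obtain ⟨a, b, ha, hb, e⟩ := exists_rank_one_form hx.2.1 (fun h => hx.2.2.2.1 (by
    rw [adj2, h, adjugate_zero]))
  refine ⟨(sElt a 0 0 0 ha, sElt b 0 0 0 hb), ⟨sElt_mem _ _ _ _ ha, sElt_mem _ _ _ _ hb⟩, ?_⟩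
  rw [act_apply, sElt_val, sElt_val, blk22_act (hasShapeS_sMat _ _ _ _) (hasShapeS_sMat _ _ _ _),
    blk_sMat, blk_sMat]
  exact e

theorem det_one_ne_zero : (1 : Matrix (Fin 2) (Fin 2) 𝕜).det ≠ 0 := by simp

theorem exists_act_border {x : Matrix (Fin 6) (Fin 6) 𝕜} (hx : blk x 2 2 = !![0, 0; 0, 1]) :
    ∃ h ∈ groupH 𝕜, blk (act h x) 2 2 = !![0, 0; 0, 1] ∧ (∀ p, blk (act h x) 0 2 p 1 = 0) ∧
    (∀ p, blk (act h x) 1 2 p 1 = 0) ∧ (∀ p, blk (act h x) 2 0 1 p = 0) ∧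
    (∀ p, blk (act h x) 2 1 1 p = 0) := by
  -- The entry 1 in the corner of the block `(2, 2)` serves as pivot and clears the rest of its
  -- column from the left and of its row from the right.
  refine ⟨(sElt 1 0 (-blk x 1 2) (-blk x 0 2) det_one_ne_zero,
    sElt 1 0 (-(blk x 2 1)ᵀ) (-(blk x 2 0)ᵀ) det_one_ne_zero),
    ⟨sElt_mem _ _ _ _ det_one_ne_zero, sElt_mem _ _ _ _ det_one_ne_zero⟩, ?_⟩
  simp only [act_apply, sElt_val, blk_mul, blk_transpose, blk_sMat]
  simp [hx, Matrix.mul_apply, Fin.sum_univ_two, Matrix.add_apply, Matrix.vecMul, dotProduct]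

/-- The entries of the lower right `4 × 4` block after the first reduction step. -/
theorem sub4_border {x : Matrix (Fin 6) (Fin 6) 𝕜} (h1 : blk x 2 2 = !![0, 0; 0, 1])
    (h2 : ∀ p, blk x 1 2 p 1 = 0) (h3 : ∀ p, blk x 2 1 1 p = 0) :
    sub4 x = !![x 2 2, x 2 3, x 2 4, 0; x 3 2, x 3 3, x 3 4, 0; x 4 2, x 4 3, 0, 0; 0, 0, 0, 1] := by
  have e2 : ∀ i j, blk x 2 2 i j = _ := fun i j => congrFun (congrFun h1 i) j
  ext i j
  fin_cases i <;> fin_cases j <;> first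
    | rfl
    | exact h2 0
    | exact h2 1
    | exact h3 0
    | exact h3 1
    | exact e2 0 0
    | exact e2 0 1
    | exact e2 1 0
    | exact e2 1 1

theorem det_border (a b c d v₁ v₂ w₁ w₂ : 𝕜) :
    (!![a, b, v₁, 0; c, d, v₂, 0; w₁, w₂, 0, 0; 0, 0, 0, 1] : Matrix (Fin 4) (Fin 4) 𝕜).det =
      -(a * v₂ * w₂) + b * v₂ * w₁ + v₁ * c * w₂ - v₁ * d * w₁ := by
  simp [Matrix.det_succ_row_zero, Fin.sum_univ_succ, Fin.succAbove]
  ring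

/-- Up to sign this is the outer product of `(w₂, -w₁)` and `(v₂, -v₁)`; it is nonzero exactly when
both borders are nonzero vectors. -/
theorem adjugate_border (a b c d v₁ v₂ w₁ w₂ : 𝕜) (i j : Fin 2) :
    adjugate (!![a, b, v₁, 0; c, d, v₂, 0; w₁, w₂, 0, 0; 0, 0, 0, 1] : Matrix (Fin 4) (Fin 4) 𝕜)
      (Fin.castAdd 2 i) (Fin.castAdd 2 j) = !![-(v₂ * w₂), v₁ * w₂; v₂ * w₁, -(v₁ * w₁)] i j := by
  rw [Matrix.adjugate_fin_succ_eq_det_submatrix, Matrix.det_fin_three]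
  fin_cases i <;> fin_cases j <;> simp [Fin.succAbove]

/-- A `2 × 2` matrix that becomes singular when bordered by `v` and `w` is a sum of multiples of
`v` and `w`. -/
theorem exists_outer {a b c d v₁ v₂ w₁ w₂ : 𝕜} (hv : v₁ ≠ 0 ∨ v₂ ≠ 0) (hw : w₁ ≠ 0 ∨ w₂ ≠ 0)
    (h : -(a * v₂ * w₂) + b * v₂ * w₁ + v₁ * c * w₂ - v₁ * d * w₁ = 0) :
    ∃ p₁ p₂ q₁ q₂ : 𝕜, a = v₁ * p₁ + q₁ * w₁ ∧ b = v₁ * p₂ + q₁ * w₂ ∧ c = v₂ * p₁ + q₂ * w₁ ∧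
      d = v₂ * p₂ + q₂ * w₂ := by
  -- With `v₁` and `w₁` invertible, set `p₁ = 0` and solve three entries; the bordered determinant
  -- yields the fourth. Interchanging rows and columns covers the other positions.
  have key : ∀ {a b c d v₁ v₂ w₁ w₂ : 𝕜}, v₁ ≠ 0 → w₁ ≠ 0 →
      -(a * v₂ * w₂) + b * v₂ * w₁ + v₁ * c * w₂ - v₁ * d * w₁ = 0 →
      ∃ p₁ p₂ q₁ q₂ : 𝕜, a = v₁ * p₁ + q₁ * w₁ ∧ b = v₁ * p₂ + q₁ * w₂ ∧ c = v₂ * p₁ + q₂ * w₁ ∧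
        d = v₂ * p₂ + q₂ * w₂ := by
    intro a b c d v₁ v₂ w₁ w₂ hv hw h
    refine ⟨0, (b - a / w₁ * w₂) / v₁, a / w₁, c / w₁, by field_simp; ring, by field_simp; ring,
      by field_simp; ring, ?_⟩
    field_simp
    linear_combination -h
  rcases hv with hv | hv <;> rcases hw with hw | hw
  · exact key hv hw h
  · obtain ⟨p₁, p₂, q₁, q₂, e1, e2, e3, e4⟩ := key (a := b) (b := a) (c := d) (d := c) hv hw
      (v₂ := v₂) (w₂ := w₁) (by linear_combination -h)
    exact ⟨p₂, p₁, q₁, q₂, e2, e1, e4, e3⟩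
  · obtain ⟨p₁, p₂, q₁, q₂, e1, e2, e3, e4⟩ := key (a := c) (b := d) (c := a) (d := b) hv hw
      (v₂ := v₁) (w₂ := w₂) (by linear_combination -h)
    exact ⟨p₁, p₂, q₂, q₁, e3, e4, e1, e2⟩
  · obtain ⟨p₁, p₂, q₁, q₂, e1, e2, e3, e4⟩ := key (a := d) (b := c) (c := b) (d := a) hv hw
      (v₂ := v₁) (w₂ := w₁) (by linear_combination h)
    exact ⟨p₂, p₁, q₂, q₁, e4, e3, e2, e1⟩

theorem ne_zero_border {x : Matrix (Fin 6) (Fin 6) 𝕜} (hx : x ∈ locus0 𝕜)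
    (h1 : blk x 2 2 = !![0, 0; 0, 1]) (h2 : ∀ p, blk x 1 2 p 1 = 0)
    (h3 : ∀ p, blk x 2 1 1 p = 0) :
    (x 2 4 ≠ 0 ∨ x 3 4 ≠ 0) ∧ (x 4 2 ≠ 0 ∨ x 4 3 ≠ 0) := by
  obtain ⟨i, j, hij⟩ := (adj4_ne_zero_iff x).1 hx.2.2.2.2
  rw [sub4_border h1 h2 h3, adjugate_border] at hij
  by_contra h
  rw [not_and_or] at h
  push Not at h
  apply hij
  rcases h with ⟨h, h'⟩ | ⟨h, h'⟩ <;> fin_cases i <;> fin_cases j <;> simp [h, h']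

theorem exists_act_slice6 {x : Matrix (Fin 6) (Fin 6) 𝕜} (hx : x ∈ locus0 𝕜) :
    ∃ h ∈ groupH 𝕜, act h x ∈ slice6 𝕜 := by
  obtain ⟨h, hh, e⟩ := exists_act_blk22 hx
  obtain ⟨k, hk, k1, k2, k3, k4, k5⟩ := exists_act_border e
  rw [← act_mul] at k1 k2 k3 k4 k5
  have hkh := (groupH 𝕜).mul_mem hk hh
  have hy := isStable_locus0 _ hkh _ hx
  generalize hy' : act (k * h) x = y at *
  obtain ⟨n1, n2⟩ := ne_zero_border hy k1 k3 k5
  have hd := hy.2.2.1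
  rw [det_m4_eq, sub4_border k1 k3 k5, det_border] at hd
  obtain ⟨p₁, p₂, q₁, q₂, e1, e2, e3, e4⟩ := exists_outer n1 n2 hd
  -- The row `w` in the block `(2, 1)` and the column `v` in the block `(1, 2)` clear the block `(1,
  -- 1)`, with the coefficients just found.
  let g : GL (Fin 6) 𝕜 × GL (Fin 6) 𝕜 := (sElt 1 0 !![-q₁, 0; -q₂, 0] 0 det_one_ne_zero,
    sElt 1 0 !![-p₁, 0; -p₂, 0] 0 det_one_ne_zero)
  have hg : g ∈ groupH 𝕜 := ⟨sElt_mem _ _ _ _ det_one_ne_zero, sElt_mem _ _ _ _ det_one_ne_zero⟩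
  refine ⟨g * (k * h), (groupH 𝕜).mul_mem hg hkh, ?_⟩
  rw [act_mul, hy', slice6_iff]
  have f1 : blk y 1 1 = !![y 2 2, y 2 3; y 3 2, y 3 3] := by
    ext i j
    fin_cases i <;> fin_cases j <;> rfl
  have f2 : blk y 1 2 = !![y 2 4, 0; y 3 4, 0] := by
    ext i j
    fin_cases i <;> fin_cases j
    exacts [rfl, k3 0, rfl, k3 1]
  have f3 : blk y 2 1 = !![y 4 2, y 4 3; 0, 0] := by
    ext i j
    fin_cases i <;> fin_cases j
    exacts [rfl, rfl, k5 0, k5 1]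
  have f4 : blk y 0 2 = !![y 0 4, 0; y 1 4, 0] := by
    ext i j
    fin_cases i <;> fin_cases j
    exacts [rfl, k2 0, rfl, k2 1]
  have f5 : blk y 2 0 = !![y 4 0, y 4 1; 0, 0] := by
    ext i j
    fin_cases i <;> fin_cases j
    exacts [rfl, rfl, k4 0, k4 1]
  refine ⟨isStable_locus0 _ hg _ hy, ?_⟩
  simp only [g, act_apply, sElt_val, blk_mul, blk_transpose, blk_sMat]
  simp only [f1, f2, f3, f4, f5, k1, e1, e2, e3, e4]
  refine ⟨?_, ?_, ?_, ?_, ?_, ?_⟩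
  · ext i j
    fin_cases i <;> fin_cases j <;> simp [transpose_two]
  all_goals simp [Fin.forall_fin_two, transpose_two]

end NormalForms

end GinzburgRallis

end

noncomputable section

namespace GinzburgRallis

/-! ### Identification of the saturated slices with the loci. -/

section Saturations

variable {𝕜 : Type*} [RCLike 𝕜]

/-- It suffices that the stable set can be moved into a larger slice `Y'` and that on `Y'` the slice
condition is the invariant equation. -/
theorem saturation_eq_of_slice {Z Y Y' : Set (Matrix (Fin 6) (Fin 6) 𝕜)}
    (hZ : IsStable (groupH 𝕜) Z) (h : ∀ z ∈ Z, ∃ h ∈ groupH 𝕜, act h z ∈ Y')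
    (hY : ∀ x ∈ Y', x ∈ Y ↔ x ∈ Z) (hYY' : Y ⊆ Y') : saturation (groupH 𝕜) Y = Z := by
  refine saturation_eq hZ (fun x hx => (hY x (hYY' hx)).1 hx) fun z hz => ?_
  obtain ⟨k, hk, hk'⟩ := h z hz
  exact ⟨k, hk, (hY _ hk').2 (hZ k hk z hz)⟩

theorem adj2_eq {x : Matrix (Fin 6) (Fin 6) 𝕜} (hx : blk x 2 2 = !![0, 0; 0, 1]) :
    adj2 x = !![1, 0; 0, 0] := by
  rw [adj2, hx, Matrix.adjugate_fin_two_of, neg_zero]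

theorem trace_invB_slice6 {x : Matrix (Fin 6) (Fin 6) 𝕜} (hx : x ∈ slice6 𝕜) :
    (invB x).trace = x 4 2 ∧ (invB' x).trace = x 2 4 := by
  obtain ⟨-, -, h, -⟩ := slice6_iff.1 hx
  rw [invB, invB', adj2_eq h]
  constructor
  · rw [Matrix.eta_fin_two (blk x 2 1), Matrix.mul_fin_two, Matrix.trace_fin_two]
    simp
    rfl
  · rw [Matrix.eta_fin_two (blk x 1 2), Matrix.mul_fin_two, Matrix.trace_fin_two]
    simp
    rfl

theorem slice6_subset : slice6 𝕜 ⊆ locus0 𝕜 := fun _ hx => (slice6_iff.1 hx).1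

theorem mem_slice61_iff {x : Matrix (Fin 6) (Fin 6) 𝕜} (hx : x ∈ slice6 𝕜) :
    x ∈ slice61 𝕜 ↔ x ∈ locus1 𝕜 := by
  obtain ⟨h1, h2⟩ := trace_invB_slice6 hx
  constructor
  · rintro ⟨-, h⟩
    exact ⟨slice6_subset hx, by rw [h1, h2, h]⟩
  · rintro ⟨-, h⟩
    rw [h1, h2] at h
    exact ⟨hx, h⟩

theorem mem_slice62_iff {x : Matrix (Fin 6) (Fin 6) 𝕜} (hx : x ∈ slice6 𝕜) :
    x ∈ slice62 𝕜 ↔ x ∈ locus2 𝕜 := by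
  obtain ⟨h1, h2⟩ := trace_invB_slice6 hx
  constructor
  · rintro ⟨-, h⟩
    exact ⟨slice6_subset hx, by rw [h1, h2]; exact h⟩
  · rintro ⟨-, h⟩
    rw [h1, h2] at h
    exact ⟨hx, h⟩

theorem saturation_slice61 : saturation (groupH 𝕜) (slice61 𝕜) = locus1 𝕜 :=
  saturation_eq_of_slice isStable_locus1 (fun _ hz => exists_act_slice6 hz.1)
    (fun _ hx => mem_slice61_iff hx) (fun _ hx => hx.1)

theorem saturation_slice62 : saturation (groupH 𝕜) (slice62 𝕜) = locus2 𝕜 :=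
  saturation_eq_of_slice isStable_locus2 (fun _ hz => exists_act_slice6 hz.1)
    (fun _ hx => mem_slice62_iff hx) (fun _ hx => hx.1)

/-- The entries that are prescribed in `slice62'`. -/
theorem slice62'_iff {x : Matrix (Fin 6) (Fin 6) 𝕜} : x ∈ slice62' 𝕜 ↔ x ∈ locus0 𝕜 ∧
    blk x 1 1 = 0 ∧ blk x 2 2 = !![0, 0; 0, 1] ∧ blk x 0 2 = 0 ∧ blk x 1 2 = !![0, 0; 1, 0] ∧
    blk x 2 0 = 0 ∧ blk x 2 1 = !![0, 1; 0, 0] ∧ (∀ p, blk x 0 1 p 1 = 0) ∧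
    (∀ p, blk x 1 0 1 p = 0) := by
  constructor
  · rintro ⟨h, hx⟩
    have e : ∀ i j, x i j = _ := fun i j => congrFun (congrFun hx i) j
    obtain ⟨h0, h1, h2, -⟩ := slice6_iff.1 h.1
    refine ⟨h0, h1, h2, ?_, ?_, ?_, ?_, ?_, ?_⟩
    · ext i j
      fin_cases i <;> fin_cases j
      exacts [e 0 4, e 0 5, e 1 4, e 1 5]
    · ext i j
      fin_cases i <;> fin_cases j
      exacts [e 2 4, e 2 5, e 3 4, e 3 5]
    · ext i j
      fin_cases i <;> fin_cases j
      exacts [e 4 0, e 4 1, e 5 0, e 5 1]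
    · ext i j
      fin_cases i <;> fin_cases j
      exacts [e 4 2, e 4 3, e 5 2, e 5 3]
    · intro p
      fin_cases p
      exacts [e 0 3, e 1 3]
    · intro p
      fin_cases p
      exacts [e 3 0, e 3 1]
  · rintro ⟨h, h11, h22, h02, h12, h20, h21, h01, h10⟩
    have e02 : ∀ i j, blk x 0 2 i j = _ := fun i j => congrFun (congrFun h02 i) j
    have e12 : ∀ i j, blk x 1 2 i j = _ := fun i j => congrFun (congrFun h12 i) j
    have e20 : ∀ i j, blk x 2 0 i j = _ := fun i j => congrFun (congrFun h20 i) j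
    have e21 : ∀ i j, blk x 2 1 i j = _ := fun i j => congrFun (congrFun h21 i) j
    have e11 : ∀ i j, blk x 1 1 i j = _ := fun i j => congrFun (congrFun h11 i) j
    have e22 : ∀ i j, blk x 2 2 i j = _ := fun i j => congrFun (congrFun h22 i) j
    have h6 : x ∈ slice6 𝕜 := slice6_iff.2 ⟨h, h11, h22, fun p => e02 p 1, fun p => by
      rw [e12]; fin_cases p <;> rfl, fun p => e20 1 p, fun p => by rw [e21]; fin_cases p <;> rfl⟩
    refine ⟨⟨h6, e12 0 0, e21 0 0⟩, ?_⟩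
    ext i j
    fin_cases i <;> fin_cases j <;> first
      | rfl
      | exact e11 0 0
      | exact e11 0 1
      | exact e11 1 0
      | exact e11 1 1
      | exact e22 0 0
      | exact e22 0 1
      | exact e22 1 0
      | exact e22 1 1
      | exact e02 0 0
      | exact e02 0 1
      | exact e02 1 0
      | exact e02 1 1
      | exact e20 0 0
      | exact e20 0 1
      | exact e20 1 0
      | exact e20 1 1
      | exact e12 0 0
      | exact e12 0 1
      | exact e12 1 0
      | exact e12 1 1
      | exact e21 0 0
      | exact e21 0 1
      | exact e21 1 0
      | exact e21 1 1
      | exact h01 0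
      | exact h01 1
      | exact h10 0
      | exact h10 1

theorem slice62_blocks {x : Matrix (Fin 6) (Fin 6) 𝕜} (hx : x ∈ slice62 𝕜) :
    blk x 1 1 = 0 ∧ blk x 2 2 = !![0, 0; 0, 1] ∧ blk x 0 2 = !![x 0 4, 0; x 1 4, 0] ∧
    blk x 1 2 = !![0, 0; x 3 4, 0] ∧ blk x 2 0 = !![x 4 0, x 4 1; 0, 0] ∧
    blk x 2 1 = !![0, x 4 3; 0, 0] := by
  obtain ⟨h6, hx1, hx2⟩ := hx
  obtain ⟨-, h11, h22, h02, h12, h20, h21⟩ := slice6_iff.1 h6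
  refine ⟨h11, h22, ?_, ?_, ?_, ?_⟩
  · ext i j
    fin_cases i <;> fin_cases j
    exacts [rfl, h02 0, rfl, h02 1]
  · ext i j
    fin_cases i <;> fin_cases j
    exacts [hx1, h12 0, rfl, h12 1]
  · ext i j
    fin_cases i <;> fin_cases j
    exacts [rfl, rfl, h20 0, h20 1]
  · ext i j
    fin_cases i <;> fin_cases j
    exacts [hx2, rfl, h21 0, h21 1]

theorem exists_act_scale {x : Matrix (Fin 6) (Fin 6) 𝕜} (hx : x ∈ slice62 𝕜) :
    ∃ h ∈ groupH 𝕜, act h x ∈ slice62 𝕜 ∧ act h x 3 4 = 1 ∧ act h x 4 3 = 1 := by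
  obtain ⟨h11, h22, h02, h12, h20, h21⟩ := slice62_blocks hx
  have h0 := slice6_subset hx.1
  obtain ⟨n1, n2⟩ := ne_zero_border h0 h22 (fun p => by rw [h12]; fin_cases p <;> rfl)
    (fun p => by rw [h21]; fin_cases p <;> rfl)
  have s0 : x 3 4 ≠ 0 := n1.resolve_left fun h => h hx.2.1
  have t0 : x 4 3 ≠ 0 := n2.resolve_left fun h => h hx.2.2
  -- These diagonal matrices normalize the two pivots, one from each side, and keep the corner entry
  -- 1.
  have hs : (!![1 / x 4 3, 0; 0, 1] : Matrix (Fin 2) (Fin 2) 𝕜).det ≠ 0 := by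
    simp [Matrix.det_fin_two, t0]
  have ht : (!![1 / x 3 4, 0; 0, 1] : Matrix (Fin 2) (Fin 2) 𝕜).det ≠ 0 := by
    simp [Matrix.det_fin_two, s0]
  let g : GL (Fin 6) 𝕜 × GL (Fin 6) 𝕜 := (sElt _ 0 0 0 hs, sElt _ 0 0 0 ht)
  have hg : g ∈ groupH 𝕜 := ⟨sElt_mem _ _ _ _ hs, sElt_mem _ _ _ _ ht⟩
  have b11 : blk (act g x) 1 1 = 0 := by
    simp only [g, act_apply, sElt_val, blk_mul, blk_transpose, blk_sMat]
    simp [h11]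
  have b22 : blk (act g x) 2 2 = !![0, 0; 0, 1] := by
    simp only [g, act_apply, sElt_val, blk_mul, blk_transpose, blk_sMat]
    simp [h22, transpose_two, funext_iff, Fin.forall_fin_two]
  have b12 : blk (act g x) 1 2 = !![0, 0; 1, 0] := by
    simp only [g, act_apply, sElt_val, blk_mul, blk_transpose, blk_sMat]
    simp [h12, transpose_two, s0, funext_iff, Fin.forall_fin_two]
  have b21 : blk (act g x) 2 1 = !![0, 1; 0, 0] := by
    simp only [g, act_apply, sElt_val, blk_mul, blk_transpose, blk_sMat]
    simp [h21, transpose_two, t0, funext_iff, Fin.forall_fin_two]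
  have b02 : ∀ p, blk (act g x) 0 2 p 1 = 0 := by
    simp only [g, act_apply, sElt_val, blk_mul, blk_transpose, blk_sMat]
    simp [h02, transpose_two, Fin.forall_fin_two]
  have b20 : ∀ p, blk (act g x) 2 0 1 p = 0 := by
    simp only [g, act_apply, sElt_val, blk_mul, blk_transpose, blk_sMat]
    simp [h20, transpose_two]
  have e12 : ∀ i j, blk (act g x) 1 2 i j = _ := fun i j => congrFun (congrFun b12 i) j
  have e21 : ∀ i j, blk (act g x) 2 1 i j = _ := fun i j => congrFun (congrFun b21 i) j
  refine ⟨g, hg, ⟨slice6_iff.2 ⟨isStable_locus0 g hg x h0, b11, b22, b02,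
    fun p => by rw [e12]; fin_cases p <;> rfl, b20, fun p => by rw [e21]; fin_cases p <;> rfl⟩,
    e12 0 0, e21 0 0⟩, e12 1 0, e21 0 1⟩

theorem exists_act_clear {x : Matrix (Fin 6) (Fin 6) 𝕜} (hx : x ∈ slice62 𝕜) (h34 : x 3 4 = 1)
    (h43 : x 4 3 = 1) : ∃ h ∈ groupH 𝕜, act h x ∈ slice62' 𝕜 := by
  obtain ⟨h11, h22, h02, h12, h20, h21⟩ := slice62_blocks hx
  rw [h34] at h12
  rw [h43] at h21
  have h01 : blk x 0 1 = !![x 0 2, x 0 3; x 1 2, x 1 3] := by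
    ext i j
    fin_cases i <;> fin_cases j <;> rfl
  have h10 : blk x 1 0 = !![x 2 0, x 2 1; x 3 0, x 3 1] := by
    ext i j
    fin_cases i <;> fin_cases j <;> rfl
  have h0 := slice6_subset hx.1
  -- The pivots at `(3, 4)` and `(4, 3)`, now equal to 1, clear what remains in their rows and
  -- columns outside the lower right 4 × 4 block.
  let g : GL (Fin 6) 𝕜 × GL (Fin 6) 𝕜 :=
    (sElt 1 !![0, -x 0 4; 0, -x 1 4] 0 !![-x 0 3, 0; -x 1 3, 0] det_one_ne_zero,
      sElt 1 !![0, -x 4 0; 0, -x 4 1] 0 !![-x 3 0, 0; -x 3 1, 0] det_one_ne_zero)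
  have hg : g ∈ groupH 𝕜 := ⟨sElt_mem _ _ _ _ det_one_ne_zero, sElt_mem _ _ _ _ det_one_ne_zero⟩
  refine ⟨g, hg, slice62'_iff.2 ⟨isStable_locus0 g hg x h0, ?_⟩⟩
  simp only [g, act_apply, sElt_val, blk_mul, blk_transpose, blk_sMat]
  simp [h11, h22, h02, h12, h20, h21, h01, h10, transpose_two, Fin.forall_fin_two]
  simp [← Matrix.ext_iff, Fin.forall_fin_two]

theorem exists_act_slice62' {x : Matrix (Fin 6) (Fin 6) 𝕜} (hx : x ∈ locus2 𝕜) :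
    ∃ h ∈ groupH 𝕜, act h x ∈ slice62' 𝕜 := by
  obtain ⟨h, hh, h6⟩ := exists_act_slice6 hx.1
  have h62 := (mem_slice62_iff h6).2 (isStable_locus2 h hh x hx)
  obtain ⟨k, hk, k1, k2, k3⟩ := exists_act_scale h62
  obtain ⟨l, hl, hl'⟩ := exists_act_clear k1 k2 k3
  rw [← act_mul, ← act_mul] at hl'
  exact ⟨_, (groupH 𝕜).mul_mem ((groupH 𝕜).mul_mem hl hk) hh, hl'⟩

theorem slice62'_subset : slice62' 𝕜 ⊆ locus2 𝕜 := fun _ hx => (mem_slice62_iff hx.1.1).1 hx.1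

/-- The 4 × 4 block is an invertible 3 × 3 part of determinant `-1`, bordered by a zero row and a
zero column, so only one cofactor survives. -/
theorem adjugate_slice62' {x : Matrix (Fin 6) (Fin 6) 𝕜} (hx : x ∈ slice62' 𝕜) :
    adjugate (m4 x) = fromBlocks !![-1, 0; 0, 0] 0 0 0 := by
  obtain ⟨-, h11, h22, -, h12, -, h21, -⟩ := slice62'_iff.1 hx
  have e : sub4 x = !![0, 0, 0, 0; 0, 0, 1, 0; 0, 1, 0, 0; 0, 0, 0, 1] := by
    have e11 : ∀ i j, blk x 1 1 i j = _ := fun i j => congrFun (congrFun h11 i) j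
    have e12 : ∀ i j, blk x 1 2 i j = _ := fun i j => congrFun (congrFun h12 i) j
    have e21 : ∀ i j, blk x 2 1 i j = _ := fun i j => congrFun (congrFun h21 i) j
    have e22 : ∀ i j, blk x 2 2 i j = _ := fun i j => congrFun (congrFun h22 i) j
    ext i j
    fin_cases i <;> fin_cases j
    exacts [e11 0 0, e11 0 1, e12 0 0, e12 0 1, e11 1 0, e11 1 1, e12 1 0, e12 1 1,
      e21 0 0, e21 0 1, e22 0 0, e22 0 1, e21 1 0, e21 1 1, e22 1 0, e22 1 1]
  have e' : adjugate (sub4 x) = !![-1, 0, 0, 0; 0, 0, 0, 0; 0, 0, 0, 0; 0, 0, 0, 0] := by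
    rw [e]
    ext i j
    rw [Matrix.adjugate_fin_succ_eq_det_submatrix, Matrix.det_fin_three]
    fin_cases i <;> fin_cases j <;> simp [Fin.succAbove]
  rw [m4_eq_submatrix, Matrix.adjugate_submatrix_equiv_self, e']
  ext (i | i) (j | j) <;> fin_cases i <;> fin_cases j <;> rfl

/-- This dictionary turns the trace equations into the entry conditions on the slices: the traces of
`invA` and `invA'` are `-x 2 0` and `-x 0 2`. -/
theorem invariants_slice62' {x : Matrix (Fin 6) (Fin 6) 𝕜} (hx : x ∈ slice62' 𝕜) :
    adj4 x = !![-1, 0; 0, 0] ∧ adj2 x = !![1, 0; 0, 0] ∧ invB x = !![0, 1; 0, 0] ∧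
    invB' x = !![0, 0; 1, 0] ∧ invA x = !![-x 2 0, -x 2 1; 0, 0] ∧
    invA' x = !![-x 0 2, 0; -x 1 2, 0] := by
  have h := adjugate_slice62' hx
  obtain ⟨-, h11, h22, -, h12, -, h21, -⟩ := slice62'_iff.1 hx
  have h2 := adj2_eq h22
  refine ⟨by rw [adj4, h, toBlocks_fromBlocks₁₁], h2, ?_, ?_, ?_, ?_⟩
  · rw [invB, h2, h21, Matrix.mul_fin_two]
    simp
  · rw [invB', h2, h12, Matrix.mul_fin_two]
    simp
  · rw [invA, h, colP, fromBlocks_mul_fromRows]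
    ext i j
    fin_cases i <;> fin_cases j <;>
      simp [toRows₁, Matrix.vecMul, dotProduct, Fin.sum_univ_two] <;> rfl
  · rw [invA', h, rowP, fromCols_mul_fromBlocks]
    ext i j
    fin_cases i <;> fin_cases j <;>
      simp [toCols₁, Matrix.mul_apply, Fin.sum_univ_two] <;> rfl

theorem mem_slice63'_iff {x : Matrix (Fin 6) (Fin 6) 𝕜} (hx : x ∈ slice62' 𝕜) :
    x ∈ slice63' 𝕜 ↔ x ∈ locus3 𝕜 := by
  obtain ⟨-, -, -, -, h1, h2⟩ := invariants_slice62' hx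
  have h3 : x ∈ locus3 𝕜 ↔ x ∈ locus2 𝕜 ∧ (invA x).trace = (invA' x).trace := Iff.rfl
  have h4 : x ∈ slice63' 𝕜 ↔ x ∈ slice62' 𝕜 ∧ x 0 2 = x 2 0 := Iff.rfl
  rw [h3, h4, h1, h2]
  simp [Matrix.trace_fin_two, hx, slice62'_subset hx, eq_comm]

theorem mem_slice64'_iff {x : Matrix (Fin 6) (Fin 6) 𝕜} (hx : x ∈ slice62' 𝕜) :
    x ∈ slice64' 𝕜 ↔ x ∈ locus4 𝕜 := by
  obtain ⟨-, -, -, -, h1, h2⟩ := invariants_slice62' hx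
  have h3 : x ∈ locus4 𝕜 ↔ x ∈ locus2 𝕜 ∧ (invA x).trace = 0 ∧ (invA' x).trace = 0 := Iff.rfl
  have h4 : x ∈ slice64' 𝕜 ↔ x ∈ slice62' 𝕜 ∧ x 0 2 = 0 ∧ x 2 0 = 0 := Iff.rfl
  rw [h3, h4, h1, h2]
  simp [Matrix.trace_fin_two, hx, slice62'_subset hx, and_comm]

theorem saturation_slice63' : saturation (groupH 𝕜) (slice63' 𝕜) = locus3 𝕜 :=
  saturation_eq_of_slice isStable_locus3 (fun _ hz => exists_act_slice62' hz.1)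
    (fun _ hx => mem_slice63'_iff hx) (fun _ hx => hx.1)

theorem saturation_slice64' : saturation (groupH 𝕜) (slice64' 𝕜) = locus4 𝕜 :=
  saturation_eq_of_slice isStable_locus4 (fun _ hz => exists_act_slice62' hz.1)
    (fun _ hx => mem_slice64'_iff hx) (fun _ hx => hx.1)

/-- The entries that are prescribed in `slice64''`. -/
theorem slice64''_iff {x : Matrix (Fin 6) (Fin 6) 𝕜} : x ∈ slice64'' 𝕜 ↔ x ∈ slice62' 𝕜 ∧
    blk x 0 0 = !![x 0 0, 0; 0, 0] ∧ blk x 0 1 = !![0, 0; x 1 2, 0] ∧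
    blk x 1 0 = !![0, x 2 1; 0, 0] := by
  constructor
  · rintro ⟨h, hx⟩
    have e : ∀ i j, x i j = _ := fun i j => congrFun (congrFun hx i) j
    refine ⟨h.1, ?_, ?_, ?_⟩
    · ext i j
      fin_cases i <;> fin_cases j
      exacts [e 0 0, e 0 1, e 1 0, e 1 1]
    · ext i j
      fin_cases i <;> fin_cases j
      exacts [e 0 2, e 0 3, e 1 2, e 1 3]
    · ext i j
      fin_cases i <;> fin_cases j
      exacts [e 2 0, e 2 1, e 3 0, e 3 1]
  · rintro ⟨h, h00, h01, h10⟩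
    have e00 : ∀ i j, blk x 0 0 i j = _ := fun i j => congrFun (congrFun h00 i) j
    have e01 : ∀ i j, blk x 0 1 i j = _ := fun i j => congrFun (congrFun h01 i) j
    have e10 : ∀ i j, blk x 1 0 i j = _ := fun i j => congrFun (congrFun h10 i) j
    have e : ∀ i j, x i j = _ := fun i j => congrFun (congrFun h.2 i) j
    refine ⟨⟨h, e01 0 0, e10 0 0⟩, ?_⟩
    ext i j
    by_cases h3 : 3 ≤ i ∨ 3 ≤ j
    · rw [e i j]
      fin_cases i <;> fin_cases j <;> first | rfl | simp at h3
    · fin_cases i <;> fin_cases j <;> first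
        | rfl
        | exact (h3 (by decide)).elim
        | exact e00 0 1
        | exact e00 1 0
        | exact e00 1 1
        | exact e01 0 0
        | exact e10 0 0
        | exact e 2 2

/-- Otherwise the third column or row would vanish, contradicting invertibility. -/
theorem ne_zero_slice64' {x : Matrix (Fin 6) (Fin 6) 𝕜} (hx : x ∈ slice64' 𝕜) :
    x 1 2 ≠ 0 ∧ x 2 1 ≠ 0 := by
  obtain ⟨h, h02, h20⟩ := hx
  have hu : x.det ≠ 0 := by
    have := (Matrix.isUnit_iff_isUnit_det _).1 (slice62'_subset h).1.1
    exact this.ne_zero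
  have e : ∀ i j, x i j = _ := fun i j => congrFun (congrFun h.2 i) j
  constructor
  · intro h12
    refine hu (Matrix.det_eq_zero_of_column_eq_zero 2 fun i => ?_)
    fin_cases i
    exacts [h02, h12, e 2 2, e 3 2, e 4 2, e 5 2]
  · intro h21
    refine hu (Matrix.det_eq_zero_of_row_eq_zero 2 fun i => ?_)
    fin_cases i
    exacts [h20, h21, e 2 2, e 2 3, e 2 4, e 2 5]

theorem exists_act_slice64'' {x : Matrix (Fin 6) (Fin 6) 𝕜} (hx : x ∈ locus4 𝕜) :
    ∃ h ∈ groupH 𝕜, act h x ∈ slice64'' 𝕜 := by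
  suffices H : ∀ x ∈ slice64' 𝕜, ∃ h ∈ groupH 𝕜, act h x ∈ slice64'' 𝕜 by
    obtain ⟨h, hh, h6⟩ := exists_act_slice62' hx.1
    obtain ⟨k, hk, hk'⟩ := H _ ((mem_slice64'_iff h6).2 (isStable_locus4 h hh x hx))
    rw [← act_mul] at hk'
    exact ⟨_, (groupH 𝕜).mul_mem hk hh, hk'⟩
  intro x hx
  obtain ⟨n12, n21⟩ := ne_zero_slice64' hx
  obtain ⟨h0, h11, h22, h02, h12, h20, h21, h01, h10⟩ := slice62'_iff.1 hx.1
  have b01 : blk x 0 1 = !![0, 0; x 1 2, 0] := by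
    ext i j
    fin_cases i <;> fin_cases j
    exacts [hx.2.1, h01 0, rfl, h01 1]
  have b10 : blk x 1 0 = !![0, x 2 1; 0, 0] := by
    ext i j
    fin_cases i <;> fin_cases j
    exacts [hx.2.2, rfl, h10 0, h10 1]
  have b00 : blk x 0 0 = !![x 0 0, x 0 1; x 1 0, x 1 1] := Matrix.eta_fin_two _
  -- The pivot `x 2 1` clears the second column above it, and the pivot `x 1 2` clears `x 1 0` from
  -- the right.
  let g : GL (Fin 6) 𝕜 × GL (Fin 6) 𝕜 :=
    (sElt 1 !![-x 0 1 / x 2 1, 0; -x 1 1 / x 2 1, 0] 0 0 det_one_ne_zero,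
      sElt 1 !![-x 1 0 / x 1 2, 0; 0, 0] 0 0 det_one_ne_zero)
  have hg : g ∈ groupH 𝕜 := ⟨sElt_mem _ _ _ _ det_one_ne_zero, sElt_mem _ _ _ _ det_one_ne_zero⟩
  have e00 : blk (act g x) 0 0 = !![x 0 0, 0; 0, 0] := by
    simp only [g, act_apply, sElt_val, blk_mul, blk_transpose, blk_sMat]
    simp [h11, b00, b01, b10, h22, h02, h12, h20, h21, transpose_two, n21]
    field_simp
    ring
  have e01 : blk (act g x) 0 1 = !![0, 0; x 1 2, 0] := by
    simp only [g, act_apply, sElt_val, blk_mul, blk_transpose, blk_sMat]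
    simp [h11, b00, b01, b10, h22, h02, h12, h20, h21, transpose_two]
  have e10 : blk (act g x) 1 0 = !![0, x 2 1; 0, 0] := by
    simp only [g, act_apply, sElt_val, blk_mul, blk_transpose, blk_sMat]
    simp [h11, b00, b01, b10, h22, h02, h12, h20, h21, transpose_two]
  have e : act g x ∈ slice62' 𝕜 := by
    refine slice62'_iff.2 ⟨isStable_locus0 g hg x h0, ?_⟩
    rw [e01, e10]
    simp only [g, act_apply, sElt_val, blk_mul, blk_transpose, blk_sMat]
    simp [h11, b00, b01, b10, h22, h02, h12, h20, h21, transpose_two, Fin.forall_fin_two]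
    simp [← Matrix.ext_iff, Fin.forall_fin_two]
  have f00 : act g x 0 0 = x 0 0 := congrFun (congrFun e00 0) 0
  have f01 : act g x 1 2 = x 1 2 := congrFun (congrFun e01 1) 0
  have f10 : act g x 2 1 = x 2 1 := congrFun (congrFun e10 0) 1
  exact ⟨g, hg, slice64''_iff.2 ⟨e, by rw [e00, f00], by rw [e01, f01], by rw [e10, f10]⟩⟩

theorem mem_slice65''_iff {x : Matrix (Fin 6) (Fin 6) 𝕜} (hx : x ∈ slice64'' 𝕜) :
    x ∈ slice65'' 𝕜 ↔ x ∈ locus5 𝕜 := by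
  obtain ⟨-, -, h1, h2, h3, h4⟩ := invariants_slice62' hx.1.1
  have h64 := (mem_slice64'_iff hx.1.1).1 hx.1
  have h5 : x ∈ locus5 𝕜 ↔ x ∈ locus4 𝕜 ∧ kroneckerMap (· * ·) (invA x) (invB' x) =
    kroneckerMap (· * ·) (invB x) (invA' x) := Iff.rfl
  have h6 : x ∈ slice65'' 𝕜 ↔ x ∈ slice64'' 𝕜 ∧ x 1 2 = x 2 1 := Iff.rfl
  obtain ⟨h02, h20⟩ := hx.1.2
  rw [h5, h6, h1, h2, h3, h4, h02, h20]
  simp only [hx, h64, true_and]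
  constructor
  · intro h
    rw [h]
    ext ⟨i, k⟩ ⟨j, l⟩
    fin_cases i <;> fin_cases j <;> fin_cases k <;> fin_cases l <;> simp
  · intro h
    -- In this position the factors from `invB` and `invB'` are both 1, so the identity compares the
    -- two parameters.
    have := congrFun (congrFun h (0, 1)) (1, 0)
    simp at this
    exact this.symm

theorem saturation_slice65'' : saturation (groupH 𝕜) (slice65'' 𝕜) = locus5 𝕜 :=
  saturation_eq_of_slice isStable_locus5 (fun _ hz => exists_act_slice64'' hz.1)
    (fun _ hx => mem_slice65''_iff hx) (fun _ hx => hx.1)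

end Saturations

end GinzburgRallis

end

noncomputable section

namespace GinzburgRallis

/-! ### The filtration and the smoothness of its strata. -/

section Strata

variable {𝕜 : Type*} [RCLike 𝕜]

theorem filtration6_eq : filtration6 𝕜 0 = locus0 𝕜 ∧ filtration6 𝕜 1 = locus1 𝕜 ∧
    filtration6 𝕜 2 = locus2 𝕜 ∧ filtration6 𝕜 3 = locus3 𝕜 ∧ filtration6 𝕜 4 = locus4 𝕜 ∧
    filtration6 𝕜 5 = locus5 𝕜 ∧ filtration6 𝕜 6 = ∅ :=
  ⟨Z6_eq_locus0, saturation_slice61, saturation_slice62, saturation_slice63',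
    saturation_slice64', saturation_slice65'', rfl⟩

/-- Clear in normal form, where `adj4 = -adj2`, and preserved by equivariance because both adjugates
transform by the same matrices up to a scalar. -/
theorem proportional_locus2 {x : Matrix (Fin 6) (Fin 6) 𝕜} (hx : x ∈ locus2 𝕜) :
    invB x ≠ 0 ∧ invB' x ≠ 0 ∧ ∃ κ : 𝕜, κ ≠ 0 ∧ adj4 x = κ • adj2 x := by
  obtain ⟨h, hh, hy⟩ := exists_act_slice62' hx
  obtain ⟨i1, i2, i3, i4, -, -⟩ := invariants_slice62' hy
  refine ⟨fun h0 => ?_, fun h0 => ?_, ?_⟩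
  · obtain ⟨a, b, e, ha, hb, he, H⟩ := exists_equivariance hh
    obtain ⟨-, -, -, -, H, -⟩ := H x
    have := (H hx.1.2.1).1
    rw [h0, i3, mul_zero, zero_mul, smul_zero] at this
    simpa using congrFun (congrFun this 0) 1
  · obtain ⟨a, b, e, ha, hb, he, H⟩ := exists_equivariance hh
    obtain ⟨-, -, -, -, H, -⟩ := H x
    have := (H hx.1.2.1).2
    rw [h0, i4, mul_zero, zero_mul, smul_zero] at this
    simpa using congrFun (congrFun this 1) 0
  · obtain ⟨a, b, e, ha, hb, he, H⟩ := exists_equivariance ((groupH 𝕜).inv_mem hh)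
    obtain ⟨-, -, H2, H4, -, -⟩ := H (act h x)
    rw [act_inv_act] at H2 H4
    refine ⟨-e, neg_ne_zero.2 he, ?_⟩
    have e1 : adj4 (act h x) = (-1 : 𝕜) • adj2 (act h x) := by
      rw [i1, i2]
      simp
    rw [H2, H4, e1, Matrix.mul_smul, Matrix.smul_mul, smul_smul, smul_smul]
    congr 1
    ring

/-- In normal form each of the matrices involved has at most one nonzero entry, in the same position
within each pair; equivariance transports the proportionality. -/
theorem proportional_locus4 {x : Matrix (Fin 6) (Fin 6) 𝕜} (hx : x ∈ locus4 𝕜) :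
    (∃ α : 𝕜, invA x = α • invB x) ∧ ∃ β : 𝕜, invA' x = β • invB' x := by
  obtain ⟨h, hh, hy⟩ := exists_act_slice64'' hx
  obtain ⟨-, -, i3, i4, i5, i6⟩ := invariants_slice62' hy.1.1
  obtain ⟨h02, h20⟩ := hy.1.2
  have hy0 := slice62'_subset hy.1.1
  obtain ⟨a, b, e, ha, hb, he, H⟩ := exists_equivariance ((groupH 𝕜).inv_mem hh)
  obtain ⟨-, -, -, -, H2, H4⟩ := H (act h x)
  obtain ⟨H2, H2'⟩ := H2 hy0.1.2.1
  obtain ⟨H4, H4'⟩ := H4 hy0.1.2.2.1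
  rw [act_inv_act] at H2 H4 H2' H4'
  constructor
  · refine ⟨e * -(act h x 2 1), ?_⟩
    have e1 : invA (act h x) = (-(act h x 2 1)) • invB (act h x) := by
      rw [i5, i3, h20]
      simp
    rw [H2, H4, e1, Matrix.mul_smul, Matrix.smul_mul, smul_smul, smul_smul]
    congr 1
    ring
  · refine ⟨e * -(act h x 1 2), ?_⟩
    have e1 : invA' (act h x) = (-(act h x 1 2)) • invB' (act h x) := by
      rw [i6, i4, h02]
      simp
    rw [H2', H4', e1, Matrix.mul_smul, Matrix.smul_mul, smul_smul, smul_smul]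
    congr 1
    ring

theorem contDiff_trace_invB : ContDiff ℝ ∞ fun x : Matrix (Fin 6) (Fin 6) 𝕜 => (invB x).trace :=
  contDiff_matrix_trace contDiff_invB

theorem contDiff_trace_invB' : ContDiff ℝ ∞ fun x : Matrix (Fin 6) (Fin 6) 𝕜 => (invB' x).trace :=
  contDiff_matrix_trace contDiff_invB'

theorem contDiff_trace_invA : ContDiff ℝ ∞ fun x : Matrix (Fin 6) (Fin 6) 𝕜 => (invA x).trace :=
  contDiff_matrix_trace contDiff_invA

theorem contDiff_trace_invA' : ContDiff ℝ ∞ fun x : Matrix (Fin 6) (Fin 6) 𝕜 => (invA' x).trace :=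
  contDiff_matrix_trace contDiff_invA'

theorem isSubmanifold_of_triangular {Z U : Set (Matrix (Fin 6) (Fin 6) 𝕜)} {k : ℕ}
    (f : Matrix (Fin 6) (Fin 6) 𝕜 → Fin k → 𝕜) (hU : IsOpen U) (hf : ContDiff ℝ ∞ f)
    (hZ : Z = {x ∈ U | f x = 0})
    (h : ∀ z ∈ Z, ∀ i, ∃ u : 𝕜 →ₗ[ℝ] Matrix (Fin 6) (Fin 6) 𝕜, ∃ a : 𝕜, a ≠ 0 ∧
      (∀ c, f (z + u c) i = f z i + c * a) ∧ ∀ j < i, ∀ c, f (z + u c) j = f z j) :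
    IsSubmanifold Z :=
  isSubmanifold_of_contDiff hU hf (fun z hz => surjective_fderiv_of_triangular
    (hf.differentiable (by simp) z) (h z hz)) hZ

theorem isSubmanifold_locus0_inter {U : Set (Matrix (Fin 6) (Fin 6) 𝕜)} (hU : IsOpen U) :
    IsSubmanifold (locus0 𝕜 ∩ U) := by
  refine isSubmanifold_of_triangular (fun x => ![(blk x 2 2).det, (m4 x).det])
    (isOpen_openPart.inter hU) ?_ ?_ ?_
  · rw [contDiff_pi]
    intro i
    fin_cases i
    exacts [contDiff_det2, contDiff_det4]
  · ext x
    simp [locus0, openPart]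
    tauto
  · rintro z ⟨⟨-, -, -, n2, n4⟩, -⟩ i
    obtain ⟨u0, a0, ha0, h0⟩ := exists_dir22 n2
    obtain ⟨u1, a1, ha1, h1⟩ := exists_dir11 n4
    fin_cases i
    · exact ⟨u0, a0, ha0, h0, by simp⟩
    · refine ⟨u1, a1, ha1, fun c => (h1 c).2.2.2, fun j hj c => ?_⟩
      fin_cases j
      · exact (h1 c).1
      · simp at hj

theorem isSubmanifold_locus1_diff : IsSubmanifold (locus1 𝕜 \ locus2 𝕜) := by
  refine isSubmanifold_of_triangular
    -- Where the two traces agree, leaving `locus2` is the single open condition that one of them is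
    -- nonzero.
    (U := openPart 𝕜 ∩ {x | (invB x).trace ≠ 0})
    (fun x => ![(blk x 2 2).det, (invB' x).trace - (invB x).trace, (m4 x).det])
    (isOpen_openPart.inter (isOpen_ne_fun contDiff_trace_invB.continuous continuous_const)) ?_ ?_ ?_
  · rw [contDiff_pi]
    intro i
    fin_cases i
    exacts [contDiff_det2, contDiff_trace_invB'.sub contDiff_trace_invB, contDiff_det4]
  · ext x
    simp [locus0, locus1, locus2, openPart, sub_eq_zero]
    grind
  · rintro z ⟨⟨⟨-, -, -, n2, n4⟩, -⟩, -⟩ i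
    obtain ⟨u0, a0, ha0, h0⟩ := exists_dir22 n2
    obtain ⟨u1, a1, ha1, h1⟩ := exists_dir12 n2
    obtain ⟨u2, a2, ha2, h2⟩ := exists_dir11 n4
    fin_cases i
    · exact ⟨u0, a0, ha0, h0, by simp⟩
    · refine ⟨u1, a1, ha1, fun c => ?_, fun j hj c => ?_⟩
      · simp [h1, add_sub_right_comm]
      · fin_cases j <;> simp [h1] at hj ⊢
    · refine ⟨u2, a2, ha2, fun c => ?_, fun j hj c => ?_⟩
      · simp [h2]
      · fin_cases j <;> simp [h2] at hj ⊢

theorem isSubmanifold_locus2_inter {U : Set (Matrix (Fin 6) (Fin 6) 𝕜)} (hU : IsOpen U) :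
    IsSubmanifold (locus2 𝕜 ∩ U) := by
  refine isSubmanifold_of_triangular
    (fun x => ![(blk x 2 2).det, (invB' x).trace, (invB x).trace, (m4 x).det])
    (isOpen_openPart.inter hU) ?_ ?_ ?_
  · rw [contDiff_pi]
    intro i
    fin_cases i
    exacts [contDiff_det2, contDiff_trace_invB', contDiff_trace_invB, contDiff_det4]
  · ext x
    simp [locus0, locus2, openPart]
    tauto
  · rintro z ⟨⟨⟨-, -, -, n2, n4⟩, -⟩, -⟩ i
    obtain ⟨u0, a0, ha0, h0⟩ := exists_dir22 n2
    obtain ⟨u1, a1, ha1, h1⟩ := exists_dir12 n2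
    obtain ⟨u2, a2, ha2, h2⟩ := exists_dir21 n2
    obtain ⟨u3, a3, ha3, h3⟩ := exists_dir11 n4
    fin_cases i
    · exact ⟨u0, a0, ha0, h0, by simp⟩
    · refine ⟨u1, a1, ha1, fun c => ?_, fun j hj c => ?_⟩
      · simp [h1]
      · fin_cases j <;> simp [h1] at hj ⊢
    · refine ⟨u2, a2, ha2, fun c => ?_, fun j hj c => ?_⟩
      · simp [h2]
      · fin_cases j <;> simp [h2] at hj ⊢
    · refine ⟨u3, a3, ha3, fun c => ?_, fun j hj c => ?_⟩
      · simp [h3]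
      · fin_cases j <;> simp [h3] at hj ⊢

theorem isSubmanifold_locus3_diff : IsSubmanifold (locus3 𝕜 \ locus4 𝕜) := by
  refine isSubmanifold_of_triangular
    -- As before, equality of the traces makes one open condition enough to exclude `locus4`.
    (U := openPart 𝕜 ∩ {x | (invA' x).trace ≠ 0})
    (fun x => ![(blk x 2 2).det, (invB' x).trace, (invB x).trace, (m4 x).det,
      (invA x).trace - (invA' x).trace])
    (isOpen_openPart.inter (isOpen_ne_fun contDiff_trace_invA'.continuous continuous_const))
    ?_ ?_ ?_
  · rw [contDiff_pi]
    intro i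
    fin_cases i
    exacts [contDiff_det2, contDiff_trace_invB', contDiff_trace_invB, contDiff_det4,
      contDiff_trace_invA.sub contDiff_trace_invA']
  · ext x
    simp [locus0, locus2, locus3, locus4, openPart, sub_eq_zero]
    grind
  · rintro z ⟨⟨⟨⟨-, -, -, n2, n4⟩, -⟩, -⟩, -⟩ i
    obtain ⟨u0, a0, ha0, h0⟩ := exists_dir22 n2
    obtain ⟨u1, a1, ha1, h1⟩ := exists_dir12 n2
    obtain ⟨u2, a2, ha2, h2⟩ := exists_dir21 n2
    obtain ⟨u3, a3, ha3, h3⟩ := exists_dir11 n4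
    obtain ⟨u4, a4, ha4, h4⟩ := exists_dir10 n4
    fin_cases i
    · exact ⟨u0, a0, ha0, h0, by simp⟩
    · refine ⟨u1, a1, ha1, fun c => ?_, fun j hj c => ?_⟩
      · simp [h1]
      · fin_cases j <;> simp [h1] at hj ⊢
    · refine ⟨u2, a2, ha2, fun c => ?_, fun j hj c => ?_⟩
      · simp [h2]
      · fin_cases j <;> simp [h2] at hj ⊢
    · refine ⟨u3, a3, ha3, fun c => ?_, fun j hj c => ?_⟩
      · simp [h3]
      · fin_cases j <;> simp [h3] at hj ⊢
    · refine ⟨u4, a4, ha4, fun c => ?_, fun j hj c => ?_⟩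
      · simp [h4, add_sub_right_comm]
      · fin_cases j <;> simp [h4] at hj ⊢

variable (𝕜) in
/-- Equations for `locus4`. -/
def equations4 (x : Matrix (Fin 6) (Fin 6) 𝕜) : Fin 6 → 𝕜 :=
  ![(blk x 2 2).det, (invB' x).trace, (invB x).trace, (m4 x).det, (invA x).trace, (invA' x).trace]

theorem contDiff_equations4 : ContDiff ℝ ∞ (equations4 𝕜) := by
  rw [contDiff_pi]
  intro i
  fin_cases i
  exacts [contDiff_det2, contDiff_trace_invB', contDiff_trace_invB, contDiff_det4,
    contDiff_trace_invA, contDiff_trace_invA']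

theorem mem_locus4_iff {x : Matrix (Fin 6) (Fin 6) 𝕜} :
    x ∈ locus4 𝕜 ↔ x ∈ openPart 𝕜 ∧ equations4 𝕜 x = 0 := by
  simp [locus0, locus2, locus4, openPart, equations4]
  tauto

theorem triangular_equations4 {z : Matrix (Fin 6) (Fin 6) 𝕜} (n2 : adj2 z ≠ 0) (n4 : adj4 z ≠ 0)
    (i : Fin 6) : ∃ u : 𝕜 →ₗ[ℝ] Matrix (Fin 6) (Fin 6) 𝕜, ∃ a : 𝕜, a ≠ 0 ∧
      (∀ c, equations4 𝕜 (z + u c) i = equations4 𝕜 z i + c * a) ∧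
      ∀ j < i, ∀ c, equations4 𝕜 (z + u c) j = equations4 𝕜 z j := by
  obtain ⟨u0, a0, ha0, h0⟩ := exists_dir22 n2
  obtain ⟨u1, a1, ha1, h1⟩ := exists_dir12 n2
  obtain ⟨u2, a2, ha2, h2⟩ := exists_dir21 n2
  obtain ⟨u3, a3, ha3, h3⟩ := exists_dir11 n4
  obtain ⟨u4, a4, ha4, h4⟩ := exists_dir10 n4
  obtain ⟨u5, a5, ha5, h5⟩ := exists_dir01 n4
  simp only [equations4]
  fin_cases i
  · exact ⟨u0, a0, ha0, h0, by simp⟩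
  · refine ⟨u1, a1, ha1, fun c => ?_, fun j hj c => ?_⟩
    · simp [h1]
    · fin_cases j <;> simp [h1] at hj ⊢
  · refine ⟨u2, a2, ha2, fun c => ?_, fun j hj c => ?_⟩
    · simp [h2]
    · fin_cases j <;> simp [h2] at hj ⊢
  · refine ⟨u3, a3, ha3, fun c => ?_, fun j hj c => ?_⟩
    · simp [h3]
    · fin_cases j <;> simp [h3] at hj ⊢
  · refine ⟨u4, a4, ha4, fun c => ?_, fun j hj c => ?_⟩
    · simp [h4]
    · fin_cases j <;> simp [h4] at hj ⊢
  · refine ⟨u5, a5, ha5, fun c => ?_, fun j hj c => ?_⟩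
    · simp [h5]
    · fin_cases j <;> simp [h5] at hj ⊢

theorem isSubmanifold_locus4_inter {U : Set (Matrix (Fin 6) (Fin 6) 𝕜)} (hU : IsOpen U) :
    IsSubmanifold (locus4 𝕜 ∩ U) := by
  refine isSubmanifold_of_triangular (equations4 𝕜) (isOpen_openPart.inter hU)
    contDiff_equations4 ?_ ?_
  · ext x
    simp [mem_locus4_iff]
    tauto
  · rintro z ⟨hz, -⟩
    exact triangular_equations4 hz.1.1.2.2.2.1 hz.1.1.2.2.2.2

theorem exists_entry_ne_zero {u : Matrix (Fin 2) (Fin 2) 𝕜} (h : u ≠ 0) : ∃ i j, u i j ≠ 0 := by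
  by_contra! h'
  exact h (Matrix.ext h')

/-- By proportionality the Kronecker identity says only that two ratios agree, which one nonzero
product of entries detects. So locally `locus5` needs a single further equation. -/
theorem mem_locus5_iff {x : Matrix (Fin 6) (Fin 6) 𝕜} (hx : x ∈ locus4 𝕜) {i j k l : Fin 2}
    (h : invB x i j ≠ 0) (h' : invB' x k l ≠ 0) :
    x ∈ locus5 𝕜 ↔ invA x i j * invB' x k l - invB x i j * invA' x k l = 0 := by
  obtain ⟨⟨α, hα⟩, β, hβ⟩ := proportional_locus4 hx
  have h5 : x ∈ locus5 𝕜 ↔ x ∈ locus4 𝕜 ∧ kroneckerMap (· * ·) (invA x) (invB' x) =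
    kroneckerMap (· * ·) (invB x) (invA' x) := Iff.rfl
  rw [h5, hα, hβ, Matrix.smul_kronecker, Matrix.kronecker_smul]
  simp only [hx, true_and, Matrix.smul_apply, smul_eq_mul]
  constructor
  · intro e
    have := congrFun (congrFun e (i, k)) (j, l)
    simp only [Matrix.smul_apply, Matrix.kroneckerMap_apply, smul_eq_mul] at this
    linear_combination this
  · intro e
    have : (α - β) * (invB x i j * invB' x k l) = 0 := by linear_combination e
    rcases mul_eq_zero.1 this with e | e
    · rw [sub_eq_zero.1 e]
    · exact (mul_ne_zero h h' e).elim

theorem contDiff_locus5_equation (i j k l : Fin 2) :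
    ContDiff ℝ ∞ fun x : Matrix (Fin 6) (Fin 6) 𝕜 =>
      invA x i j * invB' x k l - invB x i j * invA' x k l :=
  ((contDiff_invA (𝕜 := 𝕜) i j).mul (contDiff_invB' k l)).sub
    ((contDiff_invB i j).mul (contDiff_invA' k l))

theorem isSubmanifold_locus5 : IsSubmanifold (locus5 𝕜) := by
  refine isSubmanifold_of_local (V := Fin 7 → 𝕜) fun z hz => ?_
  have hz2 := hz.1.1
  obtain ⟨nB, nB', κ, hκ, e4⟩ := proportional_locus2 hz2
  obtain ⟨i, j, hij⟩ := exists_entry_ne_zero nB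
  obtain ⟨k, l, hkl⟩ := exists_entry_ne_zero nB'
  let g : Matrix (Fin 6) (Fin 6) 𝕜 → 𝕜 := fun x =>
    invA x i j * invB' x k l - invB x i j * invA' x k l
  let f : Matrix (Fin 6) (Fin 6) 𝕜 → Fin 7 → 𝕜 := fun x => Fin.snoc (equations4 𝕜 x) (g x)
  have hf : ContDiff ℝ ∞ f := by
    rw [contDiff_pi]
    intro m
    refine Fin.lastCases ?_ (fun m => ?_) m
    · simp only [f, Fin.snoc_last]
      exact contDiff_locus5_equation i j k l
    · simp only [f, Fin.snoc_castSucc]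
      exact contDiff_pi.1 contDiff_equations4 m
  refine ⟨openPart 𝕜 ∩ ({x | invB x i j ≠ 0} ∩ {x | invB' x k l ≠ 0}), f, ?_, ?_,
    hf.contDiffOn, ?_, ?_⟩
  · exact isOpen_openPart.inter ((isOpen_ne_fun (contDiff_invB (𝕜 := 𝕜) i j).continuous
      continuous_const).inter (isOpen_ne_fun
      (contDiff_invB' (𝕜 := 𝕜) k l).continuous continuous_const))
  · exact ⟨(mem_locus4_iff.1 hz.1).1, hij, hkl⟩
  · refine surjective_fderiv_of_triangular (hf.differentiable (by simp) z) fun m => ?_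
    refine Fin.lastCases ?_ (fun m => ?_) m
    -- Since `adj4 z = κ • adj2 z`, this direction changes `invA` by a multiple of `invB`. That
    -- moves the seventh equation, but not the trace of `invA`, because `invB` has trace zero.
    · refine ⟨dir 1 0 (blk z 2 1), κ * (invB z i j * invB' z k l),
        mul_ne_zero hκ (mul_ne_zero hij hkl), fun c => ?_, fun m hm c => ?_⟩
      · obtain ⟨-, h2, h3, -, h5, h6⟩ := invariants_add_dir10 (z := z) (blk z 2 1) c
        simp only [f, Fin.snoc_last, g, h2, h3, h5, h6, e4, Matrix.smul_mul, Matrix.add_apply,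
          Matrix.smul_apply, smul_eq_mul]
        rw [← invB]
        ring
      · obtain ⟨h1, h2, h3, h4, h5, h6⟩ := invariants_add_dir10 (z := z) (blk z 2 1) c
        obtain ⟨m, rfl⟩ := Fin.exists_castSucc_eq.2 hm.ne
        simp only [f, Fin.snoc_castSucc, equations4, h1, h2, h3, h4, h5, h6, e4, Matrix.smul_mul]
        rw [← invB, Matrix.trace_add, Matrix.trace_smul, Matrix.trace_smul, hz2.2.2]
        simp
    · obtain ⟨u, a, ha, h1, h2⟩ := triangular_equations4 hz2.1.2.2.2.1 hz2.1.2.2.2.2 m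
      refine ⟨u, a, ha, fun c => ?_, fun m' hm c => ?_⟩
      · simp only [f, Fin.snoc_castSucc, h1]
      · obtain ⟨m', rfl⟩ := Fin.exists_castSucc_eq.2 (hm.trans_le (Fin.le_last _)).ne
        simp only [f, Fin.snoc_castSucc]
        exact h2 m' (Fin.castSucc_lt_castSucc_iff.1 hm) c
  · ext x
    have key : f x = 0 ↔ equations4 𝕜 x = 0 ∧ g x = 0 := by
      constructor
      · intro h
        refine ⟨funext fun m => ?_, ?_⟩
        · simpa [f] using congrFun h m.castSucc
        · have := congrFun h (Fin.last 6)
          simp only [f, Fin.snoc_last] at this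
          exact this
      · rintro ⟨h1, h2⟩
        ext m
        refine Fin.lastCases ?_ (fun m => ?_) m
        · simp only [f, Fin.snoc_last]
          exact h2
        · simpa [f] using congrFun h1 m
    simp only [Set.mem_inter_iff, Set.mem_ofPred_eq, key]
    constructor
    · rintro ⟨hx, h1, h2, h3⟩
      exact ⟨⟨h1, h2, h3⟩, (mem_locus4_iff.1 hx.1).2, (mem_locus5_iff hx.1 h2 h3).1 hx⟩
    · rintro ⟨⟨h1, h2, h3⟩, h4, h5⟩
      exact ⟨(mem_locus5_iff (mem_locus4_iff.2 ⟨h1, h4⟩) h2 h3).2 h5, h1, h2, h3⟩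

theorem isClosed_eq_contDiff {f g : Matrix (Fin 6) (Fin 6) 𝕜 → 𝕜} (hf : ContDiff ℝ ∞ f)
    (hg : ContDiff ℝ ∞ g) : IsClosed {x | f x = g x} :=
  isClosed_eq hf.continuous hg.continuous

theorem isClosed_equation5 : IsClosed {x : Matrix (Fin 6) (Fin 6) 𝕜 |
    kroneckerMap (· * ·) (invA x) (invB' x) = kroneckerMap (· * ·) (invB x) (invA' x)} := by
  simp only [← Matrix.ext_iff, Set.ofPred_forall, Matrix.kroneckerMap_apply]
  exact isClosed_iInter fun i => isClosed_iInter fun j => isClosed_eq_contDiff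
    ((contDiff_invA (𝕜 := 𝕜) _ _).mul (contDiff_invB' _ _)) ((contDiff_invB (𝕜 := 𝕜) _ _).mul (contDiff_invA' _ _))

theorem isLocallyClosed_locus0 : IsLocallyClosed (locus0 𝕜) := by
  have e : locus0 𝕜 = openPart 𝕜 ∩ ({x | (blk x 2 2).det = 0} ∩ {x | (m4 x).det = 0}) := by
    ext x
    simp [locus0, openPart]
    tauto
  rw [e]
  exact isOpen_openPart.isLocallyClosed.inter ((isClosed_eq_contDiff (contDiff_det2 (𝕜 := 𝕜))
    contDiff_const).inter (isClosed_eq_contDiff (contDiff_det4 (𝕜 := 𝕜)) contDiff_const)).isLocallyClosed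

theorem isStableClosedFiltration_filtration6 :
    IsStableClosedFiltration (groupH 𝕜) (Z6 𝕜) 5 (filtration6 𝕜) := by
  obtain ⟨e0, e1, e2, e3, e4, e5, e6⟩ := filtration6_eq (𝕜 := 𝕜)
  have c1 : IsClosed {x : Matrix (Fin 6) (Fin 6) 𝕜 | (invB' x).trace = (invB x).trace} :=
    isClosed_eq_contDiff contDiff_trace_invB' contDiff_trace_invB
  have c2 : IsClosed {x : Matrix (Fin 6) (Fin 6) 𝕜 | (invB' x).trace = 0 ∧ (invB x).trace = 0} :=
    (isClosed_eq_contDiff (contDiff_trace_invB' (𝕜 := 𝕜)) contDiff_const).inter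
      (isClosed_eq_contDiff (contDiff_trace_invB (𝕜 := 𝕜)) contDiff_const)
  have c3 : IsClosed {x : Matrix (Fin 6) (Fin 6) 𝕜 | (invA x).trace = (invA' x).trace} :=
    isClosed_eq_contDiff contDiff_trace_invA contDiff_trace_invA'
  have c4 : IsClosed {x : Matrix (Fin 6) (Fin 6) 𝕜 | (invA x).trace = 0 ∧ (invA' x).trace = 0} :=
    (isClosed_eq_contDiff (contDiff_trace_invA (𝕜 := 𝕜)) contDiff_const).inter
      (isClosed_eq_contDiff (contDiff_trace_invA' (𝕜 := 𝕜)) contDiff_const)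
  refine ⟨rfl, e6, ?_, ?_⟩
  · intro i hi
    interval_cases i
    · rw [e0, e1]
      exact fun x hx => hx.1
    · rw [e1, e2]
      exact fun x hx => ⟨hx.1, hx.2.1.trans hx.2.2.symm⟩
    · rw [e2, e3]
      exact fun x hx => hx.1
    · rw [e3, e4]
      exact fun x hx => ⟨hx.1, hx.2.1.trans hx.2.2.symm⟩
    · rw [e4, e5]
      exact fun x hx => hx.1
    · rw [e6]
      exact Set.empty_subset _
  · intro i hi
    rw [Z6_eq_locus0]
    interval_cases i
    · rw [e0]
      exact ⟨isStable_locus0, _, isClosed_univ, (Set.inter_univ _).symm⟩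
    · rw [e1]
      exact ⟨isStable_locus1, _, c1, rfl⟩
    · rw [e2]
      exact ⟨isStable_locus2, _, c2, rfl⟩
    · rw [e3]
      exact ⟨isStable_locus3, _, c2.inter c3, (Set.inter_assoc _ _ _)⟩
    · rw [e4]
      exact ⟨isStable_locus4, _, c2.inter c4, (Set.inter_assoc _ _ _)⟩
    · rw [e5]
      refine ⟨isStable_locus5, _, c2.inter (c4.inter isClosed_equation5), ?_⟩
      rw [← Set.inter_assoc, ← Set.inter_assoc]
      rfl
    · rw [e6]
      exact ⟨fun _ _ _ h => h.elim, ∅, isClosed_empty, (Set.inter_empty _).symm⟩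

end Strata

end GinzburgRallis

end

noncomputable section

namespace GinzburgRallis

/-! ### Incompatibility from globally defined stabilizers. -/

section Incompatible

variable {𝕜 : Type*} [RCLike 𝕜]

theorem blk_zero (i j : Fin 3) : blk (0 : Matrix (Fin 6) (Fin 6) 𝕜) i j = 0 := rfl

/-- For a trivial diagonal block the factor from `χ₀` disappears. -/
theorem chiS_of_blk_eq_one (ψ : AddChar 𝕜 Circle) (χ₀ : 𝕜ˣ →* ℂˣ) {g : S 𝕜}
    (hg : blk g.1.1 0 0 = 1) :
    chiS ψ χ₀ g = Circle.toUnits (ψ ((blk g.1.1 0 1).trace + (blk g.1.1 1 2).trace)) := by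
  have h1 : leviS 𝕜 g = 1 := Units.ext hg
  have h2 : traceS g = (blk g.1.1 0 1).trace + (blk g.1.1 1 2).trace := by
    rw [traceS, h1, inv_one, Units.val_one, mul_one, Matrix.trace_add]
  change χ₀ (Matrix.GeneralLinearGroup.det (leviS 𝕜 g)) * Circle.toUnits (ψ (traceS g)) = _
  rw [h1, h2, map_one, map_one, one_mul]

theorem chiH_apply (ψ : AddChar 𝕜 Circle) (χ₀ : 𝕜ˣ →* ℂˣ) {h : GL (Fin 6) 𝕜 × GL (Fin 6) 𝕜}
    (hh : h ∈ groupH 𝕜) :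
    chiH ψ χ₀ ⟨h, hh⟩ = chiS ψ χ₀ ⟨h.1, hh.1⟩ * chiS ψ χ₀ ⟨h.2, hh.2⟩ := rfl

/-- The pair of `1 + z K` and `(1 - K z)ᵀ` lies in `H` if `z K` is strictly block upper triangular
and `K z` is strictly block lower triangular; `χ` takes the obvious value. -/
theorem chiH_stabPair (ψ : AddChar 𝕜 Circle) (χ₀ : 𝕜ˣ →* ℂˣ) {z K : Matrix (Fin 6) (Fin 6) 𝕜}
    (hK : K * z * K = 0) (hu : ∀ i j, j ≤ i → blk (z * K) i j = 0)
    (hl : ∀ i j, i ≤ j → blk (K * z) i j = 0) :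
    ∃ hm : stabPair z K hK ∈ groupH 𝕜, chiH ψ χ₀ ⟨_, hm⟩ = Circle.toUnits
      (ψ ((blk (z * K) 0 1).trace + (blk (z * K) 1 2).trace - (blk (K * z) 1 0).trace -
        (blk (K * z) 2 1).trace)) := by
  have b1 : ∀ i j, blk ((stabPair z K hK).1 : Matrix (Fin 6) (Fin 6) 𝕜) i j =
      (if i = j then 1 else 0) + blk (z * K) i j := fun i j => by
    rw [stabPair_fst, ← blk_one]
    rfl
  have b2 : ∀ i j, blk ((stabPair z K hK).2 : Matrix (Fin 6) (Fin 6) 𝕜) i j =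
      (if i = j then 1 else 0) - (blk (K * z) j i)ᵀ := fun i j => by
    rw [stabPair_snd, Matrix.transpose_sub, Matrix.transpose_one, ← blk_one, ← blk_transpose]
    rfl
  have m1 : HasShapeS ((stabPair z K hK).1 : Matrix (Fin 6) (Fin 6) 𝕜) := by
    refine ⟨?_, ?_, ?_, ?_, ?_⟩ <;> simp [b1, hu]
  have m2 : HasShapeS ((stabPair z K hK).2 : Matrix (Fin 6) (Fin 6) 𝕜) := by
    refine ⟨?_, ?_, ?_, ?_, ?_⟩ <;> simp [b2, hl]
  have hm : stabPair z K hK ∈ groupH 𝕜 := ⟨m1, m2⟩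
  refine ⟨hm, ?_⟩
  rw [chiH_apply, chiS_of_blk_eq_one _ _ (by simp [b1, hu]),
    chiS_of_blk_eq_one _ _ (by simp [b2, hl]), ← map_mul, ← AddChar.map_add_eq_mul]
  simp only [b1, b2]
  congr 2
  simp
  ring

theorem isLieTangent_zero {n : Type*} [Fintype n] [DecidableEq n]
    (H : Subgroup (GL n 𝕜 × GL n 𝕜)) : IsLieTangent H 0 :=
  Filter.Eventually.of_forall fun t => ⟨1, H.one_mem, by simp [pairVal]⟩

theorem toUnits_ne_one {ψ : AddChar 𝕜 Circle} {s : 𝕜} (hs : ψ s ≠ 1) :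
    Circle.toUnits (ψ s) ≠ 1 := fun h => hs <| by
  ext
  exact congrArg Units.val h

/-- An invariant field of stabilizers on the whole stratum. -/
theorem isUnipotentlyIncompatible_of_field {ψ : AddChar 𝕜 Circle} (hψ : ψ ≠ 1) (χ₀ : 𝕜ˣ →* ℂˣ)
    {Z : Set (Matrix (Fin 6) (Fin 6) 𝕜)} (hZm : IsSubmanifold Z) (hZ : IsStable (groupH 𝕜) Z)
    {K : Matrix (Fin 6) (Fin 6) 𝕜 → Matrix (Fin 6) (Fin 6) 𝕜} (hK : ContDiff ℝ ∞ K)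
    {τ : Matrix (Fin 6) (Fin 6) 𝕜 → 𝕜} (hτ : ContDiff ℝ ∞ τ)
    (h : ∀ z ∈ Z, τ z ≠ 0 ∧ K z * z * K z = 0 ∧ (∀ i j, j ≤ i → blk (z * K z) i j = 0) ∧
      (∀ i j, i ≤ j → blk (K z * z) i j = 0) ∧
      (blk (z * K z) 0 1).trace + (blk (z * K z) 1 2).trace - (blk (K z * z) 1 0).trace -
        (blk (K z * z) 2 1).trace = τ z) :
    IsUnipotentlyIncompatible (groupH 𝕜) (chiH ψ χ₀) Z := by
  obtain ⟨s, hs⟩ : ∃ s, ψ s ≠ 1 := by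
    by_contra! h'
    exact hψ (DFunLike.ext _ _ h')
  have hsmul : ∀ (c : 𝕜) (x : Matrix (Fin 6) (Fin 6) 𝕜) i j, blk (c • x) i j = c • blk x i j :=
    fun _ _ _ _ => rfl
  -- The stratum serves as its own slice, so transversality is trivial. Dividing by `τ` normalizes
  -- the argument of `ψ` to a fixed `s` with `ψ s ≠ 1`.
  refine isUnipotentlyIncompatible_of_slices hZm hZ fun z hz => ⟨1, (groupH 𝕜).one_mem, Z,
    fun y => (s / τ y) • K y, by rwa [act_one], subset_rfl, hZm, fun y hy v hv =>
    ⟨0, isLieTangent_zero _, by simpa using hv⟩, ?_, fun y hy => ?_⟩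
  · have hc : ContDiffOn ℝ ∞ (fun y => s / τ y) Z := by
      simp only [div_eq_mul_inv]
      exact contDiffOn_const.mul (hτ.contDiffOn.inv fun y hy => (h y hy).1)
    exact hc.smul hK.contDiffOn
  · obtain ⟨h1, h2, h3, h4, h5⟩ := h y hy
    have hK' : ((s / τ y) • K y) * y * ((s / τ y) • K y) = 0 := by
      simp [h2]
    obtain ⟨hm, hχ⟩ := chiH_stabPair ψ χ₀ hK' (fun i j hij => by simp [hsmul, h3 i j hij])
      (fun i j hij => by simp [hsmul, h4 i j hij])
    refine ⟨hK', hm, ?_⟩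
    rw [hχ]
    simp only [Matrix.smul_mul, Matrix.mul_smul, hsmul, Matrix.trace_smul]
    rw [← smul_add, ← smul_sub, ← smul_sub, h5, smul_eq_mul, div_mul_cancel₀ _ h1]
    exact toUnits_ne_one hs

theorem contDiff_ofBlk {E : Type*} [NormedAddCommGroup E] [NormedSpace ℝ E]
    {f : E → Matrix (Fin 3) (Fin 3) (Matrix (Fin 2) (Fin 2) 𝕜)}
    (hf : ∀ i j p q, ContDiff ℝ ∞ fun x => f x i j p q) : ContDiff ℝ ∞ fun x => ofBlk (f x) :=
  contDiff_matrix fun _ _ => hf _ _ _ _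

/-- Put the adjugate of the corner block in the corner. It annihilates that block from both sides,
which gives triangularity and `K z K = 0`, and the character sees the traces of `invB'` and `invB`.
-/
theorem isUnipotentlyIncompatible_locus0_diff {ψ : AddChar 𝕜 Circle} (hψ : ψ ≠ 1)
    (χ₀ : 𝕜ˣ →* ℂˣ) :
    IsUnipotentlyIncompatible (groupH 𝕜) (chiH ψ χ₀) (locus0 𝕜 \ locus1 𝕜) := by
  have e : locus0 𝕜 \ locus1 𝕜 = locus0 𝕜 ∩ {x | (invB' x).trace ≠ (invB x).trace} := by
    ext x
    simp [locus1]
  refine isUnipotentlyIncompatible_of_field hψ χ₀ ?_ (isStable_locus0.diff isStable_locus1)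
    (K := fun x => ofBlk !![0, 0, 0; 0, 0, 0; 0, 0, adj2 x]) ?_
    (contDiff_trace_invB'.sub contDiff_trace_invB) ?_
  · rw [e]
    exact isSubmanifold_locus0_inter (isOpen_ne_fun contDiff_trace_invB'.continuous
      contDiff_trace_invB.continuous)
  · refine contDiff_ofBlk fun i j p q => ?_
    fin_cases i <;> fin_cases j <;> first | exact contDiff_const | exact contDiff_adj2 p q
  · intro z hz
    rw [e] at hz
    obtain ⟨⟨-, h2, -⟩, hne⟩ := hz
    have m1 : blk z 2 2 * adj2 z = 0 := by
      rw [adj2, Matrix.mul_adjugate, h2, zero_smul]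
    have m2 : adj2 z * blk z 2 2 = 0 := by
      rw [adj2, Matrix.adjugate_mul, h2, zero_smul]
    refine ⟨sub_ne_zero.2 hne, ?_, ?_, ?_, ?_⟩
    · apply blk_ext
      intro i j
      simp only [blk_mul, blk_ofBlk, blk_zero]
      fin_cases i <;> fin_cases j <;> simp [m2]
    · intro i j hij
      simp only [blk_mul, blk_ofBlk]
      fin_cases i <;> fin_cases j <;> simp [m1] at hij ⊢
    · intro i j hij
      simp only [blk_mul, blk_ofBlk]
      fin_cases i <;> fin_cases j <;> simp [m2] at hij ⊢
    · simp only [blk_mul, blk_ofBlk]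
      simp [invB, invB']

/-- The adjugate of the lower right `4 × 4` part, as a `6 × 6` matrix. -/
def adjField (x : Matrix (Fin 6) (Fin 6) 𝕜) : Matrix (Fin 6) (Fin 6) 𝕜 :=
  ofBlk !![0, 0, 0; 0, adj4 x, (adjugate (m4 x)).toBlocks₁₂;
    0, (adjugate (m4 x)).toBlocks₂₁, (adjugate (m4 x)).toBlocks₂₂]

theorem adjField_mul {z : Matrix (Fin 6) (Fin 6) 𝕜} (hz : (m4 z).det = 0) :
    (∀ i j, 1 ≤ i → blk (z * adjField z) i j = 0) ∧
      (∀ i j, 1 ≤ j → blk (adjField z * z) i j = 0) ∧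
      blk (z * adjField z) 0 1 = invA' z ∧ blk (adjField z * z) 1 0 = invA z := by
  have m1 : m4 z * adjugate (m4 z) = 0 := by rw [Matrix.mul_adjugate, hz, zero_smul]
  have m2 : adjugate (m4 z) * m4 z = 0 := by rw [Matrix.adjugate_mul, hz, zero_smul]
  -- Singularity of `m4 z` makes both products with its adjugate zero; it is used one block at a
  -- time.
  rw [← fromBlocks_toBlocks (adjugate (m4 z)), ← fromBlocks_zero] at m1 m2
  nth_rw 1 [m4] at m1
  nth_rw 5 [m4] at m2
  rw [fromBlocks_multiply, fromBlocks_inj] at m1 m2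
  obtain ⟨a1, a2, a3, a4⟩ := m1
  obtain ⟨b1, b2, b3, b4⟩ := m2
  refine ⟨?_, ?_, ?_, ?_⟩
  · intro i j hij
    simp only [blk_mul, adjField, blk_ofBlk]
    fin_cases i <;> fin_cases j <;> simp [adj4, a1, a2, a3, a4] at hij ⊢
  · intro i j hij
    simp only [blk_mul, adjField, blk_ofBlk]
    fin_cases i <;> fin_cases j <;> simp [adj4, b1, b2, b3, b4] at hij ⊢
  · simp only [blk_mul, adjField, blk_ofBlk]
    rw [invA', rowP, ← fromBlocks_toBlocks (adjugate (m4 z)), fromCols_mul_fromBlocks]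
    simp [adj4]
  · simp only [blk_mul, adjField, blk_ofBlk]
    rw [invA, colP, ← fromBlocks_toBlocks (adjugate (m4 z)), fromBlocks_mul_fromRows]
    simp [adj4]

/-- The adjugate of the 4 × 4 block plays the role of the smaller one. Only the first block row of
`z K` and the first block column of `K z` survive, so the argument of `ψ` is the difference of the
traces of `invA'` and `invA`. -/
theorem isUnipotentlyIncompatible_locus2_diff {ψ : AddChar 𝕜 Circle} (hψ : ψ ≠ 1)
    (χ₀ : 𝕜ˣ →* ℂˣ) :
    IsUnipotentlyIncompatible (groupH 𝕜) (chiH ψ χ₀) (locus2 𝕜 \ locus3 𝕜) := by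
  have e : locus2 𝕜 \ locus3 𝕜 = locus2 𝕜 ∩ {x | (invA x).trace ≠ (invA' x).trace} := by
    ext x
    simp [locus3]
  refine isUnipotentlyIncompatible_of_field hψ χ₀ ?_ (isStable_locus2.diff isStable_locus3)
    (K := adjField) ?_ (contDiff_trace_invA'.sub contDiff_trace_invA) ?_
  · rw [e]
    exact isSubmanifold_locus2_inter (isOpen_ne_fun contDiff_trace_invA.continuous
      contDiff_trace_invA'.continuous)
  · refine contDiff_ofBlk fun i j p q => ?_
    fin_cases i <;> fin_cases j <;> first
      | exact contDiff_const
      | exact contDiff_adjugate contDiff_m4 _ _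
  · intro z hz
    rw [e] at hz
    obtain ⟨⟨⟨-, -, h4, -⟩, -⟩, hne⟩ := hz
    obtain ⟨m1, m2, m3, m4⟩ := adjField_mul h4
    have m0 : ∀ j, blk (adjField z) 0 j = 0 := fun j => by
      simp only [adjField, blk_ofBlk]
      fin_cases j <;> rfl
    refine ⟨sub_ne_zero.2 (Ne.symm hne), ?_, ?_, ?_, ?_⟩
    · apply blk_ext
      intro i j
      rw [blk_mul, m0, m2 i 1 (by decide), m2 i 2 (by decide), blk_zero]
      simp
    · intro i j hij
      rcases eq_or_ne i 0 with rfl | hi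
      · rw [Fin.le_zero_iff.1 hij, blk_mul]
        simp only [adjField, blk_ofBlk]
        simp
      · exact m1 i j (Fin.one_le_of_ne_zero hi)
    · intro i j hij
      rcases eq_or_ne j 0 with rfl | hi
      · rw [Fin.le_zero_iff.1 hij, blk_mul]
        simp [m0]
      · exact m2 i j (Fin.one_le_of_ne_zero hi)
    · rw [m3, m4, m1 1 2 le_rfl, m2 2 1 le_rfl]
      simp

end Incompatible

end GinzburgRallis

end

noncomputable section

namespace GinzburgRallis

/-! ### Jacobi's formula and linearized equations. -/

section Derivatives

variable {𝕜 : Type*} [RCLike 𝕜] {m n : Type*} [Fintype m] [DecidableEq m] [Fintype n]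
  [DecidableEq n]

theorem hasDerivAt_entry {γ : ℝ → Matrix n n 𝕜} {u : Matrix n n 𝕜} {t : ℝ}
    (h : HasDerivAt γ u t) (i j : n) : HasDerivAt (fun t => γ t i j) (u i j) t :=
  (LinearMap.toContinuousLinearMap (Matrix.entryLinearMap ℝ 𝕜 i j)).hasFDerivAt.comp_hasDerivAt t h

/-- Jacobi's formula. -/
theorem hasDerivAt_det {M : ℝ → Matrix m m 𝕜} {U : Matrix m m 𝕜} {t : ℝ}
    (h : ∀ i j, HasDerivAt (fun t => M t i j) (U i j) t) :
    HasDerivAt (fun t => (M t).det) (Matrix.trace (adjugate (M t) * U)) t := by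
  have e : Matrix.trace (adjugate (M t) * U) = ∑ σ : Equiv.Perm m, Equiv.Perm.sign σ •
      ∑ i, (∏ j ∈ Finset.univ.erase i, M t (σ j) j) • U (σ i) i := by
    -- Cramer's rule: a diagonal entry is the determinant with one column replaced by that of `U`.
    -- Expanding over permutations matches the product rule.
    have e1 : ∀ i, (adjugate (M t) * U) i i = ((M t).updateCol i fun k => U k i).det := fun i => by
      rw [← Matrix.cramer_apply, Matrix.cramer_eq_adjugate_mulVec]
      rfl
    simp only [Matrix.trace, Matrix.diag_apply, e1, Matrix.det_apply, Finset.smul_sum]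
    rw [Finset.sum_comm]
    refine Finset.sum_congr rfl fun σ _ => Finset.sum_congr rfl fun i _ => ?_
    rw [← Finset.mul_prod_erase _ _ (Finset.mem_univ i), Matrix.updateCol_self, mul_comm,
      smul_eq_mul]
    congr 2
    refine Finset.prod_congr rfl fun j hj => ?_
    rw [Matrix.updateCol_ne (Finset.ne_of_mem_erase hj)]
  rw [e]
  simp only [Matrix.det_apply]
  exact HasDerivAt.fun_sum fun σ _ =>
    (HasDerivAt.fun_finsetProd fun i _ => h (σ i) i).const_smul _

theorem hasDerivAt_minor {γ : ℝ → Matrix n n 𝕜} {u : Matrix n n 𝕜} {t : ℝ}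
    (h : HasDerivAt γ u t) (r c : m → n) : HasDerivAt (fun t => ((γ t).submatrix r c).det)
      (Matrix.trace (adjugate ((γ t).submatrix r c) * u.submatrix r c)) t :=
  hasDerivAt_det fun i j => hasDerivAt_entry h (r i) (c j)

/-- An equation of `Z` gives an equation of its tangent spaces. -/
theorem eq_zero_of_mem_tangentSpaceOf {Z : Set (Matrix n n 𝕜)} {y : Matrix n n 𝕜}
    {f ℓ : Matrix n n 𝕜 → 𝕜} (hℓ : IsLinearMap ℝ ℓ) (hf : ∀ x ∈ Z, f x = 0)
    (hd : ∀ (γ : ℝ → Matrix n n 𝕜) (u : Matrix n n 𝕜), γ 0 = y → HasDerivAt γ u 0 →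
      HasDerivAt (fun t => f (γ t)) (ℓ u) 0) {v : Matrix n n 𝕜} (hv : v ∈ tangentSpaceOf Z y) :
    ℓ v = 0 := by
  have : tangentSpaceOf Z y ≤ LinearMap.ker hℓ.mk' :=
    tangentSpaceOf_le fun w hw => hw.eq_zero hf fun γ h0 h1 => hd γ w h0 h1
  exact this hv

theorem isLinearMap_trace_mul (Q : Matrix n n 𝕜) :
    IsLinearMap ℝ fun u : Matrix n n 𝕜 => (Q * u).trace :=
  ⟨fun u v => by rw [mul_add, Matrix.trace_add], fun c u => by
    rw [Matrix.mul_smul, Matrix.trace_smul]⟩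

end Derivatives

/-! ### First order behaviour of the invariants at normal forms. -/

section Minors

variable {𝕜 : Type*} [RCLike 𝕜]

theorem invB_eq (x : Matrix (Fin 6) (Fin 6) 𝕜) :
    invB x = !![x 5 5 * x 4 2 - x 4 5 * x 5 2, x 5 5 * x 4 3 - x 4 5 * x 5 3;
      -x 5 4 * x 4 2 + x 4 4 * x 5 2, -x 5 4 * x 4 3 + x 4 4 * x 5 3] := by
  rw [invB, adj2, Matrix.eta_fin_two (blk x 2 2), Matrix.adjugate_fin_two_of,
    Matrix.eta_fin_two (blk x 2 1), Matrix.mul_fin_two]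
  simp only [neg_mul, ← sub_eq_add_neg]
  rfl

/-- Cramer's rule exhibits each entry as a minor of `x`, to which Jacobi's formula applies directly.
-/
theorem invA_eq_minor (x : Matrix (Fin 6) (Fin 6) 𝕜) :
    invA x = !![(x.submatrix ![2, 3, 4, 5] ![0, 3, 4, 5]).det,
        (x.submatrix ![2, 3, 4, 5] ![1, 3, 4, 5]).det;
      (x.submatrix ![2, 3, 4, 5] ![2, 0, 4, 5]).det,
        (x.submatrix ![2, 3, 4, 5] ![2, 1, 4, 5]).det] := by
  have e : ∀ (i j : Fin 2), invA x i j =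
      ((m4 x).updateCol (Sum.inl i) fun k => colP x k j).det := fun i j => by
    rw [← Matrix.cramer_apply, Matrix.cramer_eq_adjugate_mulVec]
    rfl
  have e' : ∀ M : Matrix (Fin 2 ⊕ Fin 2) (Fin 2 ⊕ Fin 2) 𝕜,
      M.det = (M.submatrix finSumFinEquiv.symm (finSumFinEquiv (m := 2) (n := 2)).symm).det :=
    fun M => (Matrix.det_submatrix_equiv_self _ _).symm
  ext i j
  rw [e, e']
  fin_cases i <;> fin_cases j <;> refine congrArg Matrix.det ?_ <;>
  · ext p q
    fin_cases p <;> fin_cases q <;> rfl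

/-- At a normal form the minors that occur have this sparse shape or the next one; `p = 0` is the
lower right block itself. -/
theorem adjugate_sparse₁ (p : 𝕜) :
    adjugate !![p, 0, 0, 0; 0, 0, 1, 0; 0, 1, 0, 0; 0, 0, 0, 1] =
      !![-1, 0, 0, 0; 0, 0, -p, 0; 0, -p, 0, 0; 0, 0, 0, -p] := by
  ext i j
  rw [Matrix.adjugate_fin_succ_eq_det_submatrix, Matrix.det_fin_three]
  fin_cases i <;> fin_cases j <;> simp [Fin.succAbove] <;> ring

theorem adjugate_sparse₂ (p : 𝕜) :
    adjugate !![0, p, 0, 0; 0, 0, 1, 0; 0, 0, 0, 0; 0, 0, 0, 1] =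
      !![0, 0, p, 0; 0, 0, 0, 0; 0, 0, 0, 0; 0, 0, 0, 0] := by
  ext i j
  rw [Matrix.adjugate_fin_succ_eq_det_submatrix, Matrix.det_fin_three]
  fin_cases i <;> fin_cases j <;> simp [Fin.succAbove]

theorem trace_sparse₁ (p : 𝕜) (U : Matrix (Fin 4) (Fin 4) 𝕜) :
    (!![-1, 0, 0, 0; 0, 0, -p, 0; 0, -p, 0, 0; 0, 0, 0, -p] * U).trace =
      -U 0 0 - p * (U 1 2 + U 2 1 + U 3 3) := by
  simp only [Matrix.trace, Matrix.diag_apply, Matrix.mul_apply, Fin.sum_univ_four]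
  simp
  ring

theorem trace_sparse₂ (p : 𝕜) (U : Matrix (Fin 4) (Fin 4) 𝕜) :
    (!![0, 0, p, 0; 0, 0, 0, 0; 0, 0, 0, 0; 0, 0, 0, 0] * U).trace = p * U 2 0 := by
  simp only [Matrix.trace, Matrix.diag_apply, Matrix.mul_apply, Fin.sum_univ_four]
  simp

theorem hasDerivAt_det4 {γ : ℝ → Matrix (Fin 6) (Fin 6) 𝕜} {u : Matrix (Fin 6) (Fin 6) 𝕜}
    (hγ : HasDerivAt γ u 0) (h : γ 0 ∈ slice62' 𝕜) :
    HasDerivAt (fun t => (m4 (γ t)).det) (-u 2 2) 0 := by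
  have e : ∀ i j, γ 0 i j = _ := fun i j => congrFun (congrFun h.2 i) j
  have h1 := hasDerivAt_minor hγ ![2, 3, 4, 5] ![2, 3, 4, 5]
  have e' : (γ 0).submatrix ![2, 3, 4, 5] ![2, 3, 4, 5] =
      !![0, 0, 0, 0; 0, 0, 1, 0; 0, 1, 0, 0; 0, 0, 0, 1] := by
    ext i j
    fin_cases i <;> fin_cases j
    exacts [e 2 2, e 2 3, e 2 4, e 2 5, e 3 2, e 3 3, e 3 4, e 3 5, e 4 2, e 4 3, e 4 4, e 4 5,
      e 5 2, e 5 3, e 5 4, e 5 5]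
  rw [e', adjugate_sparse₁, trace_sparse₁, zero_mul, sub_zero] at h1
  simp only [det_m4_eq]
  exact h1

/-- The derivative of `invA` at a point in normal form. -/
theorem hasDerivAt_invA_minor {γ : ℝ → Matrix (Fin 6) (Fin 6) 𝕜} {u : Matrix (Fin 6) (Fin 6) 𝕜}
    (hγ : HasDerivAt γ u 0) {c : Fin 6} (h3 : γ 0 3 c = 0) (h4 : γ 0 4 c = 0) (h5 : γ 0 5 c = 0)
    (h : (γ 0).submatrix ![2, 3, 4, 5] ![2, 3, 4, 5] =
      !![0, 0, 0, 0; 0, 0, 1, 0; 0, 1, 0, 0; 0, 0, 0, 1]) :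
    HasDerivAt (fun t => ((γ t).submatrix ![2, 3, 4, 5] ![c, 3, 4, 5]).det)
      (-u 2 c - γ 0 2 c * (u 3 4 + u 4 3 + u 5 5)) 0 ∧
    HasDerivAt (fun t => ((γ t).submatrix ![2, 3, 4, 5] ![2, c, 4, 5]).det)
      (γ 0 2 c * u 4 2) 0 := by
  have e : ∀ i j, (γ 0).submatrix ![2, 3, 4, 5] ![2, 3, 4, 5] i j = _ :=
    fun i j => congrFun (congrFun h i) j
  have row2 : γ 0 2 2 = 0 ∧ γ 0 2 3 = 0 ∧ γ 0 2 4 = 0 ∧ γ 0 2 5 = 0 := ⟨e 0 0, e 0 1, e 0 2, e 0 3⟩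
  have row3 : γ 0 3 2 = 0 ∧ γ 0 3 3 = 0 ∧ γ 0 3 4 = 1 ∧ γ 0 3 5 = 0 := ⟨e 1 0, e 1 1, e 1 2, e 1 3⟩
  have row4 : γ 0 4 2 = 0 ∧ γ 0 4 3 = 1 ∧ γ 0 4 4 = 0 ∧ γ 0 4 5 = 0 := ⟨e 2 0, e 2 1, e 2 2, e 2 3⟩
  have row5 : γ 0 5 2 = 0 ∧ γ 0 5 3 = 0 ∧ γ 0 5 4 = 0 ∧ γ 0 5 5 = 1 := ⟨e 3 0, e 3 1, e 3 2, e 3 3⟩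
  clear e h
  obtain ⟨a22, a23, a24, a25⟩ := row2
  obtain ⟨a32, a33, a34, a35⟩ := row3
  obtain ⟨a42, a43, a44, a45⟩ := row4
  obtain ⟨a52, a53, a54, a55⟩ := row5
  constructor
  · have h1 := hasDerivAt_minor hγ ![2, 3, 4, 5] ![c, 3, 4, 5]
    have e' : (γ 0).submatrix ![2, 3, 4, 5] ![c, 3, 4, 5] =
        !![γ 0 2 c, 0, 0, 0; 0, 0, 1, 0; 0, 1, 0, 0; 0, 0, 0, 1] := by
      ext i j
      fin_cases i <;> fin_cases j
      exacts [rfl, a23, a24, a25, h3, a33, a34, a35, h4, a43, a44, a45, h5, a53, a54, a55]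
    rw [e', adjugate_sparse₁, trace_sparse₁] at h1
    exact h1
  · have h1 := hasDerivAt_minor hγ ![2, 3, 4, 5] ![2, c, 4, 5]
    have e' : (γ 0).submatrix ![2, 3, 4, 5] ![2, c, 4, 5] =
        !![0, γ 0 2 c, 0, 0; 0, 0, 1, 0; 0, 0, 0, 0; 0, 0, 0, 1] := by
      ext i j
      fin_cases i <;> fin_cases j
      exacts [a22, rfl, a24, a25, a32, h3, a34, a35, a42, h4, a44, a45, a52, h5, a54, a55]
    rw [e', adjugate_sparse₂, trace_sparse₂] at h1
    exact h1

/-- The assumptions concern single entries rather than membership in a slice, so that they can also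
be checked for the transposed curve. -/
theorem hasDerivAt_invA {γ : ℝ → Matrix (Fin 6) (Fin 6) 𝕜} {u : Matrix (Fin 6) (Fin 6) 𝕜}
    (hγ : HasDerivAt γ u 0) (hc : ∀ c : Fin 6, c = 0 ∨ c = 1 →
      γ 0 3 c = 0 ∧ γ 0 4 c = 0 ∧ γ 0 5 c = 0)
    (h : (γ 0).submatrix ![2, 3, 4, 5] ![2, 3, 4, 5] =
      !![0, 0, 0, 0; 0, 0, 1, 0; 0, 1, 0, 0; 0, 0, 0, 1]) :
    HasDerivAt (fun t => (invA (γ t)).trace)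
      (-u 2 0 - γ 0 2 0 * (u 3 4 + u 4 3 + u 5 5) + γ 0 2 1 * u 4 2) 0 ∧
    HasDerivAt (fun t => invA (γ t) 0 1) (-u 2 1 - γ 0 2 1 * (u 3 4 + u 4 3 + u 5 5)) 0 := by
  obtain ⟨a1, a2, a3⟩ := hc 0 (Or.inl rfl)
  obtain ⟨b1, b2, b3⟩ := hc 1 (Or.inr rfl)
  obtain ⟨ha, -⟩ := hasDerivAt_invA_minor hγ a1 a2 a3 h
  obtain ⟨hb, hb'⟩ := hasDerivAt_invA_minor hγ b1 b2 b3 h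
  simp only [invA_eq_minor, Matrix.trace_fin_two_of]
  exact ⟨ha.add hb', hb⟩

theorem hasDerivAt_transpose {γ : ℝ → Matrix (Fin 6) (Fin 6) 𝕜} {u : Matrix (Fin 6) (Fin 6) 𝕜}
    {t : ℝ} (hγ : HasDerivAt γ u t) : HasDerivAt (fun t => (γ t)ᵀ) uᵀ t :=
  (LinearMap.toContinuousLinearMap
    (Matrix.transposeLinearEquiv (Fin 6) (Fin 6) ℝ 𝕜).toLinearMap).hasFDerivAt.comp_hasDerivAt t hγ

/-- The derivatives of the invariants at a point in normal form. -/
theorem hasDerivAt_slice62' {γ : ℝ → Matrix (Fin 6) (Fin 6) 𝕜} {u : Matrix (Fin 6) (Fin 6) 𝕜}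
    (hγ : HasDerivAt γ u 0) (h : γ 0 ∈ slice62' 𝕜) :
    HasDerivAt (fun t => (invA (γ t)).trace)
      (-u 2 0 - γ 0 2 0 * (u 3 4 + u 4 3 + u 5 5) + γ 0 2 1 * u 4 2) 0 ∧
    HasDerivAt (fun t => invA (γ t) 0 1) (-u 2 1 - γ 0 2 1 * (u 3 4 + u 4 3 + u 5 5)) 0 ∧
    HasDerivAt (fun t => (invA' (γ t)).trace)
      (-u 0 2 - γ 0 0 2 * (u 3 4 + u 4 3 + u 5 5) + γ 0 1 2 * u 2 4) 0 ∧
    HasDerivAt (fun t => invA' (γ t) 1 0) (-u 1 2 - γ 0 1 2 * (u 3 4 + u 4 3 + u 5 5)) 0 := by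
  have e : ∀ i j, γ 0 i j = _ := fun i j => congrFun (congrFun h.2 i) j
  obtain ⟨h1, h2⟩ := hasDerivAt_invA hγ (by
    rintro c (rfl | rfl)
    exacts [⟨e 3 0, e 4 0, e 5 0⟩, ⟨e 3 1, e 4 1, e 5 1⟩]) (by
    ext i j
    fin_cases i <;> fin_cases j
    exacts [e 2 2, e 2 3, e 2 4, e 2 5, e 3 2, e 3 3, e 3 4, e 3 5, e 4 2, e 4 3, e 4 4, e 4 5,
      e 5 2, e 5 3, e 5 4, e 5 5])
  -- The primed invariants are the transposes of the unprimed ones of the transposed curve.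
  obtain ⟨h3, h4⟩ := hasDerivAt_invA (hasDerivAt_transpose hγ) (by
    rintro c (rfl | rfl)
    exacts [⟨e 0 3, e 0 4, e 0 5⟩, ⟨e 1 3, e 1 4, e 1 5⟩]) (by
    ext i j
    fin_cases i <;> fin_cases j
    exacts [e 2 2, e 3 2, e 4 2, e 5 2, e 2 3, e 3 3, e 4 3, e 5 3, e 2 4, e 3 4, e 4 4, e 5 4,
      e 2 5, e 3 5, e 4 5, e 5 5])
  refine ⟨h1, h2, ?_, ?_⟩
  · simp only [invA'_eq, Matrix.trace_transpose]
    refine h3.congr_deriv ?_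
    simp only [Matrix.transpose_apply]
    ring
  · simp only [invA'_eq, Matrix.transpose_apply]
    refine h4.congr_deriv ?_
    simp only [Matrix.transpose_apply]
    ring

/-- The derivatives of the simpler invariants at a point in normal form. -/
theorem hasDerivAt_slice6 {γ : ℝ → Matrix (Fin 6) (Fin 6) 𝕜} {u : Matrix (Fin 6) (Fin 6) 𝕜}
    (hγ : HasDerivAt γ u 0) (h : γ 0 ∈ slice6 𝕜) :
    HasDerivAt (fun t => (blk (γ t) 2 2).det) (u 4 4) 0 ∧
    HasDerivAt (fun t => (invB (γ t)).trace) (u 4 2 + γ 0 4 2 * u 5 5 - γ 0 4 3 * u 5 4) 0 ∧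
    HasDerivAt (fun t => invB (γ t) 0 1) (u 4 3 + γ 0 4 3 * u 5 5) 0 ∧
    HasDerivAt (fun t => (invB' (γ t)).trace) (u 2 4 + γ 0 2 4 * u 5 5 - γ 0 3 4 * u 4 5) 0 ∧
    HasDerivAt (fun t => invB' (γ t) 1 0) (u 3 4 + γ 0 3 4 * u 5 5) 0 := by
  have e : ∀ i j, γ 0 i j = _ := fun i j => congrFun (congrFun h.2 i) j
  have d := hasDerivAt_entry hγ
  have e44 := e 4 4
  have e45 := e 4 5
  have e54 := e 5 4
  have e55 := e 5 5
  have e52 := e 5 2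
  have e53 := e 5 3
  have e25 := e 2 5
  have e35 := e 3 5
  simp at e44 e45 e54 e55 e52 e53 e25 e35
  have hB : ∀ x : Matrix (Fin 6) (Fin 6) 𝕜, (invB x).trace =
      x 5 5 * x 4 2 - x 4 5 * x 5 2 + (-x 5 4 * x 4 3 + x 4 4 * x 5 3) := fun x => by
    rw [invB_eq, Matrix.trace_fin_two_of]
  have hB' : ∀ x : Matrix (Fin 6) (Fin 6) 𝕜, (invB' x).trace =
      x 5 5 * x 2 4 - x 5 4 * x 2 5 + (-x 4 5 * x 3 4 + x 4 4 * x 3 5) := fun x => by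
    rw [invB'_eq, Matrix.trace_transpose, hB]
    rfl
  have hB1 : ∀ x : Matrix (Fin 6) (Fin 6) 𝕜, invB x 0 1 = x 5 5 * x 4 3 - x 4 5 * x 5 3 :=
    fun x => by
    rw [invB_eq]
    rfl
  have hB1' : ∀ x : Matrix (Fin 6) (Fin 6) 𝕜, invB' x 1 0 = x 5 5 * x 3 4 - x 5 4 * x 3 5 :=
    fun x => by
    rw [invB'_eq, Matrix.transpose_apply, hB1]
    rfl
  have hD : ∀ x : Matrix (Fin 6) (Fin 6) 𝕜, (blk x 2 2).det = x 4 4 * x 5 5 - x 4 5 * x 5 4 :=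
    fun x => Matrix.det_fin_two _
  simp only [hB, hB', hB1, hB1', hD]
  refine ⟨?_, ?_, ?_, ?_, ?_⟩
  · refine HasDerivAt.congr_deriv (((d 4 4).mul (d 5 5)).sub ((d 4 5).mul (d 5 4))) ?_
    rw [e44, e45, e54, e55]
    ring
  · refine HasDerivAt.congr_deriv ((((d 5 5).mul (d 4 2)).sub ((d 4 5).mul (d 5 2))).add
      (((d 5 4).neg.mul (d 4 3)).add ((d 4 4).mul (d 5 3)))) ?_
    simp only [e44, e45, e54, e55, e52, e53, Pi.neg_apply]
    ring
  · refine HasDerivAt.congr_deriv (((d 5 5).mul (d 4 3)).sub ((d 4 5).mul (d 5 3))) ?_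
    rw [e45, e53, e55]
    ring
  · refine HasDerivAt.congr_deriv ((((d 5 5).mul (d 2 4)).sub ((d 5 4).mul (d 2 5))).add
      (((d 4 5).neg.mul (d 3 4)).add ((d 4 4).mul (d 3 5)))) ?_
    simp only [e44, e45, e54, e55, e25, e35, Pi.neg_apply]
    ring
  · refine HasDerivAt.congr_deriv (((d 5 5).mul (d 3 4)).sub ((d 5 4).mul (d 3 5))) ?_
    rw [e54, e35, e55]
    ring

end Minors

end GinzburgRallis

end

noncomputable section

namespace GinzburgRallis

/-! ### Anisotropic gradients at normal forms. -/

section MetricallyProper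

variable {𝕜 : Type*} [RCLike 𝕜]

/-- At a point of a stratum, a normal form with a non-isotropic conormal vector. -/
theorem isMetricallyProper_of_normal_form {Z : Set (Matrix (Fin 6) (Fin 6) 𝕜)}
    (hZm : IsSubmanifold Z) (hZ : IsStable (groupH 𝕜) Z) (hu : ∀ z ∈ Z, IsUnit z)
    (h : ∀ z ∈ Z, ∃ h ∈ groupH 𝕜, ∃ Q, IsAnisotropicConormal Z (act h z) Q) :
    IsMetricallyProper Z := by
  refine isMetricallyProper_of_conormal hZm hu fun z hz => ?_
  obtain ⟨h, hh, Q, hQ⟩ := h z hz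
  exact ⟨_, hQ.of_act hZ hh⟩

/-- The matrix is the gradient of the difference of the traces of `invB'` and `invB`; the
contributions of the corner entry cancel because `y 2 4 = y 4 2`. The square trace equals `2 (y 4
2)²`. -/
theorem isAnisotropicConormal_slice61 {y : Matrix (Fin 6) (Fin 6) 𝕜} (hy : y ∈ slice6 𝕜)
    (h : y 2 4 = y 4 2) (h0 : y 4 2 ≠ 0) :
    IsAnisotropicConormal (locus1 𝕜 \ locus2 𝕜) y
      (single 4 2 1 - single 2 4 1 - single 5 4 (y 3 4) + single 4 5 (y 4 3)) := by
  have e : ∀ i j, y i j = _ := fun i j => congrFun (congrFun hy.2 i) j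
  have e22 : y 2 2 = 0 := e 2 2
  have e44 : y 4 4 = 0 := e 4 4
  have e45 : y 4 5 = 0 := e 4 5
  have e52 : y 5 2 = 0 := e 5 2
  have e54 : y 5 4 = 0 := e 5 4
  have e55 : y 5 5 = 1 := e 5 5
  have e25 : y 2 5 = 0 := e 2 5
  constructor
  · intro v hv
    refine eq_zero_of_mem_tangentSpaceOf (isLinearMap_trace_mul _)
      (f := fun x => (invB' x).trace - (invB x).trace) (fun x hx => sub_eq_zero.2 hx.1.2) ?_ hv
    rintro γ u rfl hγ
    obtain ⟨-, h1, -, h2, -⟩ := hasDerivAt_slice6 hγ hy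
    refine (h2.sub h1).congr_deriv ?_
    simp only [add_mul, sub_mul, Matrix.trace_add, Matrix.trace_sub, Matrix.trace_single_mul,
      smul_eq_mul, h]
    ring
  · simp only [Matrix.trace, Matrix.diag_apply, Matrix.mul_apply, Fin.sum_univ_six,
      Matrix.add_apply, Matrix.sub_apply, Matrix.single_apply]
    simp [h, e22, e44, e45, e52, e54, e55, e25, h0]

/-- Here the gradient is that of the difference of the traces of `invA` and `invA'`, and the square
trace equals `2 (y 2 0)²`. -/
theorem isAnisotropicConormal_slice63' {y : Matrix (Fin 6) (Fin 6) 𝕜} (hy : y ∈ slice62' 𝕜)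
    (h : y 0 2 = y 2 0) (h0 : y 2 0 ≠ 0) :
    IsAnisotropicConormal (locus3 𝕜 \ locus4 𝕜) y
      (single 2 0 1 - single 0 2 1 + single 2 4 (y 2 1) - single 4 2 (y 1 2)) := by
  have e : ∀ i j, y i j = _ := fun i j => congrFun (congrFun hy.2 i) j
  have e22 : y 2 2 = 0 := e 2 2
  have e24 : y 2 4 = 0 := e 2 4
  have e42 : y 4 2 = 0 := e 4 2
  have e44 : y 4 4 = 0 := e 4 4
  have e40 : y 4 0 = 0 := e 4 0
  have e04 : y 0 4 = 0 := e 0 4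
  constructor
  · intro v hv
    refine eq_zero_of_mem_tangentSpaceOf (isLinearMap_trace_mul _)
      (f := fun x => (invA x).trace - (invA' x).trace) (fun x hx => sub_eq_zero.2 hx.1.2) ?_ hv
    rintro γ u rfl hγ
    obtain ⟨h1, -, h2, -⟩ := hasDerivAt_slice62' hγ hy
    refine (h1.sub h2).congr_deriv ?_
    simp only [add_mul, sub_mul, Matrix.trace_add, Matrix.trace_sub, Matrix.trace_single_mul,
      smul_eq_mul, h]
    ring
  · simp only [Matrix.trace, Matrix.diag_apply, Matrix.mul_apply, Fin.sum_univ_six,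
      Matrix.add_apply, Matrix.sub_apply, Matrix.single_apply]
    simp [h, e22, e24, e42, e44, e40, e04, h0]

/-- One entry of the Kronecker identity suffices. Its gradient has square trace `4 (y 1 2)²`,
nonzero because `y` is invertible. -/
theorem isAnisotropicConormal_slice65'' {y : Matrix (Fin 6) (Fin 6) 𝕜} (hy : y ∈ slice65'' 𝕜) :
    IsAnisotropicConormal (locus5 𝕜) y
      (single 2 1 1 - single 1 2 1 + single 3 4 (y 1 2) - single 4 3 (y 1 2)) := by
  obtain ⟨hy, h⟩ := hy
  have e : ∀ i j, y i j = _ := fun i j => congrFun (congrFun hy.2 i) j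
  have n12 := (ne_zero_slice64' hy.1).1
  have hy2 : y ∈ slice62' 𝕜 := hy.1.1
  obtain ⟨-, -, i3, i4, i5, i6⟩ := invariants_slice62' hy2
  have e11 : y 1 1 = 0 := e 1 1
  have e13 : y 1 3 = 0 := e 1 3
  have e14 : y 1 4 = 0 := e 1 4
  have e22 : y 2 2 = 0 := e 2 2
  have e23 : y 2 3 = 0 := e 2 3
  have e24 : y 2 4 = 0 := e 2 4
  have e31 : y 3 1 = 0 := e 3 1
  have e32 : y 3 2 = 0 := e 3 2
  have e33 : y 3 3 = 0 := e 3 3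
  have e34 : y 3 4 = 1 := e 3 4
  have e41 : y 4 1 = 0 := e 4 1
  have e42 : y 4 2 = 0 := e 4 2
  have e43 : y 4 3 = 1 := e 4 3
  have e44 : y 4 4 = 0 := e 4 4
  constructor
  · intro v hv
    refine eq_zero_of_mem_tangentSpaceOf (isLinearMap_trace_mul _)
      (f := fun x => invA x 0 1 * invB' x 1 0 - invB x 0 1 * invA' x 1 0) (fun x hx => ?_) ?_ hv
    · exact sub_eq_zero.2 (congrFun (congrFun hx.2 (0, 1)) (1, 0))
    · rintro γ u rfl hγ
      obtain ⟨-, h1, -, h2⟩ := hasDerivAt_slice62' hγ hy2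
      obtain ⟨-, -, h3, -, h4⟩ := hasDerivAt_slice6 hγ hy2.1.1
      refine ((h1.mul h4).sub (h3.mul h2)).congr_deriv ?_
      simp only [add_mul, sub_mul, Matrix.trace_add, Matrix.trace_sub, Matrix.trace_single_mul,
        smul_eq_mul, i3, i4, i5, i6, h, e34, e43]
      simp
      ring
  · simp only [Matrix.trace, Matrix.diag_apply, Matrix.mul_apply, Fin.sum_univ_six,
      Matrix.add_apply, Matrix.sub_apply, Matrix.single_apply]
    simp [← h, e11, e13, e14, e22, e23, e24, e31, e32, e33, e34, e41, e42, e43, e44]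
    rw [show y 1 2 * y 1 2 + y 1 2 * y 1 2 + y 1 2 * y 1 2 + y 1 2 * y 1 2 =
      4 * (y 1 2 * y 1 2) by ring]
    simp [n12]

theorem isMetricallyProper_locus1_diff : IsMetricallyProper (locus1 𝕜 \ locus2 𝕜) := by
  have hs : IsStable (groupH 𝕜) (locus1 𝕜 \ locus2 𝕜) := isStable_locus1.diff isStable_locus2
  refine isMetricallyProper_of_normal_form isSubmanifold_locus1_diff hs
    (fun z hz => hz.1.1.1) fun z hz => ?_
  obtain ⟨h, hh, hy⟩ := exists_act_slice6 hz.1.1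
  obtain ⟨h1, h2⟩ := hs h hh z hz
  rw [← mem_slice61_iff hy] at h1
  rw [← mem_slice62_iff hy] at h2
  have h3 : act h z 2 4 = act h z 4 2 := h1.2
  exact ⟨h, hh, _, isAnisotropicConormal_slice61 hy h3 fun h0 => h2 ⟨hy, h3.trans h0, h0⟩⟩

theorem isMetricallyProper_locus3_diff : IsMetricallyProper (locus3 𝕜 \ locus4 𝕜) := by
  have hs : IsStable (groupH 𝕜) (locus3 𝕜 \ locus4 𝕜) := isStable_locus3.diff isStable_locus4
  refine isMetricallyProper_of_normal_form isSubmanifold_locus3_diff hs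
    (fun z hz => hz.1.1.1.1) fun z hz => ?_
  obtain ⟨h, hh, hy⟩ := exists_act_slice62' hz.1.1
  obtain ⟨h1, h2⟩ := hs h hh z hz
  rw [← mem_slice63'_iff hy] at h1
  rw [← mem_slice64'_iff hy] at h2
  have h3 : act h z 0 2 = act h z 2 0 := h1.2
  exact ⟨h, hh, _, isAnisotropicConormal_slice63' hy h3 fun h0 => h2 ⟨hy, h3.trans h0, h0⟩⟩

theorem isMetricallyProper_locus5 : IsMetricallyProper (locus5 𝕜) := by
  refine isMetricallyProper_of_normal_form isSubmanifold_locus5 isStable_locus5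
    (fun z hz => hz.1.1.1.1) fun z hz => ?_
  obtain ⟨h, hh, hy⟩ := exists_act_slice64'' hz.1
  exact ⟨h, hh, _, isAnisotropicConormal_slice65''
    ((mem_slice65''_iff hy).2 (isStable_locus5 h hh z hz))⟩

end MetricallyProper

end GinzburgRallis

end

noncomputable section

namespace GinzburgRallis

/-! ### Transversality of the three parameter slice. -/

section NormalForm

variable {𝕜 : Type*} [RCLike 𝕜]

/-- The matrices in `slice64''`. -/
def normalForm (a b c : 𝕜) : Matrix (Fin 6) (Fin 6) 𝕜 :=
  !![a, 0, 0, 0, 0, 0;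
     0, 0, b, 0, 0, 0;
     0, c, 0, 0, 0, 0;
     0, 0, 0, 0, 1, 0;
     0, 0, 0, 1, 0, 0;
     0, 0, 0, 0, 0, 1]

/-- The determinant equations hold automatically for matrices of this shape, so the slice is an open
part of an affine space. -/
theorem mem_slice64''_iff {x : Matrix (Fin 6) (Fin 6) 𝕜} :
    x ∈ slice64'' 𝕜 ↔ x ∈ openPart 𝕜 ∧ x = normalForm (x 0 0) (x 1 2) (x 2 1) := by
  constructor
  · rintro ⟨h, hx⟩
    obtain ⟨h1, -, -, h2, h3⟩ := (slice62'_subset h.1).1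
    exact ⟨⟨h1, h2, h3⟩, hx⟩
  · rintro ⟨⟨h1, h2, h3⟩, hx⟩
    have e : ∀ i j, x i j = _ := fun i j => congrFun (congrFun hx i) j
    have b22 : blk x 2 2 = !![0, 0; 0, 1] := by
      ext i j
      fin_cases i <;> fin_cases j
      exacts [e 4 4, e 4 5, e 5 4, e 5 5]
    have d4 : (m4 x).det = 0 := by
      rw [det_m4_eq]
      refine Matrix.det_eq_zero_of_row_eq_zero 0 fun j => ?_
      fin_cases j
      exacts [e 2 2, e 2 3, e 2 4, e 2 5]
    have h0 : x ∈ locus0 𝕜 := ⟨h1, by rw [b22, Matrix.det_fin_two_of]; simp, d4, h2, h3⟩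
    refine slice64''_iff.2 ⟨slice62'_iff.2 ⟨h0, ?_, b22, ?_, ?_, ?_, ?_, ?_, ?_⟩, ?_, ?_, ?_⟩
    · ext i j
      fin_cases i <;> fin_cases j
      exacts [e 2 2, e 2 3, e 3 2, e 3 3]
    · ext i j
      fin_cases i <;> fin_cases j
      exacts [e 0 4, e 0 5, e 1 4, e 1 5]
    · ext i j
      fin_cases i <;> fin_cases j
      exacts [e 2 4, e 2 5, e 3 4, e 3 5]
    · ext i j
      fin_cases i <;> fin_cases j
      exacts [e 4 0, e 4 1, e 5 0, e 5 1]
    · ext i j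
      fin_cases i <;> fin_cases j
      exacts [e 4 2, e 4 3, e 5 2, e 5 3]
    · intro p
      fin_cases p
      exacts [e 0 3, e 1 3]
    · intro p
      fin_cases p
      exacts [e 3 0, e 3 1]
    · ext i j
      fin_cases i <;> fin_cases j
      exacts [rfl, e 0 1, e 1 0, e 1 1]
    · ext i j
      fin_cases i <;> fin_cases j
      exacts [e 0 2, e 0 3, rfl, e 1 3]
    · ext i j
      fin_cases i <;> fin_cases j
      exacts [e 2 0, rfl, e 3 0, e 3 1]

/-- The positions of the entries that are not prescribed in `slice64''`. -/
def freeEntries : Set (Fin 6 × Fin 6) := {(0, 0), (1, 2), (2, 1)}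

theorem normalForm_apply (a b c : 𝕜) {p : Fin 6 × Fin 6} (hp : p ∉ freeEntries) :
    normalForm a b c p.1 p.2 = normalForm (0 : 𝕜) 0 0 p.1 p.2 := by
  obtain ⟨i, j⟩ := p
  simp only [normalForm]
  fin_cases i <;> fin_cases j <;> simp [freeEntries] at hp ⊢

theorem eq_normalForm_iff {x : Matrix (Fin 6) (Fin 6) 𝕜} :
    x = normalForm (x 0 0) (x 1 2) (x 2 1) ↔
      ∀ p ∉ freeEntries, x p.1 p.2 = normalForm (0 : 𝕜) 0 0 p.1 p.2 := by
  constructor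
  · intro h p hp
    rw [← normalForm_apply _ _ _ hp, ← h]
  · intro h
    ext i j
    by_cases hp : (i, j) ∈ freeEntries
    · simp only [freeEntries, Set.mem_insert_iff, Set.mem_singleton_iff, Prod.mk.injEq] at hp
      obtain ⟨rfl, rfl⟩ | ⟨rfl, rfl⟩ | ⟨rfl, rfl⟩ := hp <;> rfl
    · rw [h (i, j) hp, normalForm_apply (x 0 0) (x 1 2) (x 2 1) hp]

theorem isSubmanifold_of_affine {E V : Type*} [NormedAddCommGroup E] [NormedSpace ℝ E]
    [NormedAddCommGroup V] [NormedSpace ℝ V] [FiniteDimensional ℝ V] {Z U : Set E} (hU : IsOpen U)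
    (L : E →L[ℝ] V) (hL : Function.Surjective L) (v : V) (hZ : Z = {x ∈ U | L x = v}) :
    IsSubmanifold Z := by
  refine isSubmanifold_of_contDiff hU (f := fun x => L x - v) (L.contDiff.sub contDiff_const)
    (fun z _ => ?_) (by simpa only [sub_eq_zero] using hZ)
  rw [(L.hasFDerivAt.sub_const v).fderiv]
  exact hL

theorem isSubmanifold_slice64''_inter {U : Set (Matrix (Fin 6) (Fin 6) 𝕜)} (hU : IsOpen U) :
    IsSubmanifold (slice64'' 𝕜 ∩ U) := by
  classical
  let L : Matrix (Fin 6) (Fin 6) 𝕜 →ₗ[ℝ] ({p : Fin 6 × Fin 6 // p ∉ freeEntries} → 𝕜) :=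
    { toFun := fun x p => x p.1.1 p.1.2
      map_add' := fun _ _ => rfl
      map_smul' := fun _ _ => rfl }
  refine isSubmanifold_of_affine (isOpen_openPart.inter hU) (LinearMap.toContinuousLinearMap L)
    (fun w => ?_) (L (normalForm 0 0 0)) ?_
  · refine ⟨of fun i j => if h : (i, j) ∉ freeEntries then w ⟨(i, j), h⟩ else 0, ?_⟩
    ext ⟨p, hp⟩
    exact dif_pos hp
  · ext x
    have hL : L x = L (normalForm 0 0 0) ↔
        ∀ p ∉ freeEntries, x p.1 p.2 = normalForm (0 : 𝕜) 0 0 p.1 p.2 :=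
      ⟨fun h p hp => congrFun h ⟨p, hp⟩, fun h => funext fun p => h p.1 p.2⟩
    simp only [Set.mem_inter_iff, mem_slice64''_iff, eq_normalForm_iff, Set.mem_ofPred_eq,
      LinearMap.coe_toContinuousLinearMap', hL]
    tauto

theorem mem_tangentSpaceOf_slice64'' {U : Set (Matrix (Fin 6) (Fin 6) 𝕜)} (hU : IsOpen U)
    {y w : Matrix (Fin 6) (Fin 6) 𝕜} (hy : y ∈ slice64'' 𝕜 ∩ U)
    (hw : ∀ p ∉ freeEntries, w p.1 p.2 = 0) : w ∈ tangentSpaceOf (slice64'' 𝕜 ∩ U) y := by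
  obtain ⟨h1, h2⟩ := hy
  obtain ⟨h1, h3⟩ := mem_slice64''_iff.1 h1
  refine (isVelocity_line ?_).mem
  have hc : ContinuousAt (fun t : ℝ => y + t • w) 0 := by fun_prop
  have := hc.preimage_mem_nhds ((isOpen_openPart.inter hU).mem_nhds (by simpa using ⟨h1, h2⟩))
  filter_upwards [this] with t ht
  refine ⟨mem_slice64''_iff.2 ⟨ht.1, eq_normalForm_iff.2 fun p hp => ?_⟩, ht.2⟩
  rw [← eq_normalForm_iff.1 h3 p hp, Matrix.add_apply, Matrix.smul_apply, hw p hp, smul_zero,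
    add_zero]

/-- The group `S` consists of the invertible elements of an algebra of matrices, so whole lines
through the identity stay in it as long as the diagonal block is invertible. -/
theorem isLieTangent_sMat (a b c d a' b' c' d' : Matrix (Fin 2) (Fin 2) 𝕜) :
    IsLieTangent (groupH 𝕜) (sMat a b c d, sMat a' b' c' d') := by
  have key : ∀ a : Matrix (Fin 2) (Fin 2) 𝕜, ∀ᶠ t in 𝓝 (0 : ℝ), (1 + t • a).det ≠ 0 := by
    intro a
    have hc : ContinuousAt (fun t : ℝ => (1 + t • a).det) 0 := by fun_prop
    exact hc.eventually_ne (by simp)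
  have e : ∀ (a b c d : Matrix (Fin 2) (Fin 2) 𝕜) (t : ℝ),
      sMat (1 + t • a) (t • b) (t • c) (t • d) = 1 + t • sMat a b c d := by
    intro a b c d t
    apply blk_ext
    intro i j
    have : blk (1 + t • sMat a b c d) i j = blk 1 i j + t • blk (sMat a b c d) i j := rfl
    rw [this, blk_sMat, blk_sMat, blk_one]
    fin_cases i <;> fin_cases j <;> simp
  filter_upwards [key a, key a'] with t ht ht'
  refine ⟨(sElt _ (t • b) (t • c) (t • d) ht, sElt _ (t • b') (t • c') (t • d') ht'),
    ⟨sElt_mem _ _ _ _ ht, sElt_mem _ _ _ _ ht'⟩, ?_⟩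
  simp only [pairVal, sElt_val, e]

/-- The equations of the tangent space of `locus4` at a point in normal form. -/
theorem tangent_locus4 {y v : Matrix (Fin 6) (Fin 6) 𝕜} (hy : y ∈ slice64'' 𝕜)
    (hv : v ∈ tangentSpaceOf (locus4 𝕜) y) :
    v 4 4 = 0 ∧ v 2 2 = 0 ∧ v 2 4 = v 4 5 ∧ v 4 2 = v 5 4 ∧ v 2 0 = y 2 1 * v 4 2 ∧
      v 0 2 = y 1 2 * v 2 4 := by
  have e : ∀ i j, y i j = _ := fun i j => congrFun (congrFun hy.2 i) j
  have e34 : y 3 4 = 1 := e 3 4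
  have e43 : y 4 3 = 1 := e 4 3
  have e24 : y 2 4 = 0 := e 2 4
  have e42 : y 4 2 = 0 := e 4 2
  have e02 : y 0 2 = 0 := e 0 2
  have e20 : y 2 0 = 0 := e 2 0
  have hy2 : y ∈ slice62' 𝕜 := hy.1.1
  refine ⟨?_, ?_, ?_, ?_, ?_, ?_⟩
  · refine eq_zero_of_mem_tangentSpaceOf (ℓ := fun u => u 4 4) ⟨fun _ _ => rfl, fun _ _ => rfl⟩
      (f := fun x => (blk x 2 2).det) (fun x hx => hx.1.1.2.1) ?_ hv
    rintro γ u rfl hγ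
    exact (hasDerivAt_slice6 hγ hy2.1.1).1
  · refine neg_eq_zero.1 (eq_zero_of_mem_tangentSpaceOf (ℓ := fun u => -u 2 2)
      ⟨fun _ _ => neg_add _ _, fun c u => (smul_neg c (u 2 2)).symm⟩
      (f := fun x => (m4 x).det) (fun x hx => hx.1.1.2.2.1) ?_ hv)
    rintro γ u rfl hγ
    exact hasDerivAt_det4 hγ hy2
  · refine sub_eq_zero.1 (eq_zero_of_mem_tangentSpaceOf (ℓ := fun u => u 2 4 - u 4 5)
      ⟨fun _ _ => add_sub_add_comm _ _ _ _, fun c u => (smul_sub c (u 2 4) (u 4 5)).symm⟩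
      (f := fun x => (invB' x).trace) (fun x hx => hx.1.2.1) ?_ hv)
    rintro γ u rfl hγ
    refine (hasDerivAt_slice6 hγ hy2.1.1).2.2.2.1.congr_deriv ?_
    rw [e24, e34]
    ring
  · refine sub_eq_zero.1 (eq_zero_of_mem_tangentSpaceOf (ℓ := fun u => u 4 2 - u 5 4)
      ⟨fun _ _ => add_sub_add_comm _ _ _ _, fun c u => (smul_sub c (u 4 2) (u 5 4)).symm⟩
      (f := fun x => (invB x).trace) (fun x hx => hx.1.2.2) ?_ hv)
    rintro γ u rfl hγ
    refine (hasDerivAt_slice6 hγ hy2.1.1).2.1.congr_deriv ?_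
    rw [e42, e43]
    ring
  · refine sub_eq_zero.1 (eq_zero_of_mem_tangentSpaceOf (ℓ := fun u => u 2 0 - y 2 1 * u 4 2)
      ⟨fun a b => ?_, fun c a => ?_⟩
      (f := fun x => -(invA x).trace) (fun x hx => neg_eq_zero.2 hx.2.1) ?_ hv)
    · simp only [Matrix.add_apply]
      ring
    · simp only [Matrix.smul_apply, smul_sub, mul_smul_comm]
    rintro γ u rfl hγ
    refine (hasDerivAt_slice62' hγ hy2).1.neg.congr_deriv ?_
    rw [e20]
    ring
  · refine sub_eq_zero.1 (eq_zero_of_mem_tangentSpaceOf (ℓ := fun u => u 0 2 - y 1 2 * u 2 4)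
      ⟨fun a b => ?_, fun c a => ?_⟩
      (f := fun x => -(invA' x).trace) (fun x hx => neg_eq_zero.2 hx.2.2) ?_ hv)
    · simp only [Matrix.add_apply]
      ring
    · simp only [Matrix.smul_apply, smul_sub, mul_smul_comm]
    rintro γ u rfl hγ
    refine (hasDerivAt_slice62' hγ hy2).2.2.1.neg.congr_deriv ?_
    rw [e02]
    ring

theorem blk_sub_action (v y : Matrix (Fin 6) (Fin 6) 𝕜)
    (a b c d a' b' c' d' : Matrix (Fin 2) (Fin 2) 𝕜) (r s : Fin 3) :
    blk (v - (sMat a b c d * y + y * (sMat a' b' c' d')ᵀ)) r s = blk v r s -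
      (!![a, b, d; 0, a, c; 0, 0, a] r 0 * blk y 0 s + !![a, b, d; 0, a, c; 0, 0, a] r 1 *
        blk y 1 s + !![a, b, d; 0, a, c; 0, 0, a] r 2 * blk y 2 s +
      (blk y r 0 * (!![a', b', d'; 0, a', c'; 0, 0, a'] s 0)ᵀ +
        blk y r 1 * (!![a', b', d'; 0, a', c'; 0, 0, a'] s 1)ᵀ +
        blk y r 2 * (!![a', b', d'; 0, a', c'; 0, 0, a'] s 2)ᵀ)) := by
  simp only [← blk_sMat, ← blk_transpose, ← blk_mul]
  rfl

/-- The slice is transversal to the orbits. -/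
theorem transversal_slice64'' {y v : Matrix (Fin 6) (Fin 6) 𝕜} (hy : y ∈ slice64'' 𝕜)
    (hv : v ∈ tangentSpaceOf (locus4 𝕜) y) :
    ∃ X, IsLieTangent (groupH 𝕜) X ∧
      ∀ p ∉ freeEntries, (v - (X.1 * y + y * X.2ᵀ)) p.1 p.2 = 0 := by
  obtain ⟨h1, h2, h3, h4, h5, h6⟩ := tangent_locus4 hy hv
  obtain ⟨n12, n21⟩ := ne_zero_slice64' hy.1
  -- The pair solves `v = X y + y X'ᵀ` entry by entry outside the free positions. The 27 parameters
  -- used match the 33 prescribed entries minus the six tangent equations, which settle the rest.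
  refine ⟨_, isLieTangent_sMat !![v 4 3, v 2 4; 0, v 5 5]
    !![v 0 1 / y 2 1, v 0 4; v 1 1 / y 2 1, v 1 4] !![v 2 3, v 2 5; v 3 3, v 3 5]
    !![v 0 3, v 0 5; v 1 3, v 1 5] !![v 3 4 - v 5 5, v 4 2; 0, 0]
    !![v 1 0 / y 1 2, v 4 0; 0, v 4 1] !![v 3 2, v 5 2; 0, v 5 3]
    !![v 3 0, v 5 0; v 3 1, v 5 1], ?_⟩
  obtain ⟨hy2, y00, y01, y10⟩ := slice64''_iff.1 hy
  obtain ⟨-, y11, y22, y02, y12, y20, y21, -⟩ := slice62'_iff.1 hy2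
  clear hy hv hy2
  generalize y 0 0 = a at *
  generalize y 1 2 = b at *
  generalize y 2 1 = c at *
  have hw := blk_sub_action v y !![v 4 3, v 2 4; 0, v 5 5]
    !![v 0 1 / c, v 0 4; v 1 1 / c, v 1 4] !![v 2 3, v 2 5; v 3 3, v 3 5]
    !![v 0 3, v 0 5; v 1 3, v 1 5] !![v 3 4 - v 5 5, v 4 2; 0, 0]
    !![v 1 0 / b, v 4 0; 0, v 4 1] !![v 3 2, v 5 2; 0, v 5 3] !![v 3 0, v 5 0; v 3 1, v 5 1]
  generalize v - _ = w at *
  have v00 : blk v 0 0 = !![v 0 0, v 0 1; v 1 0, v 1 1] := Matrix.eta_fin_two _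
  have v01 : blk v 0 1 = !![v 0 2, v 0 3; v 1 2, v 1 3] := Matrix.eta_fin_two _
  have v02 : blk v 0 2 = !![v 0 4, v 0 5; v 1 4, v 1 5] := Matrix.eta_fin_two _
  have v10 : blk v 1 0 = !![v 2 0, v 2 1; v 3 0, v 3 1] := Matrix.eta_fin_two _
  have v11 : blk v 1 1 = !![v 2 2, v 2 3; v 3 2, v 3 3] := Matrix.eta_fin_two _
  have v12 : blk v 1 2 = !![v 2 4, v 2 5; v 3 4, v 3 5] := Matrix.eta_fin_two _
  have v20 : blk v 2 0 = !![v 4 0, v 4 1; v 5 0, v 5 1] := Matrix.eta_fin_two _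
  have v21 : blk v 2 1 = !![v 4 2, v 4 3; v 5 2, v 5 3] := Matrix.eta_fin_two _
  have v22 : blk v 2 2 = !![v 4 4, v 4 5; v 5 4, v 5 5] := Matrix.eta_fin_two _
  have f00 : blk w 0 0 0 1 = 0 ∧ blk w 0 0 1 0 = 0 ∧ blk w 0 0 1 1 = 0 := by
    rw [hw, v00]
    simp [y00, y01, y10, y20, y02, transpose_two, n12, n21]
    field_simp
    simp
  have f01 : blk w 0 1 0 0 = 0 ∧ blk w 0 1 0 1 = 0 ∧ blk w 0 1 1 1 = 0 := by
    rw [hw, v01]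
    simp [y00, y01, y11, y21, y02, transpose_two, h6]
    ring
  have f10 : blk w 1 0 0 0 = 0 ∧ blk w 1 0 1 0 = 0 ∧ blk w 1 0 1 1 = 0 := by
    rw [hw, v10]
    simp [y00, y11, y10, y20, y12, transpose_two, h5]
  have f02 : blk w 0 2 = 0 := by
    rw [hw, v02]
    simp [y00, y01, y10, y11, y22, y02, y12, y20, y21, transpose_two, ← Matrix.ext_iff,
      Fin.forall_fin_two, h1, h2, h3, h4]
  have f11 : blk w 1 1 = 0 := by
    rw [hw, v11]
    simp [y00, y01, y10, y11, y22, y02, y12, y20, y21, transpose_two, ← Matrix.ext_iff,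
      Fin.forall_fin_two, h1, h2, h3, h4]
  have f12 : blk w 1 2 = 0 := by
    rw [hw, v12]
    simp [y00, y01, y10, y11, y22, y02, y12, y20, y21, transpose_two, ← Matrix.ext_iff,
      Fin.forall_fin_two, h1, h2, h3, h4]
  have f20 : blk w 2 0 = 0 := by
    rw [hw, v20]
    simp [y00, y01, y10, y11, y22, y02, y12, y20, y21, transpose_two, ← Matrix.ext_iff,
      Fin.forall_fin_two, h1, h2, h3, h4]
  have f21 : blk w 2 1 = 0 := by
    rw [hw, v21]
    simp [y00, y01, y10, y11, y22, y02, y12, y20, y21, transpose_two, ← Matrix.ext_iff,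
      Fin.forall_fin_two, h1, h2, h3, h4]
  have f22 : blk w 2 2 = 0 := by
    rw [hw, v22]
    simp [y00, y01, y10, y11, y22, y02, y12, y20, y21, transpose_two, ← Matrix.ext_iff,
      Fin.forall_fin_two, h1, h2, h3, h4]
  have e02 : ∀ i j, blk w 0 2 i j = 0 := fun i j => congrFun (congrFun f02 i) j
  have e11 : ∀ i j, blk w 1 1 i j = 0 := fun i j => congrFun (congrFun f11 i) j
  have e12 : ∀ i j, blk w 1 2 i j = 0 := fun i j => congrFun (congrFun f12 i) j
  have e20 : ∀ i j, blk w 2 0 i j = 0 := fun i j => congrFun (congrFun f20 i) j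
  have e21 : ∀ i j, blk w 2 1 i j = 0 := fun i j => congrFun (congrFun f21 i) j
  have e22 : ∀ i j, blk w 2 2 i j = 0 := fun i j => congrFun (congrFun f22 i) j
  rintro ⟨i, j⟩ hp
  rw [freeEntries] at hp
  fin_cases i <;> fin_cases j
  exacts [(hp (by simp)).elim, f00.1, f01.1, f01.2.1, e02 0 0, e02 0 1,
    f00.2.1, f00.2.2, (hp (by simp)).elim, f01.2.2, e02 1 0, e02 1 1,
    f10.1, (hp (by simp)).elim, e11 0 0, e11 0 1, e12 0 0, e12 0 1,
    f10.2.1, f10.2.2, e11 1 0, e11 1 1, e12 1 0, e12 1 1,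
    e20 0 0, e20 0 1, e21 0 0, e21 0 1, e22 0 0, e22 0 1,
    e20 1 0, e20 1 1, e21 1 0, e21 1 1, e22 1 0, e22 1 1]

end NormalForm

end GinzburgRallis

end

noncomputable section

namespace GinzburgRallis

/-! ### Stabilizers of normal forms and the remaining incompatible stratum. -/

section NormalFormStabilizers

variable {𝕜 : Type*} [RCLike 𝕜]

/-- A family of matrices that give rise to stabilizers of normal forms. -/
def stabLower (b : 𝕜) : Matrix (Fin 6) (Fin 6) 𝕜 :=
  single 2 0 1 + single 4 2 b + single 5 4 b

/-- The counterpart of `stabLower` under transposition. -/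
def stabUpper (c : 𝕜) : Matrix (Fin 6) (Fin 6) 𝕜 :=
  single 0 2 1 + single 2 4 c + single 4 5 c

theorem normalForm_eq (a b c : 𝕜) : normalForm a b c =
    single 0 0 a + single 1 2 b + single 2 1 c + single 3 4 1 + single 4 3 1 + single 5 5 1 := by
  ext i j
  fin_cases i <;> fin_cases j <;> simp [normalForm]

theorem sMat_eq_lower (t : 𝕜) :
    sMat !![1, 0; t, 1] 0 0 0 = 1 + (single 1 0 t + single 3 2 t + single 5 4 t) := by
  have e : sMat !![1, 0; t, 1] 0 0 0 = !![1, 0, 0, 0, 0, 0; t, 1, 0, 0, 0, 0; 0, 0, 1, 0, 0, 0;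
      0, 0, t, 1, 0, 0; 0, 0, 0, 0, 1, 0; 0, 0, 0, 0, t, 1] := by
    ext i j
    fin_cases i <;> fin_cases j <;> rfl
  rw [e]
  ext i j
  fin_cases i <;> fin_cases j <;> simp

theorem sMat_eq_upper (r s t : 𝕜) :
    sMat !![1, 0; 0, 1] !![r, 0; 0, 0] !![0, 0; 0, t] !![0, 0; s, 0] =
      1 + (single 0 2 r + single 1 4 s + single 3 5 t) := by
  have e : sMat !![1, 0; 0, 1] !![r, 0; 0, 0] !![0, 0; 0, t] !![0, 0; s, 0] =
      !![1, 0, r, 0, 0, 0; 0, 1, 0, 0, s, 0; 0, 0, 1, 0, 0, 0;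
      0, 0, 0, 1, 0, t; 0, 0, 0, 0, 1, 0; 0, 0, 0, 0, 0, 1] := by
    ext i j
    fin_cases i <;> fin_cases j <;> rfl
  rw [e]
  ext i j
  fin_cases i <;> fin_cases j <;> simp

theorem single_neg_eq (i j : Fin 6) (r : 𝕜) :
    (single i j (-r) : Matrix (Fin 6) (Fin 6) 𝕜) = -single i j r :=
  (Matrix.singleLinearMap ℝ i j : 𝕜 →ₗ[ℝ] Matrix (Fin 6) (Fin 6) 𝕜).map_neg r

/-- Determinant 1 removes `χ₀` and turns the inverse of the diagonal block into its adjugate. -/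
theorem chiS_of_sMat (ψ : AddChar 𝕜 Circle) (χ₀ : 𝕜ˣ →* ℂˣ) {g : S 𝕜}
    {a b c d : Matrix (Fin 2) (Fin 2) 𝕜} (hg : g.1.1 = sMat a b c d) (ha : a.det = 1) {r : 𝕜}
    (hr : ((b + c) * adjugate a).trace = r) : chiS ψ χ₀ g = Circle.toUnits (ψ r) := by
  have h0 : (leviS 𝕜 g : Matrix (Fin 2) (Fin 2) 𝕜) = a := by
    rw [leviS_val, hg, blk_sMat]
    rfl
  have h1 : Matrix.GeneralLinearGroup.det (leviS 𝕜 g) = 1 := by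
    ext
    rw [Matrix.GeneralLinearGroup.val_det_apply, h0, ha, Units.val_one]
  have h2 : ((leviS 𝕜 g)⁻¹).1 = adjugate a := by
    rw [Matrix.coe_units_inv, h0, Matrix.inv_def, ha]
    simp
  have h3 : traceS g = r := by
    rw [traceS, h2, hg, blk_sMat, blk_sMat, ← hr]
    rfl
  change χ₀ (Matrix.GeneralLinearGroup.det (leviS 𝕜 g)) * Circle.toUnits (ψ (traceS g)) = _
  rw [h1, h3, map_one, one_mul]

/-- Here `z K` is not strictly block upper triangular: the first component has a unipotent diagonal
block of determinant 1 and contributes nothing to the character. The value comes from the entries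
`-(t a)` and `-(t b)` in the second. -/
theorem exists_stabLower (ψ : AddChar 𝕜 Circle) (χ₀ : 𝕜ˣ →* ℂˣ) (a b c t : 𝕜) :
    ∃ (hK : (t • stabLower b) * normalForm a b c * (t • stabLower b) = 0)
      (hm : stabPair (normalForm a b c) (t • stabLower b) hK ∈ groupH 𝕜),
      chiH ψ χ₀ ⟨_, hm⟩ = Circle.toUnits (ψ (-(t * (a + b)))) := by
  have h1 : normalForm a b c * (t • stabLower b) =
      single 1 0 (t * b) + single 3 2 (t * b) + single 5 4 (t * b) := by
    rw [normalForm_eq, stabLower]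
    simp [add_mul, mul_add, mul_comm b]
  have h2 : (t • stabLower b) * normalForm a b c =
      single 2 0 (t * a) + single 4 1 (t * (b * c)) + single 5 3 (t * b) := by
    rw [normalForm_eq, stabLower]
    simp [add_mul, mul_add, mul_assoc]
  have hK : (t • stabLower b) * normalForm a b c * (t • stabLower b) = 0 := by
    rw [h2]
    simp [stabLower, add_mul, mul_add]
  have g1 : ((stabPair (normalForm a b c) (t • stabLower b) hK).1 : Matrix (Fin 6) (Fin 6) 𝕜) =
      sMat !![1, 0; t * b, 1] 0 0 0 := by
    rw [stabPair_fst, h1, sMat_eq_lower]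
  have g2 : ((stabPair (normalForm a b c) (t • stabLower b) hK).2 : Matrix (Fin 6) (Fin 6) 𝕜) =
      sMat !![1, 0; 0, 1] !![-(t * a), 0; 0, 0] !![0, 0; 0, -(t * b)] !![0, 0; -(t * (b * c)), 0] := by
    rw [stabPair_snd, h2, sMat_eq_upper]
    simp only [single_neg_eq, Matrix.transpose_sub, Matrix.transpose_one, Matrix.transpose_add,
      Matrix.transpose_single]
    abel
  have s1 := hasShapeS_sMat !![1, 0; t * b, 1] 0 0 0
  have s2 := hasShapeS_sMat !![1, 0; 0, 1] !![-(t * a), 0; 0, 0] !![0, 0; 0, -(t * b)]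
    !![0, 0; -(t * (b * c)), 0]
  rw [← g1] at s1
  rw [← g2] at s2
  have hm : stabPair (normalForm a b c) (t • stabLower b) hK ∈ groupH 𝕜 := ⟨s1, s2⟩
  refine ⟨hK, hm, ?_⟩
  rw [chiH_apply, chiS_of_sMat (g := ⟨_, s1⟩) ψ χ₀ g1 (by simp [Matrix.det_fin_two]) rfl,
    chiS_of_sMat (g := ⟨_, s2⟩) ψ χ₀ g2 (by simp [Matrix.det_fin_two]) rfl, ← map_mul,
    ← AddChar.map_add_eq_mul]
  congr 2
  simp [Matrix.trace_fin_two, Matrix.adjugate_fin_two]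
  ring

/-- The roles of the two components are exchanged, so `c` takes the place of `b` and the sign
changes. -/
theorem exists_stabUpper (ψ : AddChar 𝕜 Circle) (χ₀ : 𝕜ˣ →* ℂˣ) (a b c t : 𝕜) :
    ∃ (hK : (t • stabUpper c) * normalForm a b c * (t • stabUpper c) = 0)
      (hm : stabPair (normalForm a b c) (t • stabUpper c) hK ∈ groupH 𝕜),
      chiH ψ χ₀ ⟨_, hm⟩ = Circle.toUnits (ψ (t * (a + c))) := by
  have h1 : normalForm a b c * (t • stabUpper c) =
      single 0 2 (t * a) + single 1 4 (t * (b * c)) + single 3 5 (t * c) := by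
    rw [normalForm_eq, stabUpper]
    simp [add_mul, mul_add, mul_comm a, mul_left_comm b]
  have h2 : (t • stabUpper c) * normalForm a b c =
      single 0 1 (t * c) + single 2 3 (t * c) + single 4 5 (t * c) := by
    rw [normalForm_eq, stabUpper]
    simp [add_mul, mul_add]
  have hK : (t • stabUpper c) * normalForm a b c * (t • stabUpper c) = 0 := by
    rw [h2]
    simp [stabUpper, add_mul, mul_add]
  have g1 : ((stabPair (normalForm a b c) (t • stabUpper c) hK).1 : Matrix (Fin 6) (Fin 6) 𝕜) =
      sMat !![1, 0; 0, 1] !![t * a, 0; 0, 0] !![0, 0; 0, t * c] !![0, 0; t * (b * c), 0] := by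
    rw [stabPair_fst, h1, sMat_eq_upper]
  have g2 : ((stabPair (normalForm a b c) (t • stabUpper c) hK).2 : Matrix (Fin 6) (Fin 6) 𝕜) =
      sMat !![1, 0; -(t * c), 1] 0 0 0 := by
    rw [stabPair_snd, h2, sMat_eq_lower]
    simp only [single_neg_eq, Matrix.transpose_sub, Matrix.transpose_one, Matrix.transpose_add,
      Matrix.transpose_single]
    abel
  have s1 := hasShapeS_sMat !![1, 0; 0, 1] !![t * a, 0; 0, 0] !![0, 0; 0, t * c]
    !![0, 0; t * (b * c), 0]
  have s2 := hasShapeS_sMat !![1, 0; -(t * c), 1] 0 0 0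
  rw [← g1] at s1
  rw [← g2] at s2
  have hm : stabPair (normalForm a b c) (t • stabUpper c) hK ∈ groupH 𝕜 := ⟨s1, s2⟩
  refine ⟨hK, hm, ?_⟩
  rw [chiH_apply, chiS_of_sMat (g := ⟨_, s1⟩) ψ χ₀ g1 (by simp [Matrix.det_fin_two]) rfl,
    chiS_of_sMat (g := ⟨_, s2⟩) ψ χ₀ g2 (by simp [Matrix.det_fin_two]) rfl, ← map_mul,
    ← AddChar.map_add_eq_mul]
  congr 2
  simp [Matrix.trace_fin_two, Matrix.adjugate_fin_two]
  ring

theorem contDiff_single (i j : Fin 6) :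
    ContDiff ℝ ∞ fun r : 𝕜 => (single i j r : Matrix (Fin 6) (Fin 6) 𝕜) :=
  (LinearMap.toContinuousLinearMap
    (Matrix.singleLinearMap ℝ i j : 𝕜 →ₗ[ℝ] Matrix (Fin 6) (Fin 6) 𝕜)).contDiff

theorem contDiff_stabLower : ContDiff ℝ ∞ (stabLower (𝕜 := 𝕜)) :=
  (contDiff_const.add (contDiff_single (𝕜 := 𝕜) 4 2)).add (contDiff_single 5 4)

theorem contDiff_stabUpper : ContDiff ℝ ∞ (stabUpper (𝕜 := 𝕜)) :=
  (contDiff_const.add (contDiff_single (𝕜 := 𝕜) 2 4)).add (contDiff_single 4 5)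

theorem isSubmanifold_locus4_diff : IsSubmanifold (locus4 𝕜 \ locus5 𝕜) := by
  have e : locus4 𝕜 \ locus5 𝕜 = locus4 𝕜 ∩ {x : Matrix (Fin 6) (Fin 6) 𝕜 |
      kroneckerMap (· * ·) (invA x) (invB' x) = kroneckerMap (· * ·) (invB x) (invA' x)}ᶜ := by
    ext x
    simp [locus5]
  rw [e]
  exact isSubmanifold_locus4_inter isClosed_equation5.isOpen_compl

/-- Open parts of `slice64''` are slices of the stratum outside of `locus5`. -/
theorem slice_locus4_diff {U : Set (Matrix (Fin 6) (Fin 6) 𝕜)} (hU : IsOpen U)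
    (h : ∀ x ∈ U, x 1 2 ≠ x 2 1) : slice64'' 𝕜 ∩ U ⊆ locus4 𝕜 \ locus5 𝕜 ∧
      IsSubmanifold (slice64'' 𝕜 ∩ U) ∧
      ∀ y ∈ slice64'' 𝕜 ∩ U, ∀ v ∈ tangentSpaceOf (locus4 𝕜 \ locus5 𝕜) y,
        ∃ X, IsLieTangent (groupH 𝕜) X ∧
          v - (X.1 * y + y * X.2ᵀ) ∈ tangentSpaceOf (slice64'' 𝕜 ∩ U) y := by
  refine ⟨fun x hx => ⟨(mem_slice64'_iff hx.1.1.1).1 hx.1.1, fun h5 => ?_⟩,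
    isSubmanifold_slice64''_inter hU, fun y hy v hv => ?_⟩
  · exact h x hx.2 ((mem_slice65''_iff hx.1).2 h5).2
  · obtain ⟨X, hX, hX'⟩ := transversal_slice64'' hy.1
      (tangentSpaceOf_mono Set.sdiff_subset y hv)
    exact ⟨X, hX, mem_tangentSpaceOf_slice64'' hU hy hX'⟩

theorem isUnipotentlyIncompatible_locus4_diff {ψ : AddChar 𝕜 Circle} (hψ : ψ ≠ 1)
    (χ₀ : 𝕜ˣ →* ℂˣ) :
    IsUnipotentlyIncompatible (groupH 𝕜) (chiH ψ χ₀) (locus4 𝕜 \ locus5 𝕜) := by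
  obtain ⟨s, hs⟩ : ∃ s, ψ s ≠ 1 := by
    by_contra! h'
    exact hψ (DFunLike.ext _ _ h')
  have hE : ∀ i j : Fin 6, ContDiff ℝ ∞ fun x : Matrix (Fin 6) (Fin 6) 𝕜 => x i j :=
    contDiff_entry
  have hcont : ∀ i j : Fin 6, Continuous fun x : Matrix (Fin 6) (Fin 6) 𝕜 => x i j :=
    fun i j => (hE i j).continuous
  refine isUnipotentlyIncompatible_of_slices isSubmanifold_locus4_diff
    (isStable_locus4.diff isStable_locus5) fun z hz => ?_
  obtain ⟨h, hh, hy⟩ := exists_act_slice64'' hz.1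
  have hne : act h z 1 2 ≠ act h z 2 1 := fun h0 =>
    (isStable_locus4.diff isStable_locus5 h hh z hz).2 ((mem_slice65''_iff hy).1 ⟨hy, h0⟩)
  refine ⟨h, hh, ?_⟩
  -- If `a + b = 0` and `a + c = 0`, then `b = c`, which is excluded off `locus5`. So one of the two
  -- families works near the given point, and the slice is shrunk to the open set where its
  -- denominator is nonzero.
  by_cases h0 : act h z 0 0 + act h z 1 2 ≠ 0
  · have hU : IsOpen {x : Matrix (Fin 6) (Fin 6) 𝕜 | x 1 2 ≠ x 2 1 ∧ x 0 0 + x 1 2 ≠ 0} :=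
      (isOpen_ne_fun (hcont 1 2) (hcont 2 1)).inter
        (isOpen_ne_fun ((hcont 0 0).add (hcont 1 2)) continuous_const)
    obtain ⟨h1, h2, h3⟩ := slice_locus4_diff hU fun x hx => hx.1
    refine ⟨slice64'' 𝕜 ∩ {x | x 1 2 ≠ x 2 1 ∧ x 0 0 + x 1 2 ≠ 0},
      fun x => (-s / (x 0 0 + x 1 2)) • stabLower (x 1 2), ⟨hy, hne, h0⟩, h1, h2, h3, ?_,
      fun y hy => ?_⟩
    · have hc : ContDiffOn ℝ ∞
          (fun x : Matrix (Fin 6) (Fin 6) 𝕜 => -s / (x 0 0 + x 1 2))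
          (slice64'' 𝕜 ∩ {x | x 1 2 ≠ x 2 1 ∧ x 0 0 + x 1 2 ≠ 0}) := by
        simp only [div_eq_mul_inv]
        exact contDiffOn_const.mul (((hE 0 0).add (hE 1 2)).contDiffOn.inv
          fun x hx => hx.2.2)
      exact hc.smul (contDiff_stabLower.comp (hE 1 2)).contDiffOn
    · obtain ⟨hy1, -, hy2⟩ := hy
      have key := exists_stabLower ψ χ₀ (y 0 0) (y 1 2) (y 2 1) (-s / (y 0 0 + y 1 2))
      rw [← (mem_slice64''_iff.1 hy1).2] at key
      obtain ⟨hK, hm, hχ⟩ := key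
      refine ⟨hK, hm, ?_⟩
      rw [hχ, div_mul_cancel₀ _ hy2, neg_neg]
      exact toUnits_ne_one hs
  · have h0' : act h z 0 0 + act h z 2 1 ≠ 0 := fun h1 =>
      hne (add_left_cancel ((not_not.1 h0).trans h1.symm))
    have hU : IsOpen {x : Matrix (Fin 6) (Fin 6) 𝕜 | x 1 2 ≠ x 2 1 ∧ x 0 0 + x 2 1 ≠ 0} :=
      (isOpen_ne_fun (hcont 1 2) (hcont 2 1)).inter
        (isOpen_ne_fun ((hcont 0 0).add (hcont 2 1)) continuous_const)
    obtain ⟨h1, h2, h3⟩ := slice_locus4_diff hU fun x hx => hx.1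
    refine ⟨slice64'' 𝕜 ∩ {x | x 1 2 ≠ x 2 1 ∧ x 0 0 + x 2 1 ≠ 0},
      fun x => (s / (x 0 0 + x 2 1)) • stabUpper (x 2 1), ⟨hy, hne, h0'⟩, h1, h2, h3, ?_,
      fun y hy => ?_⟩
    · have hc : ContDiffOn ℝ ∞
          (fun x : Matrix (Fin 6) (Fin 6) 𝕜 => s / (x 0 0 + x 2 1))
          (slice64'' 𝕜 ∩ {x | x 1 2 ≠ x 2 1 ∧ x 0 0 + x 2 1 ≠ 0}) := by
        simp only [div_eq_mul_inv]
        exact contDiffOn_const.mul (((hE 0 0).add (hE 2 1)).contDiffOn.inv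
          fun x hx => hx.2.2)
      exact hc.smul (contDiff_stabUpper.comp (hE 2 1)).contDiffOn
    · obtain ⟨hy1, -, hy2⟩ := hy
      have key := exists_stabUpper ψ χ₀ (y 0 0) (y 1 2) (y 2 1) (s / (y 0 0 + y 2 1))
      rw [← (mem_slice64''_iff.1 hy1).2] at key
      obtain ⟨hK, hm, hχ⟩ := key
      refine ⟨hK, hm, ?_⟩
      rw [hχ, div_mul_cancel₀ _ hy2]
      exact toUnits_ne_one hs

theorem strata_filtration6 {ψ : AddChar 𝕜 Circle} (hψ : ψ ≠ 1)
    (χ₀ : 𝕜ˣ →* ℂˣ) : ∀ i ≤ 5,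
      (Even i → IsUnipotentlyIncompatible (groupH 𝕜) (chiH ψ χ₀)
        (filtration6 𝕜 i \ filtration6 𝕜 (i + 1))) ∧
      (Odd i → IsMetricallyProper (filtration6 𝕜 i \ filtration6 𝕜 (i + 1))) := by
  obtain ⟨e0, e1, e2, e3, e4, e5, e6⟩ := filtration6_eq (𝕜 := 𝕜)
  intro i hi
  interval_cases i
  · rw [e0, e1]
    exact ⟨fun _ => isUnipotentlyIncompatible_locus0_diff hψ χ₀, fun h => absurd h (by decide)⟩
  · rw [e1, e2]
    exact ⟨fun h => absurd h (by decide), fun _ => isMetricallyProper_locus1_diff⟩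
  · rw [e2, e3]
    exact ⟨fun _ => isUnipotentlyIncompatible_locus2_diff hψ χ₀, fun h => absurd h (by decide)⟩
  · rw [e3, e4]
    exact ⟨fun h => absurd h (by decide), fun _ => isMetricallyProper_locus3_diff⟩
  · rw [e4, e5]
    exact ⟨fun _ => isUnipotentlyIncompatible_locus4_diff hψ χ₀, fun h => absurd h (by decide)⟩
  · rw [e5, e6, Set.sdiff_empty]
    exact ⟨fun h => absurd h (by decide), fun _ => isMetricallyProper_locus5⟩

end NormalFormStabilizers

end GinzburgRallis

end

open GinzburgRallis

theorem mainTheorem9 {𝕜 : Type*} [RCLike 𝕜]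
    (ψ : AddChar 𝕜 Circle) (hψ : Continuous ψ) (hψ' : ψ ≠ 1)
    (χ₀ : 𝕜ˣ →* ℂˣ) (hχ₀ : Continuous χ₀) :
    IsSubmanifold (Z6 𝕜) ∧
    HasUChiM (groupH 𝕜) (chiH ψ χ₀) (Z6 𝕜) ∧
    IsStableClosedFiltration (groupH 𝕜) (Z6 𝕜) 5 (filtration6 𝕜) ∧
    ∀ i ≤ 5,
      (Even i → IsUnipotentlyIncompatible (groupH 𝕜) (chiH ψ χ₀)
        (filtration6 𝕜 i \ filtration6 𝕜 (i + 1))) ∧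
      (Odd i → IsMetricallyProper (filtration6 𝕜 i \ filtration6 𝕜 (i + 1))) := by
  have hs := strata_filtration6 (𝕜 := 𝕜) hψ' χ₀
  have hZ : Z6 𝕜 = locus0 𝕜 := Z6_eq_locus0
  refine ⟨?_, ⟨?_, ?_, ?_, 5, filtration6 𝕜, isStableClosedFiltration_filtration6,
    fun i hi => ?_⟩, isStableClosedFiltration_filtration6, hs⟩
  · rw [hZ, ← Set.inter_univ (locus0 𝕜)]
    exact isSubmanifold_locus0_inter isOpen_univ
  · exact fun z hz => hz.1
  · rw [hZ]
    exact isStable_locus0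
  · rw [hZ]
    exact isLocallyClosed_locus0
  · obtain ⟨h1, h2⟩ := hs i hi
    rcases Nat.even_or_odd i with he | ho
    · exact ⟨(h1 he).1, Or.inl (h1 he)⟩
    · exact ⟨(h2 ho).1, Or.inr (h2 ho)⟩
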